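/- Let $\omega$ be the exponent of matrix multiplication over $\mathbb{Q}$, that is, the infimum of all real $\tau$ such that two $n\times n$ matrices over $\mathbb{Q}$ can be multiplied with $O(n^{\tau})$ arithmetic operations (additions, subtractions, multiplications in a straight-line computation). Let $G=(V,A)$ be a directed graph without loops and parallel arcs (both $(u,v)$ and $(v,u)$ may be arcs), and let $n=|V|$. For an ordering $\pi\colon V\to\{1,\dots,n\}$ (a bijection) and an integer $i$, let $\mathrm{cut}^i_\pi=\{(u,v)\in A : \pi(u)>i \text{ and } \pi(v)\le i\}$. The width of $\pi$ is $\max_{1\le i\le n-1}|\mathrm{cut}^i_\pi|$ (it is $0$ if $n\le 1$), and the directed cutwidth of $G$ is the minimum width of an ordering of $V$. \textbf{Proposition.} \textsc{Directed Cutwidth} can be $2$-approximated in $O^*(2^{\omega n/3})$ time, where, as usual for running times in terms of the infimum $\omega$, this means time $O^*(2^{(\omega+\varepsilon)n/3})$ for every fixed $\varepsilon>0$. Precisely: for every $\varepsilon>0$ there are a deterministic algorithm (a program of a random access machine with logarithmic cost) and constants $K$ and $c$ such that, given the adjacency matrix of any directed graph $G$ on $n\ge 0$ vertices as above, the algorithm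 halts within time $K\,(n+1)^c\,2^{(\omega+\varepsilon)n/3}$ and outputs an ordering $\pi$ whose width is at most twice the directed cutwidth of $G$. Moreover, the ordering that it outputs is always of the following form: there is a set $L\subseteq V$ with $|L|=\lfloor n/2\rfloor$ that minimizes the number of arcs from $V\setminus L$ to $L$ among all sets of $\lfloor n/2\rfloor$ vertices, and $\pi$ lists first the vertices of $L$, in an order of minimum width for the induced subgraph $G[L]$, and then the vertices of $V\setminus L$, in an order of minimum width for $G[V\setminus L]$. -/

import Mathlib

namespace DirCutwidth

/-! ### Directed graphs, orderings, directed cutwidth -/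

section Graphs

variable {V : Type*} [Fintype V]

/-- An ordering of `V`: a bijection between `V` and the positions. The vertex `v` has position
`π v + 1` in the numbering `1, …, n` of the positions. -/
abbrev Ordering (V : Type*) [Fintype V] : Type _ := V ≃ Fin (Fintype.card V)

/-- The cut at position `i`: the arcs from a vertex after position `i` to a vertex at position at
most `i`, where positions are numbered from `1`. -/
def cut (G : Digraph V) (π : Ordering V) (i : ℕ) : Set (V × V) :=
  {a | G.Adj a.1 a.2 ∧ i < (π a.1 : ℕ) + 1 ∧ (π a.2 : ℕ) + 1 ≤ i}

/-- The width of an ordering: the largest size of a cut at a position in `{1, …, n - 1}`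
(and `0` if there is no such position). -/
noncomputable def width (G : Digraph V) (π : Ordering V) : ℕ :=
  (Finset.Icc 1 (Fintype.card V - 1)).sup fun i => (cut G π i).ncard

/-- The directed cutwidth: the smallest width of an ordering. -/
noncomputable def dirCutwidth (G : Digraph V) : ℕ := ⨅ π : Ordering V, width G π

/-- The subgraph of `G` induced by `S`. -/
def induced (G : Digraph V) (S : Finset V) : Digraph S where
  Adj u v := G.Adj u v

/-- The number of arcs from the complement of `L` to `L`. -/
noncomputable def cutSize (G : Digraph V) (L : Finset V) : ℕ :=
  {a : V × V | G.Adj a.1 a.2 ∧ a.1 ∉ L ∧ a.2 ∈ L}.ncard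

/-- `L` is an optimal directed `(k, n - k)`-cut. -/
def IsMinCut (G : Digraph V) (k : ℕ) (L : Finset V) : Prop :=
  L.card = k ∧ ∀ L' : Finset V, L'.card = k → cutSize G L ≤ cutSize G L'

/-- `π` lists the vertices of `L` in the order `πL`, and after them all other vertices in the
order `πR`. -/
def IsConcat [DecidableEq V] (π : Ordering V) (L : Finset V) (πL : Ordering L)
    (πR : Ordering (Lᶜ : Finset V)) : Prop :=
  (∀ v : L, (π v : ℕ) = πL v) ∧ (∀ v : (Lᶜ : Finset V), (π v : ℕ) = L.card + πR v)

end Graphs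

/-! ### The exponent of matrix multiplication -/

section MatrixMultiplication

open MvPolynomial

variable {ι : Type*}

/-- What a straight-line computation may use at time `t` for free: the scalars, the inputs, and
the results of the operations `0, …, t - 1`. -/
def Available (s : ℕ → MvPolynomial ι ℚ) (t : ℕ) (f : MvPolynomial ι ℚ) : Prop :=
  (∃ c : ℚ, f = C c) ∨ (∃ x : ι, f = X x) ∨ ∃ j < t, f = s j

/-- `s 0, …, s (t - 1)` are the results of a straight-line computation with `t` arithmetic
operations (additions, subtractions, multiplications). -/
def IsStraightLine (s : ℕ → MvPolynomial ι ℚ) (t : ℕ) : Prop :=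
  ∀ k < t, ∃ f g, Available s k f ∧ Available s k g ∧ (s k = f + g ∨ s k = f - g ∨ s k = f * g)

/-- Two `n × n` matrices (of indeterminates) over `ℚ` can be multiplied with `t` arithmetic
operations. The entries of the factors are the inputs `Sum.inl (i, j)` and `Sum.inr (i, j)`. -/
def MatMulWith (n t : ℕ) : Prop :=
  ∃ s : ℕ → MvPolynomial ((Fin n × Fin n) ⊕ (Fin n × Fin n)) ℚ, IsStraightLine s t ∧
    ∀ i j : Fin n, Available s t (∑ l : Fin n, X (Sum.inl (i, l)) * X (Sum.inr (l, j)))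

/-- The exponent `ω` of matrix multiplication: the infimum of all `τ` such that `n × n` matrices
can be multiplied with `O(n ^ τ)` arithmetic operations. -/
noncomputable def omega : ℝ :=
  sInf {τ : ℝ | ∃ K : ℝ, ∀ n : ℕ, 1 ≤ n → ∃ t : ℕ, MatMulWith n t ∧ (t : ℝ) ≤ K * (n : ℝ) ^ τ}

end MatrixMultiplication

/-! ### Random access machines with logarithmic cost -/

/-- The memory: cells `0, 1, 2, …`, each of which holds a natural number. -/
abbrev Mem : Type := ℕ → ℕ

/-- Arithmetic expressions. `load e` is the content of the cell whose address is the value of `e`;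
`sub` is truncated subtraction, `div` is division with rounding down (by `0` it gives `0`). -/
inductive Expr : Type
  | const (k : ℕ)
  | load (e : Expr)
  | add (a b : Expr)
  | sub (a b : Expr)
  | mul (a b : Expr)
  | div (a b : Expr)

/-- The value of an expression. -/
def Expr.eval (m : Mem) : Expr → ℕ
  | .const k => k
  | .load e => m (e.eval m)
  | .add a b => a.eval m + b.eval m
  | .sub a b => a.eval m - b.eval m
  | .mul a b => a.eval m * b.eval m
  | .div a b => a.eval m / b.eval m

/-- The logarithmic cost of evaluating an expression: each constant, memory access and operation
costs `1` plus the number of bits of its result, in addition to the cost of computing its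
operands or its address (so that the bits of those are paid for as well). -/
def Expr.cost (m : Mem) : Expr → ℕ
  | .const k => 1 + k.size
  | .load e => e.cost m + (1 + (m (e.eval m)).size)
  | .add a b => a.cost m + b.cost m + (1 + (a.eval m + b.eval m).size)
  | .sub a b => a.cost m + b.cost m + (1 + (a.eval m - b.eval m).size)
  | .mul a b => a.cost m + b.cost m + (1 + (a.eval m * b.eval m).size)
  | .div a b => a.cost m + b.cost m + (1 + (a.eval m / b.eval m).size)

/-- Programs. `store a e` writes the value of `e` into the cell whose address is the value of `a`;
a test `c` counts as true if its value is not `0`. -/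
inductive Prog : Type
  | skip
  | store (a e : Expr)
  | seq (p q : Prog)
  | cond (c : Expr) (p q : Prog)
  | loop (c : Expr) (p : Prog)

/-- `Exec p m t m'`: started on the memory `m`, the program `p` halts with the memory `m'` after
time `t` (logarithmic cost). -/
inductive Exec : Prog → Mem → ℕ → Mem → Prop
  | skip (m : Mem) : Exec .skip m 1 m
  | store (a e : Expr) (m : Mem) :
      Exec (.store a e) m (a.cost m + e.cost m + 1) (Function.update m (a.eval m) (e.eval m))
  | seq {p q : Prog} {m m' m'' : Mem} {t t' : ℕ} :
      Exec p m t m' → Exec q m' t' m'' → Exec (.seq p q) m (t + t') m''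
  | cond_true {c : Expr} {p q : Prog} {m m' : Mem} {t : ℕ} :
      c.eval m ≠ 0 → Exec p m t m' → Exec (.cond c p q) m (c.cost m + 1 + t) m'
  | cond_false {c : Expr} {p q : Prog} {m m' : Mem} {t : ℕ} :
      c.eval m = 0 → Exec q m t m' → Exec (.cond c p q) m (c.cost m + 1 + t) m'
  | loop_true {c : Expr} {p : Prog} {m m' m'' : Mem} {t t' : ℕ} :
      c.eval m ≠ 0 → Exec p m t m' → Exec (.loop c p) m' t' m'' →
        Exec (.loop c p) m (c.cost m + 1 + t + t') m''
  | loop_false {c : Expr} {p : Prog} {m : Mem} :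
      c.eval m = 0 → Exec (.loop c p) m (c.cost m + 1) m

open Classical in
/-- The input: cell `0` holds the number `n` of vertices, cells `1, …, n ^ 2` hold the adjacency
matrix row by row, and all other cells hold `0`. -/
noncomputable def graphInput {n : ℕ} (G : Digraph (Fin n)) : Mem := fun x =>
  if x = 0 then n
  else if ∃ i j : Fin n, x = 1 + (i : ℕ) * n + j ∧ G.Adj i j then 1 else 0

/-- The output: cell `v` holds the position of the vertex `v`, counted from `0`. -/
def IsOutput {n : ℕ} (m : Mem) (π : Ordering (Fin n)) : Prop :=
  ∀ v : Fin n, m v = π v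

end DirCutwidth

namespace DirCutwidth

/-! Approximation. In an optimal ordering the first `⌊n/2⌋` vertices form a set of the right size,
so a minimum balanced cut `L` has at most `dirCutwidth G` entering arcs (`cutSize_le_dirCutwidth`).
An ordering of `G` restricts to both sides, so their cutwidths are at most that of `G`
(`dirCutwidth_induced_le`). An arc cut by the concatenation either stays on one side or enters `L`
(`width_concat_le`), which gives the factor two.

Finding `L`. The vertices are split into three blocks of `h` vertices, `h` about `n / 3`, and a
vertex set becomes a triple `(x, y, z)` of subsets of the blocks. Every pair of vertices meets at
most two blocks, so the number of entering arcs plus a large multiple of the number of chosen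
vertices is a sum `expA x y + expB y z + expC x z` (`expA_add_expB_add_expC`). The entry `(x, z)` of
the product of the matrices `X ^ expA x y` and `X ^ expB y z` is a generating function over `y`. If
the base `X` is so large that no carries occur, its digits show which sums occur for some `y`
(`digit_ne_zero_iff`). Hence one product of `2 ^ h × 2 ^ h` matrices replaces the enumeration of all
triples.

Multiplying. For fixed `ε` a matrix size `2 ^ q` is chosen for which a straight-line computation of
length close to `(2 ^ q) ^ omega` exists. Its second-order part is a bilinear algorithm with `R ≤ (2
^ q) ^ (omega + ε)` products (`exists_bilinearAlgorithm_rpow`), a finite object that can be built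
into a program. Its `d`-th tensor power multiplies matrices of size `2 ^ (q * d)`, where `q * d =
h`, with `R ^ d` products. Yates' algorithm applies the linear maps on both ends, one tensor factor
at a time (`yates_eq_sum`). Clearing denominators multiplies the result by `D ^ d`, which is
harmless because only the vanishing of digits matters. All arithmetic is done modulo a power of two
that exceeds the true entries.

Ordering the sides. Dynamic programming over the subsets of each half gives optimal orderings in
time about `2 ^ (n / 2)`, which is less than the size of the matrices.

The machine. Every quantity is an entry of one of twenty tables, given by an expression with bounded
sums and searches in earlier entries. `TExpr.exec_comp` compiles such an expression at a cost
polynomial in the number of bits, so the time is the size of the largest table up to polynomial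
factors (`exists_prog_of_tables`). That size is about `R ^ d`, and `pow_depth_le` turns it into the
bound in terms of `omega`. -/

open Polynomial in
theorem polynomial_eval_mono (p : Polynomial ℕ) {s t : ℕ} (h : s ≤ t) :
    p.eval s ≤ p.eval t := by
  induction p using Polynomial.induction_on' with
  | add p q hp hq => simp only [eval_add]; omega
  | monomial n a => simp only [eval_monomial]; gcongr

/-! ### Sizes of numbers -/

theorem size_le_self (a : ℕ) : a.size ≤ a := Nat.size_le.2 Nat.lt_two_pow_self

theorem size_mul_le (a b : ℕ) : (a * b).size ≤ a.size + b.size := by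
  rw [Nat.size_le, pow_add]
  exact Nat.mul_lt_mul'' (Nat.lt_size_self a) (Nat.lt_size_self b)

theorem size_add_le (a b : ℕ) : (a + b).size ≤ a.size + b.size + 1 := by
  rw [Nat.size_le, pow_succ, pow_add]
  have ha := Nat.lt_size_self a
  have hb := Nat.lt_size_self b
  have h1 : 1 ≤ 2 ^ a.size := Nat.one_le_two_pow
  have h2 : 1 ≤ 2 ^ b.size := Nat.one_le_two_pow
  nlinarith

/-! ### Loop bounds: expressions in the number of vertices -/

/-- Expressions in the content `n` of cell `0`, used as bounds of loops. -/
inductive Bound : Type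
  | const (k : ℕ)
  | n
  | add (a b : Bound)
  | mul (a b : Bound)
  | div (a b : Bound)

/-- The value of a loop bound. -/
def Bound.val (n : ℕ) : Bound → ℕ
  | .const k => k
  | .n => n
  | .add a b => a.val n + b.val n
  | .mul a b => a.val n * b.val n
  | .div a b => a.val n / b.val n

/-- A loop bound as an expression of the machine. -/
def Bound.toExpr : Bound → Expr
  | .const k => .const k
  | .n => .load (.const 0)
  | .add a b => .add a.toExpr b.toExpr
  | .mul a b => .mul a.toExpr b.toExpr
  | .div a b => .div a.toExpr b.toExpr

theorem Bound.eval_toExpr (B : Bound) (m : Mem) : B.toExpr.eval m = B.val (m 0) := by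
  induction B <;> simp_all [Bound.toExpr, Bound.val, Expr.eval]

/-- A number has at most as many bits as its value, so one polynomial can dominate both the value of
a bound and the cost of evaluating it. Loops governed by bounds therefore contribute only polynomial
factors. -/
theorem Bound.exists_poly (B : Bound) : ∃ p : Polynomial ℕ, ∀ s n m, n ≤ s → m 0 = n →
    B.val n ≤ p.eval s ∧ B.toExpr.cost m ≤ p.eval s := by
  have key : ∀ a b c x y : ℕ, c ≤ x → c ≤ y → c ≤ x + y + a * b := by intros; omega
  induction B with
  | const k => exact ⟨.C (k + 1), fun s n m _ _ => by
      have := size_le_self k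
      simp [Bound.val, Bound.toExpr, Expr.cost]; omega⟩
  | n => exact ⟨.X + .C 2, fun s n m hn h0 => by
      have := size_le_self n
      simp [Bound.val, Bound.toExpr, Expr.cost, Expr.eval, h0]; omega⟩
  | add a b ha hb =>
    obtain ⟨p, hp⟩ := ha
    obtain ⟨q, hq⟩ := hb
    refine ⟨2 * p + 2 * q + .C 1, fun s n m hn h0 => ?_⟩
    have h1 := hp s n m hn h0
    have h2 := hq s n m hn h0
    have := size_le_self (a.val n + b.val n)
    simp [Bound.val, Bound.toExpr, Expr.cost, Bound.eval_toExpr, h0]; omega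
  | mul a b ha hb =>
    obtain ⟨p, hp⟩ := ha
    obtain ⟨q, hq⟩ := hb
    refine ⟨p + q + p * q + .C 1, fun s n m hn h0 => ?_⟩
    have h1 := hp s n m hn h0
    have h2 := hq s n m hn h0
    have := size_le_self (a.val n * b.val n)
    have := Nat.mul_le_mul h1.1 h2.1
    simp [Bound.val, Bound.toExpr, Expr.cost, Bound.eval_toExpr, h0]; omega
  | div a b ha hb =>
    obtain ⟨p, hp⟩ := ha
    obtain ⟨q, hq⟩ := hb
    refine ⟨2 * p + q + .C 1, fun s n m hn h0 => ?_⟩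
    have h1 := hp s n m hn h0
    have h2 := hq s n m hn h0
    have := size_le_self (a.val n / b.val n)
    have := Nat.div_le_self (a.val n) (b.val n)
    simp [Bound.val, Bound.toExpr, Expr.cost, Bound.eval_toExpr, h0]; omega

/-! ### Table expressions -/

/-- The abstract memory: arrays `0, 1, 2, …` of natural numbers. Array `0` holds the loop
variables. -/
abbrev State : Type := ℕ → ℕ → ℕ

/-- Expressions over arrays, with bounded sums and bounded searches. -/
inductive TExpr : Type
  | const (k : ℕ)
  | inp (e : TExpr)
  | arr (a : ℕ) (e : TExpr)
  | add (a b : TExpr)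
  | sub (a b : TExpr)
  | mul (a b : TExpr)
  | div (a b : TExpr)
  | fold (search : Bool) (x : ℕ) (N : Bound) (e : TExpr)

/-- Assign the value `j` to the variable `x`. -/
def setVar (σ : State) (x j : ℕ) : State := Function.update σ 0 (Function.update (σ 0) x j)

@[simp] theorem setVar_same (σ : State) (x j : ℕ) : setVar σ x j 0 x = j := by simp [setVar]

theorem setVar_var (σ : State) (x j y : ℕ) :
    setVar σ x j 0 y = if y = x then j else σ 0 y := by simp [setVar, Function.update_apply]

@[simp] theorem setVar_arr (σ : State) (x j a : ℕ) (ha : a ≠ 0) : setVar σ x j a = σ a := by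
  simp [setVar, ha]

/-- One step of a bounded sum or of a bounded search. -/
def foldStep (search : Bool) (acc j g : ℕ) : ℕ :=
  bif search then acc + (1 - (j - acc)) * (1 - g) else acc + g

/-- A bounded sum or a bounded search. -/
def foldVal (search : Bool) (g : ℕ → ℕ) : ℕ → ℕ
  | 0 => 0
  | N + 1 => foldStep search (foldVal search g N) N (g N)

theorem foldVal_sum (g : ℕ → ℕ) (N : ℕ) : foldVal false g N = ∑ j ∈ Finset.range N, g j := by
  induction N with
  | zero => rfl
  | succ N ih => rw [Finset.sum_range_succ, ← ih]; rfl

theorem foldVal_congr {b : Bool} {g g' : ℕ → ℕ} {N : ℕ} (h : ∀ j < N, g j = g' j) :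
    foldVal b g N = foldVal b g' N := by
  induction N with
  | zero => rfl
  | succ N ih => rw [foldVal, foldVal, ih fun j hj => h j (by omega), h N (by omega)]

/-- The accumulator equals the running index as long as only zeros have been seen, and then `1 - (j
- acc)` is `1`. After the first nonzero term it lags behind the index and is frozen. The value `N`
means that the search failed. -/
theorem foldVal_search (g : ℕ → ℕ) (N : ℕ) :
    foldVal true g N ≤ N ∧ (∀ j < foldVal true g N, g j = 0) ∧
      (foldVal true g N < N → g (foldVal true g N) ≠ 0) := by
  induction N with
  | zero => simp [foldVal]
  | succ N ih =>
    obtain ⟨h1, h2, h3⟩ := ih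
    rcases Nat.lt_or_ge (foldVal true g N) N with h | h
    · have : foldVal true g (N + 1) = foldVal true g N := by
        simp only [foldVal, foldStep, cond_true]
        rw [Nat.sub_eq_zero_of_le (by omega : 1 ≤ N - foldVal true g N)]; simp
      rw [this]
      exact ⟨by omega, h2, fun _ => h3 h⟩
    · have h4 : foldVal true g N = N := by omega
      rw [h4] at h2
      by_cases hg : g N = 0
      · have : foldVal true g (N + 1) = N + 1 := by simp [foldVal, foldStep, h4, hg]
        rw [this]
        refine ⟨le_rfl, fun j hj => ?_, by omega⟩
        rcases Nat.lt_succ_iff_lt_or_eq.1 hj with h | rfl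
        · exact h2 j h
        · exact hg
      · have : foldVal true g (N + 1) = N := by
          have : 1 - g N = 0 := by omega
          simp [foldVal, foldStep, h4, this]
        rw [this]
        exact ⟨by omega, h2, fun _ => hg⟩

/-- The value of a table expression. -/
def TExpr.eval (I : Mem) : TExpr → State → ℕ
  | .const k, _ => k
  | .inp e, σ => I (e.eval I σ * (1 - (e.eval I σ - I 0 * I 0)))
  | .arr a e, σ => σ a (e.eval I σ)
  | .add a b, σ => a.eval I σ + b.eval I σ
  | .sub a b, σ => a.eval I σ - b.eval I σ
  | .mul a b, σ => a.eval I σ * b.eval I σ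
  | .div a b, σ => a.eval I σ / b.eval I σ
  | .fold b x N e, σ => foldVal b (fun j => e.eval I (setVar σ x j)) (N.val (I 0))

theorem foldVal_lt {b : Bool} {g : ℕ → ℕ} {N P : ℕ} (h : ∀ j < N, g j < 2 ^ P) :
    foldVal b g N < 2 ^ (N + P) := by
  have h0 : N < 2 ^ N := Nat.lt_two_pow_self
  have h1 : 1 ≤ 2 ^ P := Nat.one_le_two_pow
  rw [pow_add]
  cases b with
  | true => have := (foldVal_search g N).1; nlinarith
  | false =>
    rw [foldVal_sum]
    have : ∑ j ∈ Finset.range N, g j ≤ ∑ j ∈ Finset.range N, 2 ^ P :=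
      Finset.sum_le_sum fun j hj => (h j (Finset.mem_range.1 hj)).le
    rw [Finset.sum_const, Finset.card_range, smul_eq_mul] at this
    nlinarith

/-- All numbers in the input and in the abstract memory have at most `s` bits, and there are at
most `s` vertices. -/
structure Bounded (s : ℕ) (I : Mem) (σ : State) : Prop where
  n_le : I 0 ≤ s
  inp_lt : ∀ x ≤ I 0 * I 0, I x < 2 ^ s
  arr_lt : ∀ a i, σ a i < 2 ^ s

theorem Bounded.mono {s s' : ℕ} {I : Mem} {σ : State} (h : Bounded s I σ) (hs : s ≤ s') :
    Bounded s' I σ := by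
  have h2 : 2 ^ s ≤ 2 ^ s' := Nat.pow_le_pow_right (by norm_num) hs
  exact ⟨h.1.trans hs, fun x hx => (h.2 x hx).trans_le h2, fun a i => (h.3 a i).trans_le h2⟩

theorem Bounded.setVar {s : ℕ} {I : Mem} {σ : State} (h : Bounded s I σ) {x j : ℕ}
    (hj : j < 2 ^ s) : Bounded s I (setVar σ x j) := by
  refine ⟨h.1, h.2, fun a i => ?_⟩
  by_cases ha : a = 0
  · subst ha; rw [setVar_var]; split
    exacts [hj, h.3 _ _]
  · rw [setVar_arr _ _ _ _ ha]; exact h.3 _ _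

/-- The factor sends every index beyond `N` to `0`. An `inp` expression thus never reads outside the
input region, the only cells for which `Represents` ties the machine to `I` rather than to an array.
-/
theorem guard_le (x N : ℕ) : x * (1 - (x - N)) ≤ N := by
  rcases Nat.lt_or_ge N x with h | h
  · rw [Nat.sub_eq_zero_of_le (by omega : 1 ≤ x - N)]; simp
  · rw [Nat.sub_eq_zero_of_le h]; simpa

theorem TExpr.exists_eval_lt (e : TExpr) : ∃ p : Polynomial ℕ, ∀ s I σ, Bounded s I σ →
    e.eval I σ < 2 ^ p.eval s := by
  induction e with
  | const k => exact ⟨.C k, fun s I σ _ => by simp [TExpr.eval, Nat.lt_two_pow_self]⟩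
  | inp e _ => exact ⟨.X, fun s I σ h => by simpa [TExpr.eval] using h.2 _ (guard_le _ _)⟩
  | arr a e _ => exact ⟨.X, fun s I σ h => by simpa [TExpr.eval] using h.3 _ _⟩
  | add a b ha hb =>
    obtain ⟨p, hp⟩ := ha
    obtain ⟨q, hq⟩ := hb
    refine ⟨p + q + .C 1, fun s I σ h => ?_⟩
    have h1 := hp s I σ h
    have h2 := hq s I σ h
    have h3 : 1 ≤ 2 ^ p.eval s := Nat.one_le_two_pow
    have h4 : 1 ≤ 2 ^ q.eval s := Nat.one_le_two_pow
    simp only [TExpr.eval, Polynomial.eval_add, Polynomial.eval_C, pow_add]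
    nlinarith
  | sub a b ha hb =>
    obtain ⟨p, hp⟩ := ha
    exact ⟨p, fun s I σ h => (Nat.sub_le _ _).trans_lt (hp s I σ h)⟩
  | mul a b ha hb =>
    obtain ⟨p, hp⟩ := ha
    obtain ⟨q, hq⟩ := hb
    refine ⟨p + q, fun s I σ h => ?_⟩
    simp only [TExpr.eval, Polynomial.eval_add, pow_add]
    exact Nat.mul_lt_mul'' (hp s I σ h) (hq s I σ h)
  | div a b ha hb =>
    obtain ⟨p, hp⟩ := ha
    exact ⟨p, fun s I σ h => (Nat.div_le_self _ _).trans_lt (hp s I σ h)⟩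
  | fold b x N e he =>
    obtain ⟨p, hp⟩ := he
    obtain ⟨q, hq⟩ := N.exists_poly
    -- The loop variable stays below `N ≤ q(s)`, so the body is evaluated in a state bounded by `s +
    -- q(s)` bits. Accumulating `N` terms adds at most `q(s)` bits more.
    refine ⟨q + p.comp (.X + q), fun s I σ h => ?_⟩
    simp only [TExpr.eval, Polynomial.eval_add, Polynomial.eval_comp, Polynomial.eval_X]
    have hN := (hq s (I 0) I h.1 rfl).1
    refine (foldVal_lt (P := p.eval (s + q.eval s)) fun j hj => ?_).trans_le
      (Nat.pow_le_pow_right (by norm_num) (by omega))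
    refine hp _ _ _ ((h.mono (by omega)).setVar ?_)
    exact lt_of_lt_of_le Nat.lt_two_pow_self (Nat.pow_le_pow_right (by norm_num) (by omega))

/-! ### Compilation -/

/-- The machine memory `m` holds the input `I` and the abstract memory `σ`. -/
structure Represents (I : Mem) (σ : State) (m : Mem) : Prop where
  inp : ∀ x ≤ I 0 * I 0, m x = I x
  arr : ∀ a i, m (I 0 * I 0 + 2 ^ (a + 1) * (2 * i + 1)) = σ a i

/-- The square of the content of cell `0`. -/
def sqE : Expr := .mul (.load (.const 0)) (.load (.const 0))

/-- The address of the temporary cell `k`. -/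
def tmpA (k : ℕ) : Expr := .add sqE (.const (2 * k + 1))

/-- The content of the temporary cell `k`. -/
def tmpE (k : ℕ) : Expr := .load (tmpA k)

/-- The address of the cell of array `a` with the index `e`. -/
def arrA (a : ℕ) (e : Expr) : Expr :=
  .add sqE (.mul (.const (2 ^ (a + 1))) (.add (.mul (.const 2) e) (.const 1)))

/-- The content of the cell of array `a` with the index `e`. -/
def arrE (a : ℕ) (e : Expr) : Expr := .load (arrA a e)

/-- The content of variable `x`. -/
def varE (x : ℕ) : Expr := arrE 0 (.const x)

/-- One step of a bounded sum or search, with accumulator `acc`, index `j` and term `g`. -/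
def foldStepE (search : Bool) (acc j g : Expr) : Expr :=
  bif search then .add acc (.mul (.sub (.const 1) (.sub j acc)) (.sub (.const 1) g))
  else .add acc g

/-- The program that computes a table expression into the temporary cell `k`. -/
def TExpr.comp : TExpr → ℕ → Prog
  | .const c, k => .store (tmpA k) (.const c)
  | .inp e, k => .seq (e.comp k)
      (.store (tmpA k) (.load (.mul (tmpE k) (.sub (.const 1) (.sub (tmpE k) sqE)))))
  | .arr a e, k => .seq (e.comp k) (.store (tmpA k) (arrE a (tmpE k)))
  | .add a b, k => .seq (a.comp k) (.seq (b.comp (k + 1))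
      (.store (tmpA k) (.add (tmpE k) (tmpE (k + 1)))))
  | .sub a b, k => .seq (a.comp k) (.seq (b.comp (k + 1))
      (.store (tmpA k) (.sub (tmpE k) (tmpE (k + 1)))))
  | .mul a b, k => .seq (a.comp k) (.seq (b.comp (k + 1))
      (.store (tmpA k) (.mul (tmpE k) (tmpE (k + 1)))))
  | .div a b, k => .seq (a.comp k) (.seq (b.comp (k + 1))
      (.store (tmpA k) (.div (tmpE k) (tmpE (k + 1)))))
  | .fold b x N e, k =>
      .seq (.store (tmpA (k + 1)) (varE x)) (.seq (.store (tmpA k) (.const 0))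
      (.seq (.store (arrA 0 (.const x)) (.const 0)) (.seq
        (.loop (.sub N.toExpr (varE x)) (.seq (e.comp (k + 2))
          (.seq (.store (tmpA k) (foldStepE b (tmpE k) (varE x) (tmpE (k + 2))))
            (.store (arrA 0 (.const x)) (.add (varE x) (.const 1))))))
        (.store (arrA 0 (.const x)) (tmpE (k + 1))))))

/-! ### Memory layout, and the cost of address expressions -/

section
variable {I : Mem} {σ : State} {m : Mem} {s : ℕ}

theorem Represents.zero (h : Represents I σ m) : m 0 = I 0 := h.inp 0 (Nat.zero_le _)

/-- The address of the temporary cell `k`. -/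
def tmpAddr (I : Mem) (k : ℕ) : ℕ := I 0 * I 0 + (2 * k + 1)

/-- The address of a cell of an array. -/
def arrAddr (I : Mem) (a i : ℕ) : ℕ := I 0 * I 0 + 2 ^ (a + 1) * (2 * i + 1)

theorem tmpAddr_inj {j k : ℕ} : tmpAddr I j = tmpAddr I k ↔ j = k := by
  unfold tmpAddr; omega

/-- Beyond the input, temporary cells have odd offsets and array cells even ones. -/
theorem arrAddr_ne_tmpAddr (a i k : ℕ) : arrAddr I a i ≠ tmpAddr I k := by
  unfold tmpAddr arrAddr
  rw [pow_succ, mul_assoc, mul_left_comm]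
  omega

/-- The exponent of two in the offset determines the array, and its odd part determines the index.
Infinitely many unbounded arrays can thus share the memory without any allocation. -/
theorem arrAddr_inj {a i a' i' : ℕ} : arrAddr I a i = arrAddr I a' i' ↔ a = a' ∧ i = i' := by
  constructor
  · intro h
    have h1 : 2 ^ (a + 1) * (2 * i + 1) = 2 ^ (a' + 1) * (2 * i' + 1) := by
      unfold arrAddr at h; omega
    have key : ∀ {b c j k : ℕ}, b < c → 2 ^ (b + 1) * (2 * j + 1) ≠ 2 ^ (c + 1) * (2 * k + 1) := by
      intro b c j k hbc heq
      obtain ⟨d, rfl⟩ := Nat.exists_eq_add_of_lt hbc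
      rw [show b + d + 1 + 1 = (b + 1) + (d + 1) by ring, pow_add 2 (b + 1) (d + 1),
        mul_assoc (2 ^ (b + 1))] at heq
      have := Nat.eq_of_mul_eq_mul_left (Nat.two_pow_pos _) heq
      rw [pow_succ, mul_assoc, mul_left_comm] at this
      omega
    rcases lt_trichotomy a a' with h' | rfl | h'
    · exact absurd h1 (key h')
    · refine ⟨rfl, ?_⟩
      have := Nat.eq_of_mul_eq_mul_left (Nat.two_pow_pos _) h1
      omega
    · exact absurd h1.symm (key h')
  · rintro ⟨rfl, rfl⟩; rfl

theorem lt_tmpAddr (k : ℕ) : I 0 * I 0 < tmpAddr I k := by unfold tmpAddr; omega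

theorem lt_arrAddr (a i : ℕ) : I 0 * I 0 < arrAddr I a i := by
  unfold arrAddr; exact Nat.lt_add_of_pos_right (by positivity)

theorem Represents.eval_sqE (h : Represents I σ m) : sqE.eval m = I 0 * I 0 := by
  simp [sqE, Expr.eval, h.zero]

theorem Represents.eval_tmpA (h : Represents I σ m) (k : ℕ) :
    (tmpA k).eval m = tmpAddr I k := by
  simp [tmpA, Expr.eval, h.eval_sqE, tmpAddr]

theorem Represents.eval_tmpE (h : Represents I σ m) (k : ℕ) :
    (tmpE k).eval m = m (tmpAddr I k) := by
  simp [tmpE, Expr.eval, h.eval_tmpA]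

theorem Represents.eval_arrA (h : Represents I σ m) (a : ℕ) (e : Expr) :
    (arrA a e).eval m = arrAddr I a (e.eval m) := by
  simp [arrA, Expr.eval, h.eval_sqE, arrAddr]

theorem Represents.eval_arrE (h : Represents I σ m) (a : ℕ) (e : Expr) :
    (arrE a e).eval m = σ a (e.eval m) := by
  simp only [arrE, Expr.eval, h.eval_arrA]; exact h.arr _ _

theorem Represents.eval_varE (h : Represents I σ m) (x : ℕ) : (varE x).eval m = σ 0 x := by
  simp [varE, h.eval_arrE, Expr.eval]

theorem Represents.cost_sqE (h : Represents I σ m) (hs : I 0 ≤ s) :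
    sqE.cost m ≤ 4 * s + 6 := by
  have h1 := size_le_self (I 0)
  have h2 := size_mul_le (I 0) (I 0)
  simp only [sqE, Expr.cost, Expr.eval, h.zero, Nat.size_zero]
  omega

theorem Represents.size_sq (hs : I 0 ≤ s) : (I 0 * I 0).size ≤ 2 * s := by
  have h1 := size_le_self (I 0)
  have h2 := size_mul_le (I 0) (I 0)
  omega

theorem Represents.cost_tmpA (h : Represents I σ m) (hs : I 0 ≤ s) (k : ℕ) :
    (tmpA k).cost m ≤ 6 * s + (4 * k + 12) := by
  have h1 := h.cost_sqE hs
  have h2 := size_le_self (2 * k + 1)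
  have h3 := size_add_le (I 0 * I 0) (2 * k + 1)
  have h4 := Represents.size_sq hs
  simp only [tmpA, Expr.cost, Expr.eval, h.eval_sqE]
  omega

theorem Represents.cost_tmpE (h : Represents I σ m) (hs : I 0 ≤ s) (k : ℕ) :
    (tmpE k).cost m ≤ 6 * s + (4 * k + 13) + (m (tmpAddr I k)).size := by
  have h1 := h.cost_tmpA hs k
  simp only [tmpE, Expr.cost, h.eval_tmpA]
  omega

theorem Represents.cost_arrA (h : Represents I σ m) (hs : I 0 ≤ s) (a : ℕ) (e : Expr) :
    (arrA a e).cost m ≤ 6 * s + (3 * 2 ^ (a + 1) + 40) + 4 * (e.eval m).size + e.cost m := by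
  have h1 := h.cost_sqE hs
  have h3 := size_mul_le 2 (e.eval m)
  have h4 := size_add_le (2 * e.eval m) 1
  have h5 := size_mul_le (2 ^ (a + 1)) (2 * e.eval m + 1)
  have h6 := size_add_le (I 0 * I 0) (2 ^ (a + 1) * (2 * e.eval m + 1))
  have h7 := Represents.size_sq hs
  have h8 : Nat.size 1 ≤ 1 := size_le_self 1
  have h9 : Nat.size 2 ≤ 2 := size_le_self 2
  have h10 := size_le_self (2 ^ (a + 1))
  simp only [arrA, Expr.cost, Expr.eval, h.eval_sqE]
  omega

theorem Represents.cost_arrE (h : Represents I σ m) (hs : I 0 ≤ s) (a : ℕ) (e : Expr) :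
    (arrE a e).cost m ≤ 6 * s + (3 * 2 ^ (a + 1) + 41) + 4 * (e.eval m).size + e.cost m
      + (σ a (e.eval m)).size := by
  have h1 := h.cost_arrA hs a e
  have h2 : m ((arrA a e).eval m) = σ a (e.eval m) := h.eval_arrE a e
  simp only [arrE, Expr.cost, h2]
  omega

theorem Represents.cost_varE (h : Represents I σ m) (hs : I 0 ≤ s) (x : ℕ) :
    (varE x).cost m ≤ 6 * s + 50 + 5 * x + (σ 0 x).size := by
  have h1 := h.cost_arrE hs 0 (.const x)
  have := size_le_self x
  simp only [Expr.cost, Expr.eval] at h1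
  simp only [varE]
  omega

theorem Represents.update_tmp (h : Represents I σ m) (k v : ℕ) :
    Represents I σ (Function.update m (tmpAddr I k) v) := by
  refine ⟨fun x hx => ?_, fun a i => ?_⟩
  · rw [Function.update_of_ne (by have := lt_tmpAddr (I := I) k; omega)]; exact h.inp x hx
  · exact (Function.update_of_ne (arrAddr_ne_tmpAddr a i k) _ _).trans (h.arr a i)

theorem Represents.update_arr (h : Represents I σ m) (a i v : ℕ) :
    Represents I (Function.update σ a (Function.update (σ a) i v))
      (Function.update m (arrAddr I a i) v) := by
  refine ⟨fun x hx => ?_, fun a' i' => ?_⟩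
  · rw [Function.update_of_ne (by have := lt_arrAddr (I := I) a i; omega)]; exact h.inp x hx
  · change Function.update m (arrAddr I a i) v (arrAddr I a' i') = _
    by_cases ha : a' = a
    · subst ha
      by_cases hi : i' = i
      · subst hi; simp
      · rw [Function.update_of_ne (by simp [arrAddr_inj, hi]), Function.update_self,
          Function.update_of_ne hi]
        exact h.arr _ _
    · rw [Function.update_of_ne (by simp [arrAddr_inj, ha]), Function.update_of_ne ha]
      exact h.arr _ _

theorem update_arr_tmp (a i v k : ℕ) :
    Function.update m (arrAddr I a i) v (tmpAddr I k) = m (tmpAddr I k) :=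
  Function.update_of_ne (arrAddr_ne_tmpAddr a i k).symm _ _

theorem update_tmp_tmp (j v k : ℕ) : Function.update m (tmpAddr I j) v (tmpAddr I k) =
    if k = j then v else m (tmpAddr I k) := by
  simp [Function.update_apply, tmpAddr_inj]

end

/-! ### Execution of compiled programs -/

theorem Exec.store' {a e : Expr} {m : Mem} {x v T : ℕ} (ha : a.eval m = x) (he : e.eval m = v)
    (hT : a.cost m + e.cost m + 1 ≤ T) :
    ∃ t ≤ T, Exec (.store a e) m t (Function.update m x v) :=
  ⟨_, hT, by subst ha he; exact Exec.store a e m⟩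

/-- Induction on the number of rounds that remain. A round costs at most `T` for the test, `T` for
the body and `1` for the branch; the extra summand in `N + 1` pays for the last, failing test. -/
theorem exec_loop {c : Expr} {p : Prog} {N T : ℕ} (Inv : ℕ → Mem → Prop)
    (hc : ∀ j < N, ∀ m, Inv j m → c.eval m ≠ 0) (hN : ∀ m, Inv N m → c.eval m = 0)
    (hcost : ∀ j ≤ N, ∀ m, Inv j m → c.cost m ≤ T)
    (hp : ∀ j < N, ∀ m, Inv j m → ∃ t ≤ T, ∃ m', Exec p m t m' ∧ Inv (j + 1) m')
    {m : Mem} (hm : Inv 0 m) :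
    ∃ t ≤ (N + 1) * (2 * T + 1), ∃ m', Exec (.loop c p) m t m' ∧ Inv N m' := by
  suffices H : ∀ k ≤ N, ∀ m, Inv (N - k) m →
      ∃ t ≤ (k + 1) * (2 * T + 1), ∃ m', Exec (.loop c p) m t m' ∧ Inv N m' by
    exact H N le_rfl m (by simpa using hm)
  intro k
  induction k with
  | zero =>
    intro _ m h
    have := hcost N le_rfl m h
    exact ⟨_, by omega, m, Exec.loop_false (hN m h), h⟩
  | succ k ih =>
    intro hk m h
    obtain ⟨t, ht, m', he, hi⟩ := hp _ (by omega) m h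
    obtain ⟨t', ht', m'', he', hi'⟩ := ih (by omega) m'
      (by rwa [show N - (k + 1) + 1 = N - k by omega] at hi)
    have := hcost _ (by omega) m h
    refine ⟨_, ?_, m'', Exec.loop_true (hc _ (by omega) m h) he he', hi'⟩
    rw [show (k + 1 + 1) * (2 * T + 1) = (k + 1) * (2 * T + 1) + (2 * T + 1) by ring]
    omega

open Polynomial

theorem setVar_setVar (σ : State) (x i j : ℕ) : setVar (setVar σ x i) x j = setVar σ x j := by
  simp [setVar]

theorem setVar_eq_self (σ : State) (x : ℕ) : setVar σ x (σ 0 x) = σ := by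
  simp [setVar]

/-- The specification of a program that computes the value of `e` into the temporary cell `k`. -/
def CompSpec (e : TExpr) (k : ℕ) (p : ℕ[X]) : Prop :=
  ∀ s I σ m, Bounded s I σ → Represents I σ m → ∃ t ≤ p.eval s, ∃ m', Exec (e.comp k) m t m' ∧
    Represents I σ m' ∧ (∀ j < k, m' (tmpAddr I j) = m (tmpAddr I j)) ∧
      m' (tmpAddr I k) = e.eval I σ

theorem size_le_of_lt {a b : ℕ} (h : a < 2 ^ b) : a.size ≤ b := Nat.size_le.2 h

theorem size_le_of_le {a b : ℕ} (h : a ≤ b) : a.size ≤ b := (size_le_self a).trans h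

/-- The left operand waits in the temporary `k` while the right one is computed into `k + 1`; this
is safe because compiled code preserves the temporaries below its target. The size of the result is
kept apart in the bound, since it depends on the operation. -/
theorem exec_binop {a b : TExpr} {k : ℕ} {p q : ℕ[X]} (ha : CompSpec a k p)
    (hb : CompSpec b (k + 1) q) (op : Expr → Expr → Expr) (f : ℕ → ℕ → ℕ)
    (hop : ∀ x y m, (op x y).eval m = f (x.eval m) (y.eval m))
    (hcost : ∀ x y m, (op x y).cost m =
      x.cost m + y.cost m + (1 + (f (x.eval m) (y.eval m)).size)) :
    ∃ r : ℕ[X], ∀ s I σ m, Bounded s I σ → Represents I σ m → (∃ B, B = f (a.eval I σ) (b.eval I σ)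
        ∧ ∃ t ≤ r.eval s + B.size, ∃ m', Exec (.seq (a.comp k) (.seq (b.comp (k + 1))
      (.store (tmpA k) (op (tmpE k) (tmpE (k + 1)))))) m t m' ∧
      Represents I σ m' ∧ (∀ j < k, m' (tmpAddr I j) = m (tmpAddr I j)) ∧ m' (tmpAddr I k) = B) := by
  obtain ⟨pa, hpa⟩ := a.exists_eval_lt
  obtain ⟨pb, hpb⟩ := b.exists_eval_lt
  refine ⟨p + q + pa + pb + C 18 * X + C (12 * k + 100), fun s I σ m hB hR => ⟨_, rfl, ?_⟩⟩
  obtain ⟨t1, ht1, m1, h1, r1, l1, e1⟩ := ha s I σ m hB hR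
  obtain ⟨t2, ht2, m2, h2, r2, l2, e2⟩ := hb s I σ m1 hB r1
  have ek : (tmpE k).eval m2 = a.eval I σ := by rw [r2.eval_tmpE, l2 k (by omega), e1]
  have ek1 : (tmpE (k + 1)).eval m2 = b.eval I σ := by rw [r2.eval_tmpE, e2]
  obtain ⟨t3, ht3, h3⟩ := Exec.store' (r2.eval_tmpA k) (hop (tmpE k) (tmpE (k + 1)) m2) le_rfl
  refine ⟨_, ?_, _, .seq h1 (.seq h2 h3), r2.update_tmp _ _, fun j hj => ?_, ?_⟩
  · have c1 := r2.cost_tmpA hB.1 k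
    have c2 := r2.cost_tmpE hB.1 k
    have c3 := r2.cost_tmpE hB.1 (k + 1)
    rw [l2 k (by omega), e1] at c2
    rw [e2] at c3
    have s1 := size_le_of_lt (hpa s I σ hB)
    have s2 := size_le_of_lt (hpb s I σ hB)
    rw [hcost, ek, ek1] at ht3
    simp only [eval_add, eval_mul, eval_C, eval_X]
    omega
  · rw [update_tmp_tmp, if_neg (by omega), l2 j (by omega), l1 j hj]
  · rw [update_tmp_tmp, if_pos rfl, ek, ek1]

theorem compSpec_of_binop {a b e : TExpr} {k : ℕ} {op : Expr → Expr → Expr} {f : ℕ → ℕ → ℕ}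
    (ha : ∃ p, CompSpec a k p) (hb : ∃ p, CompSpec b (k + 1) p)
    (he : ∀ I σ, e.eval I σ = f (a.eval I σ) (b.eval I σ))
    (hc : e.comp k = .seq (a.comp k) (.seq (b.comp (k + 1))
      (.store (tmpA k) (op (tmpE k) (tmpE (k + 1))))))
    (hop : ∀ x y m, (op x y).eval m = f (x.eval m) (y.eval m))
    (hcost : ∀ x y m, (op x y).cost m =
      x.cost m + y.cost m + (1 + (f (x.eval m) (y.eval m)).size)) :
    ∃ p, CompSpec e k p := by
  obtain ⟨p, hp⟩ := ha
  obtain ⟨q, hq⟩ := hb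
  obtain ⟨r, hr⟩ := exec_binop hp hq op f hop hcost
  obtain ⟨u, hu⟩ := e.exists_eval_lt
  refine ⟨r + u, fun s I σ m hB hR => ?_⟩
  obtain ⟨_, rfl, t, ht, m', h⟩ := hr s I σ m hB hR
  refine ⟨t, ?_, m', ?_⟩
  · have := size_le_of_lt (hu s I σ hB)
    rw [he] at this
    rw [eval_add]; omega
  · rwa [hc, he]

theorem foldStepE_eval (b : Bool) (x y z : Expr) (m : Mem) :
    (foldStepE b x y z).eval m = foldStep b (x.eval m) (y.eval m) (z.eval m) := by
  cases b <;> rfl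

theorem foldStepE_cost (b : Bool) (x y z : Expr) (m : Mem) :
    (foldStepE b x y z).cost m ≤ 2 * x.cost m + y.cost m + z.cost m + (y.eval m).size + 20
      + (foldStep b (x.eval m) (y.eval m) (z.eval m)).size := by
  cases b with
  | false => simp only [foldStepE, foldStep, cond_false, Expr.cost]; omega
  | true =>
    simp only [foldStepE, foldStep, cond_true, Expr.cost, Expr.eval]
    have h1 : Nat.size 1 ≤ 1 := size_le_self 1
    have h2 := size_le_of_le (Nat.sub_le 1 (y.eval m - x.eval m))
    have h3 := size_le_of_le (Nat.sub_le 1 (z.eval m))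
    have h4 := Nat.size_le_size (Nat.sub_le (y.eval m) (x.eval m))
    have h5 := size_mul_le (1 - (y.eval m - x.eval m)) (1 - z.eval m)
    omega

/-- Temporary `k` is the accumulator, `k + 1` saves the old value of the loop variable, and the body
writes to `k + 2`. Restoring the variable at the end makes the abstract state `σ` again, so
evaluation has no side effect outside the temporaries. -/
theorem exec_comp_fold {e : TExpr} {k : ℕ} (b : Bool) (x : ℕ) (N : Bound)
    (he : ∃ p, CompSpec e (k + 2) p) : ∃ p, CompSpec (.fold b x N e) k p := by
  obtain ⟨pe, hpe⟩ := he
  obtain ⟨pb, hpb⟩ := e.exists_eval_lt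
  obtain ⟨q, hq⟩ := N.exists_poly
  -- A common bound for one test and for one round: the cost of the body on `s + q(s)` bits, plus a
  -- multiple of the number of bits of everything that is read or written.
  let T : ℕ[X] := pe.comp (X + q) + C 60 * (X + C k + C x + q + pb.comp (X + q)) + C 400
  refine ⟨(q + 1) * (2 * T + 1) + C 4 * T, fun s I σ m hB hR => ?_⟩
  have hT : T.eval s = pe.eval (s + q.eval s) +
      60 * (s + k + x + q.eval s + pb.eval (s + q.eval s)) + 400 := by simp [T]
  set g : ℕ → ℕ := fun j => e.eval I (setVar σ x j) with hg
  set n := N.val (I 0) with hn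
  have hnq : n ≤ q.eval s := (hq s (I 0) I hB.1 rfl).1
  have hBj : ∀ j ≤ n, Bounded (s + q.eval s) I (setVar σ x j) := fun j hj =>
    (hB.mono (by omega)).setVar
      (lt_of_lt_of_le Nat.lt_two_pow_self (Nat.pow_le_pow_right (by norm_num) (by omega)))
  have hgj : ∀ j < n, g j < 2 ^ pb.eval (s + q.eval s) := fun j hj => hpb _ _ _ (hBj j hj.le)
  have hfold : ∀ j ≤ n, (foldVal b g j).size ≤ q.eval s + pb.eval (s + q.eval s) := fun j hj =>
    (size_le_of_lt (foldVal_lt fun i hi => hgj i (by omega))).trans (by omega)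
  have hold : (σ 0 x).size ≤ s := size_le_of_lt (hB.3 0 x)
  -- initialization
  obtain ⟨t1, ht1, h1⟩ := Exec.store' (hR.eval_tmpA (k + 1)) (hR.eval_varE x) le_rfl
  have r1 := hR.update_tmp (k + 1) (σ 0 x)
  obtain ⟨t2, ht2, h2⟩ := Exec.store' (e := .const 0) (r1.eval_tmpA k) rfl le_rfl
  have r2 := r1.update_tmp k 0
  obtain ⟨t3, ht3, h3⟩ := Exec.store' (e := .const 0) (r2.eval_arrA 0 (.const x)) rfl le_rfl
  have r3 := r2.update_arr 0 x 0
  have c1 := hR.cost_tmpA hB.1 (k + 1)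
  have c1' := hR.cost_varE hB.1 x
  have c2 := r1.cost_tmpA hB.1 k
  have c3 := r2.cost_arrA hB.1 0 (.const x)
  have sx := size_le_self x
  simp only [Expr.cost, Expr.eval, Nat.size_zero] at ht2 ht3 c3
  -- the loop
  obtain ⟨t4, ht4, m4, h4, r4, l4, e4, o4⟩ := exec_loop (c := .sub N.toExpr (varE x))
    (p := .seq (e.comp (k + 2))
          (.seq (.store (tmpA k) (foldStepE b (tmpE k) (varE x) (tmpE (k + 2))))
            (.store (arrA 0 (.const x)) (.add (varE x) (.const 1)))))
    (N := n) (T := T.eval s)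
    (fun j μ => Represents I (setVar σ x j) μ ∧ (∀ i < k, μ (tmpAddr I i) = m (tmpAddr I i)) ∧
      μ (tmpAddr I k) = foldVal b g j ∧ μ (tmpAddr I (k + 1)) = σ 0 x)
    (by
      rintro j hj μ ⟨r, -⟩
      simp only [Expr.eval, r.eval_varE, setVar_same, Bound.eval_toExpr, r.zero]
      omega)
    (by
      rintro μ ⟨r, -⟩
      simp only [Expr.eval, r.eval_varE, setVar_same, Bound.eval_toExpr, r.zero]
      omega)
    (by
      rintro j hj μ ⟨r, -⟩
      have d1 := (hq s (I 0) μ hB.1 r.zero).2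
      have d2 := r.cost_varE hB.1 x
      simp only [Expr.cost, r.eval_varE, setVar_same, Bound.eval_toExpr, r.zero] at d2 ⊢
      have d3 := size_le_self j
      have d4 := size_le_of_le (Nat.sub_le (N.val (I 0)) j)
      omega)
    (by
      rintro j hj μ ⟨r, l, ea, o⟩
      obtain ⟨t1, ht1, μ1, h1, r1, l1, e1⟩ := hpe _ I _ μ (hBj j hj.le) r
      have v : (foldStepE b (tmpE k) (varE x) (tmpE (k + 2))).eval μ1 = foldVal b g (j + 1) := by
        rw [foldStepE_eval, r1.eval_tmpE, r1.eval_varE, r1.eval_tmpE, l1 k (by omega), ea, e1,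
          setVar_same]
        rfl
      obtain ⟨t2, ht2, h2⟩ := Exec.store' (r1.eval_tmpA k) v le_rfl
      have r2 := r1.update_tmp k (foldVal b g (j + 1))
      have v2 : (Expr.add (varE x) (.const 1)).eval
          (Function.update μ1 (tmpAddr I k) (foldVal b g (j + 1))) = j + 1 := by
        simp [Expr.eval, r2.eval_varE]
      obtain ⟨t3, ht3, h3⟩ := Exec.store' (r2.eval_arrA 0 (.const x)) v2 le_rfl
      have r3 := r2.update_arr 0 x (j + 1)
      refine ⟨_, ?_, _, .seq h1 (.seq h2 h3), ?_, fun i hi => ?_, ?_, ?_⟩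
      · have c1 := r1.cost_tmpA hB.1 k
        have c2 := foldStepE_cost b (tmpE k) (varE x) (tmpE (k + 2)) μ1
        rw [← foldStepE_eval, v] at c2
        have c3 := r1.cost_tmpE hB.1 k
        have c4 := r1.cost_tmpE hB.1 (k + 2)
        have c5 := r1.cost_varE hB.1 x
        have c6 := r2.cost_arrA hB.1 0 (.const x)
        have c7 := r2.cost_varE hB.1 x
        rw [l1 k (by omega), ea] at c3
        rw [e1] at c4
        have s1 := hfold j hj.le
        have s2 := hfold (j + 1) hj
        have s3 := size_le_of_lt (hgj j hj)
        have s4 := size_le_self j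
        have s5 := size_le_self (j + 1)
        have s6 : Nat.size 1 ≤ 1 := size_le_self 1
        simp only [Expr.cost, Expr.eval, r2.eval_varE, setVar_same, r1.eval_varE] at ht3 c5 c6 c7 c2
        simp only [hg] at s3
        omega
      · rw [← setVar_setVar σ x j]; exact r3
      · rw [Expr.eval, update_arr_tmp, update_tmp_tmp, if_neg (by omega), l1 i (by omega), l i hi]
      · rw [Expr.eval, update_arr_tmp, update_tmp_tmp, if_pos rfl]
      · rw [Expr.eval, update_arr_tmp, update_tmp_tmp, if_neg (by omega), l1 _ (by omega), o])
    (m := Function.update (Function.update (Function.update m (tmpAddr I (k + 1)) (σ 0 x))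
      (tmpAddr I k) 0) (arrAddr I 0 x) 0)
    (by
      refine ⟨r3, fun i hi => ?_, ?_, ?_⟩
      · rw [update_arr_tmp, update_tmp_tmp, if_neg (by omega), update_tmp_tmp, if_neg (by omega)]
      · rw [update_arr_tmp, update_tmp_tmp, if_pos rfl]; rfl
      · rw [update_arr_tmp, update_tmp_tmp, if_neg (by omega), update_tmp_tmp, if_pos rfl])
  -- restoring the variable
  obtain ⟨t5, ht5, h5⟩ := Exec.store' (r4.eval_arrA 0 (.const x))
    ((r4.eval_tmpE (k + 1)).trans o4) le_rfl
  have r5 := r4.update_arr 0 x (σ 0 x)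
  refine ⟨_, ?_, _, .seq h1 (.seq h2 (.seq h3 (.seq h4 h5))), ?_, fun j hj => ?_, ?_⟩
  · have d1 := r4.cost_arrA hB.1 0 (.const x)
    have d2 := r4.cost_tmpE hB.1 (k + 1)
    rw [o4] at d2
    simp only [Expr.cost, Expr.eval] at d1
    have d3 : (n + 1) * (2 * T.eval s + 1) ≤ (q.eval s + 1) * (2 * T.eval s + 1) := by gcongr
    simp only [eval_add, eval_mul, eval_C, eval_one, eval_ofNat]
    omega
  · have h6 : Function.update (setVar σ x n) 0 (Function.update (setVar σ x n 0) x (σ 0 x)) = σ :=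
      (setVar_setVar σ x n _).trans (setVar_eq_self σ x)
    rw [h6] at r5; exact r5
  · rw [Expr.eval, update_arr_tmp, l4 j hj]
  · rw [Expr.eval, update_arr_tmp, e4]; rfl

theorem TExpr.exec_comp (e : TExpr) : ∀ k, ∃ p, CompSpec e k p := by
  induction e with
  | const c =>
    refine fun k => ⟨C 6 * X + C (4 * k + c + 20), fun s I σ m hB hR => ?_⟩
    obtain ⟨t, ht, h⟩ := Exec.store' (e := .const c) (hR.eval_tmpA k) rfl le_rfl
    refine ⟨t, ?_, _, h, hR.update_tmp _ _, fun j hj => ?_, ?_⟩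
    · have := hR.cost_tmpA hB.1 k
      have := size_le_self c
      simp only [Expr.cost] at ht
      simp only [eval_add, eval_mul, eval_C, eval_X]
      omega
    · rw [update_tmp_tmp, if_neg (by omega)]
    · rw [update_tmp_tmp, if_pos rfl]; rfl
  | inp e ih =>
    intro k
    obtain ⟨p, hp⟩ := ih k
    obtain ⟨pe, hpe⟩ := e.exists_eval_lt
    refine ⟨p + C 40 * X + C 10 * pe + C (20 * k + 100), fun s I σ m hB hR => ?_⟩
    obtain ⟨t1, ht1, m1, h1, r1, l1, e1⟩ := hp s I σ m hB hR
    have v : (Expr.load (.mul (tmpE k) (.sub (.const 1) (.sub (tmpE k) sqE)))).eval m1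
        = (TExpr.inp e).eval I σ := by
      simp only [Expr.eval, r1.eval_tmpE, r1.eval_sqE, e1, TExpr.eval]
      exact r1.inp _ (guard_le _ _)
    obtain ⟨t2, ht2, h2⟩ := Exec.store' (r1.eval_tmpA k) v le_rfl
    refine ⟨_, ?_, _, .seq h1 h2, r1.update_tmp _ _, fun j hj => ?_, ?_⟩
    · have c1 := r1.cost_tmpA hB.1 k
      have c2 := r1.cost_tmpE hB.1 k
      have c3 := r1.cost_sqE hB.1
      have s0 := size_le_of_lt (hpe s I σ hB)
      have s1 := size_le_of_lt (hB.2 _ (guard_le (e.eval I σ) (I 0 * I 0)))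
      rw [← r1.inp _ (guard_le (e.eval I σ) (I 0 * I 0))] at s1
      have s2 := size_mul_le (e.eval I σ) (1 - (e.eval I σ - I 0 * I 0))
      have s3 := size_le_of_le (Nat.sub_le 1 (e.eval I σ - I 0 * I 0))
      have s4 := Nat.size_le_size (Nat.sub_le (e.eval I σ) (I 0 * I 0))
      have s5 : Nat.size 1 ≤ 1 := size_le_self 1
      rw [e1] at c2
      simp only [Expr.cost, Expr.eval, r1.eval_tmpE, r1.eval_sqE, e1] at ht2
      simp only [eval_add, eval_mul, eval_C, eval_X]
      omega
    · rw [update_tmp_tmp, if_neg (by omega), l1 j hj]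
    · rw [update_tmp_tmp, if_pos rfl]
  | arr a e ih =>
    intro k
    obtain ⟨p, hp⟩ := ih k
    obtain ⟨pe, hpe⟩ := e.exists_eval_lt
    refine ⟨p + C 40 * X + C 10 * pe + C (20 * k + 3 * 2 ^ (a + 1) + 100),
      fun s I σ m hB hR => ?_⟩
    obtain ⟨t1, ht1, m1, h1, r1, l1, e1⟩ := hp s I σ m hB hR
    have v : (arrE a (tmpE k)).eval m1 = (TExpr.arr a e).eval I σ := by
      rw [r1.eval_arrE, r1.eval_tmpE, e1]; rfl
    obtain ⟨t2, ht2, h2⟩ := Exec.store' (r1.eval_tmpA k) v le_rfl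
    refine ⟨_, ?_, _, .seq h1 h2, r1.update_tmp _ _, fun j hj => ?_, ?_⟩
    · have c1 := r1.cost_tmpA hB.1 k
      have c2 := r1.cost_tmpE hB.1 k
      have c3 := r1.cost_arrE hB.1 a (tmpE k)
      have s0 := size_le_of_lt (hpe s I σ hB)
      have s1 := size_le_of_lt (hB.3 a (e.eval I σ))
      rw [e1] at c2
      rw [r1.eval_tmpE, e1] at c3
      simp only [eval_add, eval_mul, eval_C, eval_X]
      omega
    · rw [update_tmp_tmp, if_neg (by omega), l1 j hj]
    · rw [update_tmp_tmp, if_pos rfl]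
  | add a b iha ihb =>
    exact fun k => compSpec_of_binop (op := .add) (f := (· + ·)) (iha k) (ihb (k + 1))
      (fun _ _ => rfl) rfl (fun _ _ _ => rfl) fun _ _ _ => rfl
  | sub a b iha ihb =>
    exact fun k => compSpec_of_binop (op := .sub) (f := (· - ·)) (iha k) (ihb (k + 1))
      (fun _ _ => rfl) rfl (fun _ _ _ => rfl) fun _ _ _ => rfl
  | mul a b iha ihb =>
    exact fun k => compSpec_of_binop (op := .mul) (f := (· * ·)) (iha k) (ihb (k + 1))
      (fun _ _ => rfl) rfl (fun _ _ _ => rfl) fun _ _ _ => rfl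
  | div a b iha ihb =>
    exact fun k => compSpec_of_binop (op := .div) (f := (· / ·)) (iha k) (ihb (k + 1))
      (fun _ _ => rfl) rfl (fun _ _ _ => rfl) fun _ _ _ => rfl
  | fold b x N e ih => exact fun k => exec_comp_fold b x N (ih (k + 2))

/-! ### Programs that fill tables and write the output -/

open Polynomial

/-- The program that fills array `a`: the cells with an index less than the value of `N` get the
value of `e`, in which variable `0` is the index. -/
def tableProg (a : ℕ) (N e : TExpr) : Prog :=
  .seq (N.comp 0) (.seq (.store (arrA 0 (.const 0)) (.const 0))
    (.loop (.sub (tmpE 0) (varE 0)) (.seq (e.comp 1)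
      (.seq (.store (arrA a (varE 0)) (tmpE 1))
        (.store (arrA 0 (.const 0)) (.add (varE 0) (.const 1)))))))

theorem Bounded.update {s : ℕ} {I : Mem} {σ : State} (h : Bounded s I σ) {a i v : ℕ}
    (hv : v < 2 ^ s) : Bounded s I (Function.update σ a (Function.update (σ a) i v)) := by
  refine ⟨h.1, h.2, fun a' i' => ?_⟩
  by_cases ha : a' = a
  · subst ha
    rw [Function.update_self, Function.update_apply]
    split
    exacts [hv, h.3 _ _]
  · rw [Function.update_of_ne ha]; exact h.3 _ _

/-- An entry may use the earlier arrays and the entries before it in its own table, which is what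
dynamic programming and the levels of Yates' algorithm need. Array `0` is left unspecified except
for the index, because it holds the loop variables. -/
theorem exec_tableProg {a : ℕ} (ha : a ≠ 0) (N e : TExpr) : ∃ p : ℕ[X], ∀ s I σ m,
    Bounded s I σ → Represents I σ m → ∀ (sz : ℕ) (F : ℕ → ℕ), N.eval I σ = sz → sz < 2 ^ s →
    (∀ i < sz, F i < 2 ^ s) →
    (∀ i < sz, ∀ τ : State, (∀ b, b ≠ 0 → b ≠ a → τ b = σ b) → (∀ j < i, τ a j = F j) →
      τ 0 0 = i → e.eval I τ = F i) →
    ∃ t ≤ p.eval s * (sz + 1), ∃ m' τ, Exec (tableProg a N e) m t m' ∧ Represents I τ m' ∧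
      Bounded s I τ ∧ (∀ b, b ≠ 0 → b ≠ a → τ b = σ b) ∧ ∀ i < sz, τ a i = F i := by
  obtain ⟨pN, hpN⟩ := N.exec_comp 0
  obtain ⟨pe, hpe⟩ := e.exec_comp 1
  let T : ℕ[X] := pe + C 60 * X + C (3 * 2 ^ (a + 1) + 400)
  refine ⟨pN + 4 * T, fun s I σ m hB hR sz F hN hsz hF he => ?_⟩
  have hT : T.eval s = pe.eval s + 60 * s + (3 * 2 ^ (a + 1) + 400) := by simp [T]
  obtain ⟨t1, ht1, m1, h1, r1, -, e1⟩ := hpN s I σ m hB hR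
  obtain ⟨t2, ht2, h2⟩ := Exec.store' (e := .const 0) (r1.eval_arrA 0 (.const 0)) rfl le_rfl
  have r2 := r1.update_arr 0 0 0
  have c2 := r1.cost_arrA hB.1 0 (.const 0)
  simp only [Expr.cost, Expr.eval, Nat.size_zero] at ht2 c2
  obtain ⟨t4, ht4, m4, h4, τ, r4, b4, o4, f4, -⟩ := exec_loop (c := .sub (tmpE 0) (varE 0))
    (p := .seq (e.comp 1) (.seq (.store (arrA a (varE 0)) (tmpE 1))
        (.store (arrA 0 (.const 0)) (.add (varE 0) (.const 1)))))
    (N := sz) (T := T.eval s)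
    (fun j μ => ∃ τ, Represents I τ μ ∧ Bounded s I τ ∧ (∀ b, b ≠ 0 → b ≠ a → τ b = σ b) ∧
      (∀ i < j, τ a i = F i) ∧ τ 0 0 = j ∧ μ (tmpAddr I 0) = sz)
    (by
      rintro j hj μ ⟨τ, r, -, -, -, h0, h1⟩
      simp only [Expr.eval, r.eval_varE, r.eval_tmpE, h0, h1]; omega)
    (by
      rintro μ ⟨τ, r, -, -, -, h0, h1⟩
      simp only [Expr.eval, r.eval_varE, r.eval_tmpE, h0, h1]; omega)
    (by
      rintro j hj μ ⟨τ, r, -, -, -, h0, h1⟩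
      have d1 := r.cost_tmpE hB.1 0
      have d2 := r.cost_varE hB.1 0
      simp only [Expr.cost, r.eval_varE, r.eval_tmpE, h0, h1] at d1 d2 ⊢
      have d3 := size_le_of_lt hsz
      have d4 := Nat.size_le_size hj
      have d5 := Nat.size_le_size (Nat.sub_le sz j)
      omega)
    (by
      rintro j hj μ ⟨τ, r, b, o, f, h0, hz⟩
      obtain ⟨t1, ht1, μ1, h1, r1, l1, e1⟩ := hpe s I τ μ b r
      rw [he j hj τ o f h0] at e1
      obtain ⟨t2, ht2, h2⟩ := Exec.store' (r1.eval_arrA a (varE 0)) (r1.eval_tmpE 1) le_rfl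
      have r2 := r1.update_arr a ((varE 0).eval μ1) (μ1 (tmpAddr I 1))
      have c2 := r1.cost_arrA hB.1 a (varE 0)
      have c3 := r1.cost_varE hB.1 0
      have c4 := r1.cost_tmpE hB.1 1
      simp only [r1.eval_varE, h0, e1] at h2 r2 c2 c3 c4
      have v2 : (Expr.add (varE 0) (.const 1)).eval
          (Function.update μ1 (arrAddr I a j) (F j)) = j + 1 := by
        simp [Expr.eval, r2.eval_varE, ha.symm, h0]
      obtain ⟨t3, ht3, h3⟩ := Exec.store' (r2.eval_arrA 0 (.const 0)) v2 le_rfl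
      have r3 := r2.update_arr 0 0 (j + 1)
      have hj1 : j + 1 < 2 ^ s := by omega
      refine ⟨_, ?_, _, .seq h1 (.seq h2 h3), _, r3, (b.update (hF j hj)).update hj1,
        fun c hc hca => ?_, fun i hi => ?_, by simp, ?_⟩
      · have c5 := r2.cost_arrA hB.1 0 (.const 0)
        have c6 := r2.cost_varE hB.1 0
        have s1 := size_le_of_lt (hF j hj)
        have s2 := size_le_of_lt hj1
        have s3 := size_le_of_lt (by omega : j < 2 ^ s)
        have s6 : Nat.size 1 ≤ 1 := size_le_self 1
        have s7 : Function.update τ a (Function.update (τ a) j (F j)) 0 0 = j := by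
          simp [ha.symm, h0]
        simp only [Expr.cost, Expr.eval, r2.eval_varE, s7, Nat.size_zero] at ht3 c5 c6
        omega
      · rw [Function.update_of_ne hc, Function.update_of_ne hca]; exact o c hc hca
      · rw [Function.update_of_ne ha, Function.update_self, Function.update_apply]
        split
        · subst i; rfl
        · exact f i (by omega)
      · rw [Expr.eval, update_arr_tmp, update_arr_tmp, l1 0 (by omega), hz])
    (m := Function.update m1 (arrAddr I 0 0) 0)
    ⟨_, r2, hB.update (by positivity), fun c hc hca => Function.update_of_ne hc _ _,
      by simp, by simp, by rw [update_arr_tmp, e1, hN]⟩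
  refine ⟨_, ?_, m4, τ, .seq h1 (.seq h2 h4), r4, b4, o4, f4⟩
  have h5 : (sz + 1) * (2 * T.eval s + 1) ≤ (sz + 1) * (3 * T.eval s) :=
    Nat.mul_le_mul_left _ (by omega)
  have h6 : (pN.eval s + 4 * T.eval s) * (sz + 1) =
      pN.eval s * (sz + 1) + T.eval s * (sz + 1) + (sz + 1) * (3 * T.eval s) := by ring
  have h7 : pN.eval s ≤ pN.eval s * (sz + 1) := Nat.le_mul_of_pos_right _ (by omega)
  have h8 : T.eval s ≤ T.eval s * (sz + 1) := Nat.le_mul_of_pos_right _ (by omega)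
  simp only [eval_add, eval_mul, eval_ofNat]
  omega

/-- The program that fills the arrays `a, a + 1, …`, one for each pair of a size and an
expression. -/
def tablesProg : ℕ → List (TExpr × TExpr) → Prog
  | _, [] => .skip
  | a, (N, e) :: l => .seq (tableProg a N e) (tablesProg (a + 1) l)

/-- The tables `F a, F (a + 1), …` of the sizes `sz a, sz (a + 1), …` satisfy the equations in
the list. -/
def Computes (I : Mem) (sz : ℕ → ℕ) (F : ℕ → ℕ → ℕ) : ℕ → List (TExpr × TExpr) → Prop
  | _, [] => True
  | a, (N, e) :: l => (∀ τ : State, (∀ b, 0 < b → b < a → ∀ i < sz b, τ b i = F b i) →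
      N.eval I τ = sz a ∧
      ∀ i < sz a, (∀ j < i, τ a j = F a j) → τ 0 0 = i → e.eval I τ = F a i) ∧
    Computes I sz F (a + 1) l

theorem exec_tablesProg (l : List (TExpr × TExpr)) : ∀ a, a ≠ 0 → ∃ p : ℕ[X], ∀ s I σ m,
    Bounded s I σ → Represents I σ m → ∀ (sz : ℕ → ℕ) (F : ℕ → ℕ → ℕ) (Z : ℕ),
    (∀ b, sz b < 2 ^ s) → (∀ b, sz b ≤ Z) → (∀ b, ∀ i < sz b, F b i < 2 ^ s) →
    (∀ b, 0 < b → b < a → ∀ i < sz b, σ b i = F b i) → Computes I sz F a l →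
    ∃ t ≤ p.eval s * (Z + 1), ∃ m' τ, Exec (tablesProg a l) m t m' ∧ Represents I τ m' ∧
      Bounded s I τ ∧ ∀ b, 0 < b → b < a + l.length → ∀ i < sz b, τ b i = F b i := by
  induction l with
  | nil =>
    intro a _
    exact ⟨1, fun s I σ m hB hR sz F Z _ _ _ hσ _ =>
      ⟨1, by simp, m, σ, Exec.skip m, hR, hB, by simpa using hσ⟩⟩
  | cons Ne l ih =>
    obtain ⟨N, e⟩ := Ne
    intro a ha
    obtain ⟨p, hp⟩ := exec_tableProg ha N e
    obtain ⟨q, hq⟩ := ih (a + 1) (by omega)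
    refine ⟨p + q, fun s I σ m hB hR sz F Z h1 h2 h3 hσ hC => ?_⟩
    obtain ⟨hC1, hC2⟩ := hC
    have hold : ∀ τ : State, (∀ b, b ≠ 0 → b ≠ a → τ b = σ b) →
        ∀ b, 0 < b → b < a → ∀ i < sz b, τ b i = F b i := fun τ hτ b hb hba i hi => by
      rw [hτ b (by omega) (by omega)]; exact hσ b hb hba i hi
    obtain ⟨t, ht, m', τ, he, r, b, o, f⟩ := hp s I σ m hB hR (sz a) (F a) (hC1 σ hσ).1 (h1 a)
      (h3 a) fun i hi τ hτ hj h0 => (hC1 τ (hold τ hτ)).2 i hi hj h0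
    obtain ⟨t', ht', m'', τ', he', r', b', f'⟩ := hq s I τ m' b r sz F Z h1 h2 h3
      (fun c hc hca i hi => by
        rcases Nat.lt_succ_iff_lt_or_eq.1 hca with h | rfl
        · exact hold τ o c hc h i hi
        · exact f i hi) hC2
    refine ⟨_, ?_, m'', τ', .seq he he', r', b', fun c hc hcl => f' c hc ?_⟩
    · have := Nat.mul_le_mul_left (p.eval s) (Nat.succ_le_succ (h2 a))
      rw [eval_add, add_mul]
      simp only [Nat.succ_eq_add_one] at this
      omega
    · rw [List.length_cons] at hcl; omega

/-- The program that copies the first `n` cells of array `a` to the cells `0, …, n - 1` of the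
machine. -/
def outputProg (a : ℕ) : Prog :=
  .seq (.store (arrA 0 (.const 0)) (.const 1)) (.seq
    (.loop (.sub (.load (.const 0)) (varE 0)) (.seq (.store (varE 0) (arrE a (varE 0)))
      (.store (arrA 0 (.const 0)) (.add (varE 0) (.const 1)))))
    (.store (.const 0) (arrE a (.const 0))))

theorem Represents.update_inp {I : Mem} {σ : State} {m : Mem} (h : Represents I σ m) {x : ℕ}
    (hx : x ≠ 0) (hxn : x ≤ I 0 * I 0) (v : ℕ) :
    Represents (Function.update I x v) σ (Function.update m x v) := by
  have h0 : Function.update I x v 0 = I 0 := Function.update_of_ne hx.symm _ _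
  refine ⟨fun y hy => ?_, fun a i => ?_⟩
  · rw [h0] at hy
    rw [Function.update_apply, Function.update_apply]
    split
    exacts [rfl, h.inp y hy]
  · rw [h0]
    refine (Function.update_of_ne ?_ _ _).trans (h.arr a i)
    have := lt_arrAddr (I := I) a i
    unfold arrAddr at this
    omega

/-- All addresses depend on `n` in cell `0`, so this cell is overwritten last and the loop starts at
`1`. The cells `1, …, n - 1` lie in the input region; overwriting them leaves the arrays intact and
only changes the represented input to some `J` with `J 0 = n`. -/
theorem exec_outputProg {a : ℕ} (ha : a ≠ 0) : ∃ p : ℕ[X], ∀ s I σ m, Bounded s I σ →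
    Represents I σ m → ∃ t ≤ p.eval s, ∃ m', Exec (outputProg a) m t m' ∧
      ∀ v < I 0, m' v = σ a v := by
  let T : ℕ[X] := C 80 * X + C (6 * 2 ^ (a + 1) + 400)
  refine ⟨(X + 1) * (2 * T + 1) + 3 * T, fun s I σ m hB hR => ?_⟩
  have hT : T.eval s = 80 * s + (6 * 2 ^ (a + 1) + 400) := by simp [T]
  obtain ⟨t1, ht1, h1⟩ := Exec.store' (e := .const 1) (hR.eval_arrA 0 (.const 0)) rfl le_rfl
  have r1 := hR.update_arr 0 0 1
  have c1 := hR.cost_arrA hB.1 0 (.const 0)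
  have s6 : Nat.size 1 ≤ 1 := size_le_self 1
  simp only [Expr.cost, Expr.eval, Nat.size_zero] at ht1 c1
  set n := I 0 with hn
  have hns : n ≤ s := hB.1
  obtain ⟨t4, ht4, m4, h4, J, τ, r4, J4, o4, -, l4⟩ := exec_loop
    (c := .sub (.load (.const 0)) (varE 0))
    (p := .seq (.store (varE 0) (arrE a (varE 0)))
      (.store (arrA 0 (.const 0)) (.add (varE 0) (.const 1))))
    (N := n - 1) (T := T.eval s)
    (fun j μ => ∃ J τ, Represents J τ μ ∧ J 0 = n ∧ (∀ b, b ≠ 0 → τ b = σ b) ∧ τ 0 0 = j + 1 ∧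
      ∀ v, v ≠ 0 → v < j + 1 → J v = σ a v)
    (by
      rintro j hj μ ⟨J, τ, r, J0, -, h0, -⟩
      simp only [Expr.eval, r.eval_varE, r.zero, h0, J0]; omega)
    (by
      rintro μ ⟨J, τ, r, J0, -, h0, -⟩
      simp only [Expr.eval, r.eval_varE, r.zero, h0, J0]; omega)
    (by
      rintro j hj μ ⟨J, τ, r, J0, -, h0, -⟩
      have d2 := r.cost_varE (J0 ▸ hns) 0
      have d3 := size_le_self n
      have d4 := size_le_self (j + 1)
      have d5 := size_le_self (n - (j + 1))
      simp only [Expr.cost, Expr.eval, r.eval_varE, r.zero, h0, J0, Nat.size_zero] at d2 ⊢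
      omega)
    (by
      rintro j hj μ ⟨J, τ, r, J0, o, h0, f⟩
      have v1 : (arrE a (varE 0)).eval μ = σ a (j + 1) := by
        rw [r.eval_arrE, r.eval_varE, h0, o a ha]
      obtain ⟨t2, ht2, h2⟩ := Exec.store' ((r.eval_varE 0).trans h0) v1 le_rfl
      have hjn : j + 1 ≤ J 0 * J 0 := by
        rw [J0]; have := Nat.le_mul_self n; omega
      have r2 := r.update_inp (Nat.succ_ne_zero j) hjn (σ a (j + 1))
      have J0' : Function.update J (j + 1) (σ a (j + 1)) 0 = n := by
        rw [Function.update_of_ne (by omega), J0]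
      have v2 : (Expr.add (varE 0) (.const 1)).eval
          (Function.update μ (j + 1) (σ a (j + 1))) = j + 1 + 1 := by
        simp [Expr.eval, r2.eval_varE, h0]
      obtain ⟨t3, ht3, h3⟩ := Exec.store' (r2.eval_arrA 0 (.const 0)) v2 le_rfl
      have r3 := r2.update_arr 0 0 (j + 1 + 1)
      refine ⟨_, ?_, _, .seq h2 h3, _, _, r3, J0', fun b hb => ?_, by simp, fun v hv hvj => ?_⟩
      · have c1 := r.cost_arrE (J0 ▸ hns) a (varE 0)
        have c2 := r.cost_varE (J0 ▸ hns) 0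
        have c5 := r2.cost_arrA (J0' ▸ hns) 0 (.const 0)
        have c6 := r2.cost_varE (J0' ▸ hns) 0
        have s1 := size_le_of_lt (hB.3 a (j + 1))
        have s2 := size_le_self (j + 1)
        have s3 := size_le_self (j + 1 + 1)
        simp only [Expr.cost, Expr.eval, r2.eval_varE, r.eval_varE, h0, o a ha,
          Nat.size_zero] at c1 c2 ht3 c5 c6
        omega
      · rw [Function.update_of_ne hb]; exact o b hb
      · rw [Function.update_apply]
        split
        · subst v; rfl
        · exact f v hv (by omega))
    (m := Function.update m (arrAddr I 0 0) 1)
    ⟨I, _, r1, rfl, fun c hc => Function.update_of_ne hc _ _, by simp, fun v h1 h2 => by omega⟩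
  have v5 : (arrE a (.const 0)).eval m4 = σ a 0 := by
    rw [r4.eval_arrE, o4 a ha]; rfl
  obtain ⟨t5, ht5, h5⟩ := Exec.store' (a := .const 0) (x := 0) rfl v5 le_rfl
  refine ⟨_, ?_, _, .seq h1 (.seq h4 h5), fun v hv => ?_⟩
  · have c1 := r4.cost_arrE (J4 ▸ hns) a (.const 0)
    have s1 := size_le_of_lt (hB.3 a 0)
    simp only [Expr.cost, Expr.eval, o4 a ha, Nat.size_zero] at c1 ht5
    have d3 : (n - 1 + 1) * (2 * T.eval s + 1) ≤ (s + 1) * (2 * T.eval s + 1) := by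
      gcongr; omega
    simp only [eval_add, eval_mul, eval_one, eval_ofNat, eval_X]
    omega
  · rw [Function.update_apply]
    split
    · subst v; rfl
    · rename_i hv0
      rw [r4.inp v (by rw [J4]; nlinarith), l4 v hv0 (by omega)]

/-- The adjacency matrix ends at cell `n * n` and array cells have offsets of at least `2` beyond
it, so all arrays start out as zero. -/
theorem represents_graphInput {n : ℕ} (G : Digraph (Fin n)) :
    Represents (graphInput G) (fun _ _ => 0) (graphInput G) := by
  refine ⟨fun _ _ => rfl, fun a i => ?_⟩
  have h0 : graphInput G 0 = n := by simp [graphInput]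
  rw [h0]
  have hpos : 0 < 2 ^ (a + 1) * (2 * i + 1) := by positivity
  simp only [graphInput]
  rw [if_neg (by omega), if_neg]
  rintro ⟨u, v, h, -⟩
  have h1 : (u : ℕ) * n + n ≤ n * n := by
    have := Nat.mul_le_mul_right n (Nat.succ_le_of_lt u.2)
    rw [Nat.succ_mul] at this; exact this
  have h2 := v.2
  have : 2 ≤ 2 ^ (a + 1) * (2 * i + 1) := by
    rw [pow_succ]
    have : 0 < 2 ^ a * (2 * i + 1) := by positivity
    nlinarith
  omega

/-- Tables that are defined by a list of equations can be computed in time proportional to the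
size of the largest one, up to factors that are polynomial in the number of bits. -/
theorem exists_prog_of_tables (l : List (TExpr × TExpr)) (a : ℕ) (ha : 0 < a)
    (hal : a ≤ l.length) : ∃ (P : Prog) (p : ℕ[X]), ∀ (s n : ℕ) (G : Digraph (Fin n))
      (sz : ℕ → ℕ) (F : ℕ → ℕ → ℕ) (Z : ℕ), n ≤ s → 0 < s → (∀ b, sz b < 2 ^ s) →
      (∀ b, sz b ≤ Z) → (∀ b, ∀ i < sz b, F b i < 2 ^ s) → Computes (graphInput G) sz F 1 l →
      n ≤ sz a → ∃ t ≤ p.eval s * (Z + 1), ∃ m, Exec P (graphInput G) t m ∧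
        ∀ v < n, m v = F a v := by
  obtain ⟨p, hp⟩ := exec_tablesProg l 1 one_ne_zero
  obtain ⟨q, hq⟩ := exec_outputProg ha.ne'
  refine ⟨.seq (tablesProg 1 l) (outputProg a), p + q,
    fun s n G sz F Z hns hs h1 h2 h3 hC hsz => ?_⟩
  have h0 : graphInput G 0 = n := by simp [graphInput]
  have hs2 : 2 ≤ 2 ^ s := by
    calc 2 = 2 ^ 1 := rfl
      _ ≤ 2 ^ s := Nat.pow_le_pow_right (by norm_num) hs
  have hB : Bounded s (graphInput G) (fun _ _ => 0) := by
    refine ⟨h0.trans_le hns, fun x _ => ?_, fun _ _ => by positivity⟩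
    simp only [graphInput]
    split_ifs
    · exact lt_of_le_of_lt hns Nat.lt_two_pow_self
    · omega
    · omega
  obtain ⟨t, ht, m, τ, he, r, b, f⟩ := hp s _ _ _ hB (represents_graphInput G) sz F Z h1 h2 h3
    (fun b hb hb1 => by omega) hC
  obtain ⟨t', ht', m', he', f'⟩ := hq s _ _ _ b r
  refine ⟨_, ?_, m', .seq he he', fun v hv => ?_⟩
  · have : q.eval s ≤ q.eval s * (Z + 1) := Nat.le_mul_of_pos_right _ (by omega)
    rw [eval_add, add_mul]; omega
  · rw [f' v (by rwa [h0]), f a ha (by omega) v (by omega)]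

/-! ### Bilinear algorithms from straight-line computations -/

section Bilinear

open MvPolynomial

variable {ι κ : Type*}

/-- The coefficient of a linear monomial. -/
noncomputable def linPart (x : ι) (f : MvPolynomial ι ℚ) : ℚ := constantCoeff (pderiv x f)

/-- The matrix of the bilinear part of a polynomial in two groups of variables. -/
noncomputable def bilinPart (f : MvPolynomial (ι ⊕ κ) ℚ) : ι × κ → ℚ := fun p =>
  constantCoeff (pderiv (.inl p.1) (pderiv (.inr p.2) f))

theorem bilinPart_C (c : ℚ) : bilinPart (C c : MvPolynomial (ι ⊕ κ) ℚ) = 0 := by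
  ext p; simp [bilinPart]

theorem bilinPart_X (x : ι ⊕ κ) : bilinPart (X x : MvPolynomial (ι ⊕ κ) ℚ) = 0 := by
  classical
  ext p
  simp only [bilinPart, pderiv_X, Pi.single_apply]
  split_ifs <;> simp

theorem bilinPart_add (f g : MvPolynomial (ι ⊕ κ) ℚ) :
    bilinPart (f + g) = bilinPart f + bilinPart g := by
  ext p; simp [bilinPart]

theorem bilinPart_sub (f g : MvPolynomial (ι ⊕ κ) ℚ) :
    bilinPart (f - g) = bilinPart f - bilinPart g := by
  ext p; simp [bilinPart]

/-- The product rule at the origin. Apart from multiples of the bilinear parts of the factors, a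
multiplication contributes two matrices of rank one, made of linear coefficients. -/
theorem bilinPart_mul (f g : MvPolynomial (ι ⊕ κ) ℚ) :
    bilinPart (f * g) = constantCoeff f • bilinPart g + constantCoeff g • bilinPart f +
      ((fun p => linPart (.inl p.1) f * linPart (.inr p.2) g) +
        fun p => linPart (.inl p.1) g * linPart (.inr p.2) f) := by
  ext p
  simp only [bilinPart, linPart, pderiv_mul, map_add, map_mul, Pi.add_apply, Pi.smul_apply,
    smul_eq_mul]
  ring

/-- Strassen's argument: scalars and inputs have no bilinear part, additions and subtractions stay
in the span, and each multiplication adds two rank-one matrices, hence the index set `Fin t × Bool`.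
Divisions are not allowed, so looking at low-order coefficients suffices. -/
theorem exists_span_of_isStraightLine {s : ℕ → MvPolynomial (ι ⊕ κ) ℚ} {t : ℕ}
    (hs : IsStraightLine s t) : ∃ (a : Fin t × Bool → ι → ℚ) (b : Fin t × Bool → κ → ℚ),
      ∀ f, Available s t f → bilinPart f ∈
        Submodule.span ℚ (Set.range fun r => fun p : ι × κ => a r p.1 * b r p.2) := by
  choose! f g hf hg hfg using hs
  refine ⟨fun r i => bif r.2 then linPart (.inl i) (f r.1) else linPart (.inl i) (g r.1),
    fun r j => bif r.2 then linPart (.inr j) (g r.1) else linPart (.inr j) (f r.1), ?_⟩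
  set W := Submodule.span ℚ (Set.range fun r : Fin t × Bool => fun p : ι × κ =>
    (bif r.2 then linPart (.inl p.1) (f r.1) else linPart (.inl p.1) (g r.1)) *
    (bif r.2 then linPart (.inr p.2) (g r.1) else linPart (.inr p.2) (f r.1))) with hW
  suffices H : ∀ k ≤ t, ∀ h, Available s k h → bilinPart h ∈ W from H t le_rfl
  intro k
  induction k using Nat.strong_induction_on with
  | _ k ih =>
    rintro hk h (⟨c, rfl⟩ | ⟨x, rfl⟩ | ⟨j, hj, rfl⟩)
    · rw [bilinPart_C]; exact W.zero_mem
    · rw [bilinPart_X]; exact W.zero_mem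
    · have h1 := ih j hj (by omega) _ (hf j (by omega))
      have h2 := ih j hj (by omega) _ (hg j (by omega))
      rcases hfg j (by omega) with h | h | h <;> rw [h]
      · rw [bilinPart_add]; exact W.add_mem h1 h2
      · rw [bilinPart_sub]; exact W.sub_mem h1 h2
      · rw [bilinPart_mul]
        refine W.add_mem (W.add_mem (W.smul_mem _ h2) (W.smul_mem _ h1)) (W.add_mem ?_ ?_)
        · exact Submodule.subset_span ⟨(⟨j, by omega⟩, true), rfl⟩
        · exact Submodule.subset_span ⟨(⟨j, by omega⟩, false), rfl⟩

theorem bilinPart_matMul {n : ℕ} (i j : Fin n) (p q : Fin n × Fin n) :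
    bilinPart (∑ l : Fin n, X (Sum.inl (i, l)) * X (Sum.inr (l, j)) :
      MvPolynomial ((Fin n × Fin n) ⊕ (Fin n × Fin n)) ℚ) (p, q) =
      if p.1 = i ∧ q.2 = j ∧ p.2 = q.1 then 1 else 0 := by
  have h : ∀ x : Fin n,
      (constantCoeff (pderiv (.inl p) (pderiv (.inr q) (X (Sum.inl (i, x)) * X (Sum.inr (x, j)) :
        MvPolynomial ((Fin n × Fin n) ⊕ (Fin n × Fin n)) ℚ))) : ℚ) =
      if x = q.1 then (if p.1 = i ∧ q.2 = j ∧ p.2 = q.1 then 1 else 0) else 0 := by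
    intro x
    simp only [pderiv_mul, pderiv_X, Pi.single_apply, Sum.inr.injEq, reduceCtorEq, if_false,
      Prod.ext_iff]
    split_ifs <;> simp_all [Pi.single_apply, Prod.ext_iff]
  simp only [bilinPart, map_sum]
  rw [Finset.sum_congr rfl fun x _ => h x]
  simp

/-- The entries of the product are distinct and none of them is a scalar or an input, so each needs
a step of its own. This yields `2 ^ q * 2 ^ q ≤ R`, by which `R ^ d` dominates the number of matrix
entries and every level of Yates' algorithm. -/
theorem sq_le_of_matMulWith {n t : ℕ} (h : MatMulWith n t) : n * n ≤ t := by
  obtain ⟨s, -, h⟩ := h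
  have key : ∀ p : Fin n × Fin n, ∃ k : Fin t,
      (∑ l : Fin n, X (Sum.inl (p.1, l)) * X (Sum.inr (l, p.2)) :
        MvPolynomial ((Fin n × Fin n) ⊕ (Fin n × Fin n)) ℚ) = s k := by
    rintro ⟨i, j⟩
    have h1 := bilinPart_matMul i j (i, i) (i, j)
    rcases h i j with ⟨c, hc⟩ | ⟨x, hx⟩ | ⟨k, hk, hs⟩
    · rw [hc, bilinPart_C] at h1; simp at h1
    · rw [hx, bilinPart_X] at h1; simp at h1
    · exact ⟨⟨k, hk⟩, hs⟩
  choose k hk using key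
  have hinj : Function.Injective k := by
    rintro ⟨i, j⟩ ⟨i', j'⟩ he
    have h1 := bilinPart_matMul i j (i, i) (i, j)
    have h2 := bilinPart_matMul i' j' (i, i) (i, j)
    have h3 := hk (i, j)
    rw [he, ← hk (i', j')] at h3
    simp only at h3
    rw [h3, h2] at h1
    simp only [and_self, if_true, and_true] at h1
    by_contra hne
    rw [if_neg] at h1
    · exact zero_ne_one h1
    · rintro ⟨rfl, rfl⟩; exact hne rfl
  simpa using Fintype.card_le_of_injective k hinj

/-- Matrices can be multiplied with a cubic number of operations. -/
theorem matMulWith_cubic (n : ℕ) : MatMulWith n (2 * n ^ 3) := by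
  let A : ℕ → ℕ → MvPolynomial ((Fin n × Fin n) ⊕ (Fin n × Fin n)) ℚ := fun i l =>
    if h : i < n ∧ l < n then X (.inl (⟨i, h.1⟩, ⟨l, h.2⟩)) else C 0
  let B : ℕ → ℕ → MvPolynomial ((Fin n × Fin n) ⊕ (Fin n × Fin n)) ℚ := fun l j =>
    if h : l < n ∧ j < n then X (.inr (⟨l, h.1⟩, ⟨j, h.2⟩)) else C 0
  have hA : ∀ s k i l, Available s k (A i l) := fun s k i l => by
    by_cases h : i < n ∧ l < n
    · exact .inr (.inl ⟨_, dif_pos h⟩)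
    · exact .inl ⟨0, dif_neg h⟩
  have hB : ∀ s k i l, Available s k (B i l) := fun s k i l => by
    by_cases h : i < n ∧ l < n
    · exact .inr (.inl ⟨_, dif_pos h⟩)
    · exact .inl ⟨0, dif_neg h⟩
  -- With `k / 2 = (i * n + j) * n + l`, the even step multiplies the entries `(i, l)` and `(l, j)`,
  -- and the odd step after it is the partial sum of the entry `(i, j)` up to `l`.
  let s : ℕ → MvPolynomial ((Fin n × Fin n) ⊕ (Fin n × Fin n)) ℚ := fun k =>
    if k % 2 = 0 then A (k / 2 / n / n) (k / 2 % n) * B (k / 2 % n) (k / 2 / n % n)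
    else ∑ l ∈ Finset.range (k / 2 % n + 1), A (k / 2 / n / n) l * B l (k / 2 / n % n)
  have s0 : ∀ k, s (2 * k) = A (k / n / n) (k % n) * B (k % n) (k / n % n) := fun k => by
    simp [s]
  have s1 : ∀ k, s (2 * k + 1) =
      ∑ l ∈ Finset.range (k % n + 1), A (k / n / n) l * B l (k / n % n) := fun k => by
    have h1 : (2 * k + 1) / 2 = k := by omega
    have h2 : (2 * k + 1) % 2 = 1 := by omega
    simp only [s, h1, h2]
    rw [if_neg one_ne_zero]
  refine ⟨s, fun k hk => ?_, fun i j => ?_⟩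
  · obtain ⟨m, rfl | rfl⟩ : ∃ m, k = 2 * m ∨ k = 2 * m + 1 := ⟨k / 2, by omega⟩
    · exact ⟨_, _, hA s _ _ _, hB s _ _ _, .inr (.inr (s0 m))⟩
    · rcases Nat.eq_zero_or_pos (m % n) with h | h
      · refine ⟨C 0, s (2 * m), .inl ⟨0, rfl⟩, .inr (.inr ⟨2 * m, by omega, rfl⟩), .inl ?_⟩
        rw [s1, s0, h]; simp
      · have hn : n ≠ 0 := by rintro rfl; simp at hk
        have hm0 : 0 < m := Nat.pos_of_ne_zero (by rintro rfl; rw [Nat.zero_mod] at h; omega)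
        have hd : (m - 1) / n = m / n := by
          have h1 := Nat.div_add_mod m n
          have h2 := Nat.mod_lt m (Nat.pos_of_ne_zero hn)
          rw [show m - 1 = m % n - 1 + n * (m / n) by omega, Nat.add_mul_div_left _ _
            (Nat.pos_of_ne_zero hn), Nat.div_eq_of_lt (by omega), zero_add]
        have hm : (m - 1) % n + 1 = m % n := by
          have h1 := Nat.div_add_mod m n
          have h2 := Nat.div_add_mod (m - 1) n
          rw [hd] at h2
          omega
        refine ⟨s (2 * (m - 1) + 1), s (2 * m), .inr (.inr ⟨_, by omega, rfl⟩),
          .inr (.inr ⟨2 * m, by omega, rfl⟩), .inl ?_⟩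
        rw [s1, s1, s0, hd, hm, Finset.sum_range_succ]
  · have hn : 0 < n := i.pos
    set m := (i * n + j) * n + (n - 1) with hm
    have h1 : m / n = i * n + j := by
      rw [hm, Nat.add_comm, Nat.add_mul_div_right _ _ hn, Nat.div_eq_of_lt (by omega), zero_add]
    have h2 : m % n = n - 1 := by
      rw [hm, Nat.add_comm, Nat.add_mul_mod_self_right, Nat.mod_eq_of_lt (by omega)]
    have h3 : (i * n + j) / n = (i : ℕ) := by
      rw [Nat.add_comm, Nat.add_mul_div_right _ _ hn, Nat.div_eq_of_lt j.2, zero_add]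
    have h4 : (i * n + j) % n = (j : ℕ) := by
      rw [Nat.add_comm, Nat.add_mul_mod_self_right, Nat.mod_eq_of_lt j.2]
    refine .inr (.inr ⟨2 * m + 1, ?_, ?_⟩)
    · have h5 : (i : ℕ) * n + j + 1 ≤ n * n := by
        have := Nat.mul_le_mul_right n (Nat.succ_le_of_lt i.2)
        rw [Nat.succ_mul] at this
        have := j.2
        omega
      have h6 := Nat.mul_le_mul_right n h5
      rw [Nat.succ_mul] at h6
      have h7 : n ^ 3 = n * n * n := by ring
      omega
    · rw [s1, h1, h2, h3, h4, Nat.sub_add_cancel hn, ← Fin.sum_univ_eq_sum_range]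
      refine Finset.sum_congr rfl fun l _ => ?_
      simp [A, B]

theorem exists_den {α : Type*} [Fintype α] (f : α → ℚ) :
    ∃ (D : ℕ) (z : α → ℤ), 0 < D ∧ ∀ x, (z x : ℚ) = D * f x := by
  classical
  refine ⟨∏ x, (f x).den, fun x => (f x).num * ∏ y ∈ Finset.univ.erase x, ((f y).den : ℤ),
    Finset.prod_pos fun x _ => (f x).pos, fun x => ?_⟩
  rw [← Finset.mul_prod_erase _ _ (Finset.mem_univ x)]
  push_cast
  nth_rewrite 3 [← Rat.num_div_den (f x)]
  have : ((f x).den : ℚ) ≠ 0 := by exact_mod_cast (f x).den_nz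
  field_simp

/-- A bilinear algorithm for the multiplication of `k × k` matrices with `R` multiplications and
integral coefficients, which computes `D` times the product. The position `i` stands for the entry
`(i / k, i % k)`. -/
structure BilinearAlgorithm (k R : ℕ) where
  D : ℕ
  D_pos : 0 < D
  α : ℕ → ℕ → ℤ
  β : ℕ → ℕ → ℤ
  γ : ℕ → ℕ → ℤ
  sum_eq : ∀ i < k * k, ∀ j < k * k, ∀ l < k * k,
    ∑ r ∈ Finset.range R, α r i * β r j * γ r l =
      if i % k = j / k ∧ i / k = l / k ∧ j % k = l % k then (D : ℤ) else 0

/-- Each rank-one matrix from the straight-line computation becomes one product, hence `2 * t`. The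
coefficients are rational; clearing the denominators of the three families separately gives integers
and the factor `D = Da * Db * Dc`. -/
theorem exists_bilinearAlgorithm {k t : ℕ} (hk : 0 < k) (h : MatMulWith k t) :
    Nonempty (BilinearAlgorithm k (2 * t)) := by
  obtain ⟨s, hs, hav⟩ := h
  obtain ⟨a, b, hab⟩ := exists_span_of_isStraightLine hs
  have hc : ∀ p : Fin k × Fin k, ∃ c : Fin t × Bool → ℚ, ∀ x y : Fin k × Fin k,
      ∑ r, c r * (a r x * b r y) = if x.1 = p.1 ∧ y.2 = p.2 ∧ x.2 = y.1 then 1 else 0 := by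
    intro p
    obtain ⟨c, hc⟩ := (Submodule.mem_span_range_iff_exists_fun ℚ).1 (hab _ (hav p.1 p.2))
    refine ⟨c, fun x y => ?_⟩
    rw [← bilinPart_matMul, ← hc]
    simp
  choose c hc using hc
  obtain ⟨Da, za, hDa, hza⟩ := exists_den fun x : (Fin t × Bool) × (Fin k × Fin k) => a x.1 x.2
  obtain ⟨Db, zb, hDb, hzb⟩ := exists_den fun x : (Fin t × Bool) × (Fin k × Fin k) => b x.1 x.2
  obtain ⟨Dc, zc, hDc, hzc⟩ := exists_den fun x : (Fin t × Bool) × (Fin k × Fin k) => c x.2 x.1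
  let e : Fin t × Bool ≃ Fin (2 * t) := Fintype.equivFinOfCardEq (by simp [mul_comm])
  let P : ℕ → Fin k × Fin k := fun i => (⟨i / k % k, Nat.mod_lt _ hk⟩, ⟨i % k, Nat.mod_lt _ hk⟩)
  have ext : ∀ z : (Fin t × Bool) × (Fin k × Fin k) → ℤ, ∃ α : ℕ → ℕ → ℤ, ∀ (r : Fin (2 * t)) i,
      α r i = z (e.symm r, P i) := fun z =>
    ⟨fun r i => if h : r < 2 * t then z (e.symm ⟨r, h⟩, P i) else 0, fun r i => by simp⟩
  obtain ⟨α, hα⟩ := ext za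
  obtain ⟨β, hβ⟩ := ext zb
  obtain ⟨γ, hγ⟩ := ext zc
  refine ⟨⟨Da * Db * Dc, by positivity, α, β, γ, fun i hi j hj l hl => ?_⟩⟩
  have hdiv : ∀ i < k * k, i / k % k = i / k := fun i hi =>
    Nat.mod_eq_of_lt (Nat.div_lt_of_lt_mul hi)
  have key := hc (P l) (P i) (P j)
  rw [← Fin.sum_univ_eq_sum_range fun r => α r i * β r j * γ r l]
  simp only [hα, hβ, hγ]
  rw [e.symm.sum_comp fun r => za (r, P i) * zb (r, P j) * zc (r, P l)]
  have h2 : ((∑ r, za (r, P i) * zb (r, P j) * zc (r, P l) : ℤ) : ℚ) =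
      (Da * Db * Dc : ℕ) * ∑ r, c (P l) r * (a r (P i) * b r (P j)) := by
    push_cast
    rw [Finset.mul_sum]
    refine Finset.sum_congr rfl fun r _ => ?_
    rw [hza, hzb, hzc]
    ring
  rw [key] at h2
  have h3 : ((P i).1 = (P l).1 ∧ (P j).2 = (P l).2 ∧ (P i).2 = (P j).1) ↔
      (i % k = j / k ∧ i / k = l / k ∧ j % k = l % k) := by
    simp only [P, Fin.mk.injEq, hdiv i hi, hdiv j hj, hdiv l hl]
    tauto
  simp only [h3] at h2
  split_ifs at h2 ⊢
  · exact_mod_cast h2.trans (mul_one _)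
  · exact_mod_cast h2.trans (mul_zero _)

end Bilinear

/-- Some admissible `τ` lies strictly below `omega + ε`. The constant `2 * K`, where `2` counts the
rank-one terms of a multiplication and `K` is the constant of the `O`-bound, is absorbed by `(2 ^ (q
+ 1)) ^ (omega + ε - τ)` once `q` is large. Choosing `τ` needs an admissible exponent to exist,
which the cubic algorithm provides. -/
theorem exists_bilinearAlgorithm_rpow {ε : ℝ} (hε : 0 < ε) : ∃ q R : ℕ, 0 < q ∧
    2 ^ q * 2 ^ q ≤ R ∧ (R : ℝ) ≤ ((2 : ℝ) ^ q) ^ (omega + ε) ∧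
    Nonempty (BilinearAlgorithm (2 ^ q) R) := by
  have hne : {τ : ℝ | ∃ K : ℝ, ∀ n : ℕ, 1 ≤ n → ∃ t : ℕ, MatMulWith n t ∧
      (t : ℝ) ≤ K * (n : ℝ) ^ τ}.Nonempty :=
    ⟨3, 2, fun n _ => ⟨_, matMulWith_cubic n, by
      rw [show (3 : ℝ) = (3 : ℕ) by norm_num, Real.rpow_natCast]; push_cast; rfl⟩⟩
  obtain ⟨τ, ⟨K, hK⟩, hτ⟩ := exists_lt_of_csInf_lt hne (lt_add_of_pos_right omega hε)
  obtain ⟨q, hq⟩ := pow_unbounded_of_one_lt (2 * K)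
    (Real.one_lt_rpow (one_lt_two : (1 : ℝ) < 2) (sub_pos.2 hτ))
  have hq1 : 2 * K ≤ ((2 : ℝ) ^ (q + 1)) ^ (omega + ε - τ) := by
    rw [← Real.rpow_natCast 2, ← Real.rpow_mul (by norm_num), mul_comm ((q + 1 : ℕ) : ℝ),
      Real.rpow_mul (by norm_num), Real.rpow_natCast]
    exact hq.le.trans (pow_le_pow_right₀ (Real.one_le_rpow one_le_two (sub_pos.2 hτ).le)
      (Nat.le_succ q))
  obtain ⟨t, ht, htK⟩ := hK (2 ^ (q + 1)) Nat.one_le_two_pow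
  refine ⟨q + 1, 2 * t, Nat.succ_pos q, ?_, ?_, exists_bilinearAlgorithm (by positivity) ht⟩
  · have := sq_le_of_matMulWith ht; omega
  · push_cast at htK ⊢
    have h2 : (0 : ℝ) < 2 ^ (q + 1) := by positivity
    calc (2 : ℝ) * t ≤ 2 * (K * (2 ^ (q + 1)) ^ τ) := by gcongr
      _ = 2 * K * (2 ^ (q + 1)) ^ τ := by ring
      _ ≤ (2 ^ (q + 1)) ^ (omega + ε - τ) * (2 ^ (q + 1)) ^ τ := by gcongr
      _ = _ := by rw [← Real.rpow_add h2]; ring_nf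

/-! ### Tensor powers and Yates' algorithm -/

theorem sum_range_mul {M : Type*} [AddCommMonoid M] (g : ℕ → M) (m a : ℕ) :
    ∑ i ∈ Finset.range (m * a), g i =
      ∑ i ∈ Finset.range m, ∑ j ∈ Finset.range a, g (i * a + j) := by
  induction m with
  | zero => simp
  | succ m ih => rw [Nat.succ_mul, Finset.sum_range_add, ih, Finset.sum_range_succ]

/-- The entries of the `s`-th tensor power of the matrix `f`, which has `b` rows and `a`
columns. -/
def tensorPow (f : ℕ → ℕ → ℤ) (a b : ℕ) : ℕ → ℕ → ℕ → ℤ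
  | 0, _, _ => 1
  | s + 1, v, i => tensorPow f a b s (v / b) (i / a) * f (v % b) (i % a)

/-- Yates' algorithm: multiplication of the vector `x` with the `d`-th tensor power of the matrix
`f`, which has `b` rows and `a` columns. -/
def yates (f : ℕ → ℕ → ℤ) (a b d : ℕ) (x : ℕ → ℤ) : ℕ → ℕ → ℤ
  | 0, l => x l
  | s + 1, l => ∑ j ∈ Finset.range a,
      f (l % b) j * yates f a b d x s (j * (a ^ (d - (s + 1)) * b ^ s) + l / b)

/-- Invariant of the algorithm: after `s` stages the `s` leading digits of the index to the base `a`
have been turned into the digits of `v` to the base `b`, and `u` consists of the digits not yet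
treated. A stage sums over the leading remaining digit `j` and appends a new last digit to `v`. -/
theorem yates_eq_sum (f : ℕ → ℕ → ℤ) {a b d : ℕ} (x : ℕ → ℤ) {s : ℕ} (hs : s ≤ d) :
    ∀ u v, u < a ^ (d - s) → v < b ^ s → yates f a b d x s (u * b ^ s + v) =
      ∑ i ∈ Finset.range (a ^ s), tensorPow f a b s v i * x (i * a ^ (d - s) + u) := by
  induction s with
  | zero => intro u v _ hv; simp at hv; simp [yates, tensorPow, hv]
  | succ s ih =>
    intro u v hu hv
    have hb : 0 < b := Nat.pos_of_ne_zero (by rintro rfl; simp at hv)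
    have hd : d - s = d - (s + 1) + 1 := by omega
    rw [yates, pow_succ a s, sum_range_mul, Finset.sum_comm]
    refine Finset.sum_congr rfl fun j hj => ?_
    have hja := Finset.mem_range.1 hj
    have h1 : (u * b ^ (s + 1) + v) % b = v % b := by
      rw [pow_succ, ← mul_assoc, Nat.add_comm, Nat.add_mul_mod_self_right]
    have h2 : (u * b ^ (s + 1) + v) / b = u * b ^ s + v / b := by
      rw [pow_succ, ← mul_assoc, Nat.add_comm, Nat.add_mul_div_right _ _ hb, Nat.add_comm]
    have h3 : v / b < b ^ s := Nat.div_lt_of_lt_mul (by rwa [pow_succ, mul_comm] at hv)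
    have h4 : j * a ^ (d - (s + 1)) + u < a ^ (d - s) := by
      rw [hd, pow_succ, mul_comm (a ^ _)]
      have := Nat.mul_le_mul_right (a ^ (d - (s + 1))) (Nat.succ_le_of_lt hja)
      rw [Nat.succ_mul] at this
      omega
    rw [h1, h2, show j * (a ^ (d - (s + 1)) * b ^ s) + (u * b ^ s + v / b) =
      (j * a ^ (d - (s + 1)) + u) * b ^ s + v / b by ring, ih (by omega) _ _ h4 h3,
      Finset.mul_sum]
    refine Finset.sum_congr rfl fun i _ => ?_
    have h5 : (i * a + j) / a = i := by
      rw [Nat.add_comm, Nat.add_mul_div_right _ _ (by omega), Nat.div_eq_of_lt hja, zero_add]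
    have h6 : (i * a + j) % a = j := by
      rw [Nat.add_comm, Nat.add_mul_mod_self_right, Nat.mod_eq_of_lt hja]
    rw [tensorPow, h5, h6, hd, pow_succ, show i * (a ^ (d - (s + 1)) * a) +
      (j * a ^ (d - (s + 1)) + u) = (i * a + j) * a ^ (d - (s + 1)) + u by ring]
    ring

theorem yates_self (f : ℕ → ℕ → ℤ) {a b d : ℕ} (x : ℕ → ℤ) {v : ℕ} (hv : v < b ^ d) :
    yates f a b d x d v = ∑ i ∈ Finset.range (a ^ d), tensorPow f a b d v i * x i := by
  simpa using yates_eq_sum f x le_rfl 0 v (by simp) hv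

/-- Apply `g` to the digits to the base `c` and read the results as digits to the base `k`. -/
def digitMap (g : ℕ → ℕ) (c k : ℕ) (i : ℕ) : ℕ :=
  if _h : 0 < i ∧ 1 < c then digitMap g c k (i / c) * k + g (i % c) else 0
termination_by i
decreasing_by exact Nat.div_lt_self _h.1 _h.2

/-- The row of the entry at position `i` of a matrix that is stored in recursive `k × k` blocks. -/
def rowIdx (k : ℕ) : ℕ → ℕ := digitMap (· / k) (k * k) k

/-- The column of the entry at position `i` of a matrix that is stored in recursive `k × k`
blocks. -/
def colIdx (k : ℕ) : ℕ → ℕ := digitMap (· % k) (k * k) k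

theorem digitMap_eq {g : ℕ → ℕ} {c : ℕ} (k : ℕ) (hc : 1 < c) (hg : g 0 = 0) (i : ℕ) :
    digitMap g c k i = digitMap g c k (i / c) * k + g (i % c) := by
  rcases Nat.eq_zero_or_pos i with rfl | hi
  · have h : digitMap g c k 0 = 0 := by rw [digitMap]; simp
    simp [h, hg]
  · rw [digitMap, dif_pos ⟨hi, hc⟩]

/-! ### Block-recursive storage of matrices -/

section
variable {k : ℕ}

theorem rowIdx_eq (hk : 1 < k) (i : ℕ) :
    rowIdx k i = rowIdx k (i / (k * k)) * k + i % (k * k) / k :=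
  digitMap_eq k (Nat.one_lt_mul_iff.2 ⟨by omega, by omega, .inl hk⟩) (Nat.zero_div k) i

theorem colIdx_eq (hk : 1 < k) (i : ℕ) :
    colIdx k i = colIdx k (i / (k * k)) * k + i % k := by
  have := digitMap_eq (g := (· % k)) (c := k * k) k (Nat.one_lt_mul_iff.2 ⟨by omega, by omega, .inl hk⟩)
    (Nat.zero_mod k) i
  simp only [Nat.mod_mul_right_mod] at this
  exact this

theorem rowIdx_zero : rowIdx k 0 = 0 := by rw [rowIdx, digitMap]; simp

theorem colIdx_zero : colIdx k 0 = 0 := by rw [colIdx, digitMap]; simp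

theorem mul_self_div_mod (hk : 0 < k) {i j : ℕ} (hj : j < k * k) :
    (i * (k * k) + j) / (k * k) = i ∧ (i * (k * k) + j) % (k * k) = j := by
  constructor
  · rw [Nat.add_comm, Nat.add_mul_div_right _ _ (by positivity), Nat.div_eq_of_lt hj, zero_add]
  · rw [Nat.add_comm, Nat.add_mul_mod_self_right, Nat.mod_eq_of_lt hj]

theorem rowIdx_mul_add (hk : 1 < k) {i j : ℕ} (hj : j < k * k) :
    rowIdx k (i * (k * k) + j) = rowIdx k i * k + j / k := by
  obtain ⟨h1, h2⟩ := mul_self_div_mod (by omega) (i := i) hj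
  rw [rowIdx_eq hk, h1, h2]

theorem colIdx_mul_add (hk : 1 < k) {i j : ℕ} (hj : j < k * k) :
    colIdx k (i * (k * k) + j) = colIdx k i * k + j % k := by
  obtain ⟨h1, h2⟩ := mul_self_div_mod (by omega) (i := i) hj
  rw [colIdx_eq hk, h1, ← mul_assoc, Nat.add_comm (i * k * k), Nat.add_mul_mod_self_right]

theorem idx_lt (hk : 1 < k) {d i : ℕ} (hi : i < (k * k) ^ d) :
    rowIdx k i < k ^ d ∧ colIdx k i < k ^ d := by
  induction d generalizing i with
  | zero => simp at hi; subst hi; simp [rowIdx_zero, colIdx_zero]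
  | succ d ih =>
    have h1 : i / (k * k) < (k * k) ^ d :=
      Nat.div_lt_of_lt_mul (by rwa [pow_succ, mul_comm] at hi)
    obtain ⟨h2, h3⟩ := ih h1
    have h4 : i % (k * k) / k < k :=
      Nat.div_lt_of_lt_mul (Nat.mod_lt _ (by positivity))
    have h5 : i % k < k := Nat.mod_lt _ (by omega)
    rw [rowIdx_eq hk, colIdx_eq hk, pow_succ]
    constructor
    · have := Nat.mul_le_mul_right k (Nat.succ_le_of_lt h2)
      rw [Nat.succ_mul] at this
      omega
    · have := Nat.mul_le_mul_right k (Nat.succ_le_of_lt h3)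
      rw [Nat.succ_mul] at this
      omega

/-- Splitting off the last digit shows that positions correspond bijectively to pairs of a row and a
column. The reindexing of sums is the form in which this is used, and it needs no explicit inverse.
-/
theorem sum_rowIdx_colIdx {M : Type*} [AddCommMonoid M] (hk : 1 < k) (d : ℕ) (g : ℕ → ℕ → M) :
    ∑ i ∈ Finset.range ((k * k) ^ d), g (rowIdx k i) (colIdx k i) =
      ∑ x ∈ Finset.range (k ^ d), ∑ y ∈ Finset.range (k ^ d), g x y := by
  induction d generalizing g with
  | zero => simp [rowIdx_zero, colIdx_zero]
  | succ d ih =>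
    have h : ∀ i, ∑ j ∈ Finset.range (k * k),
        g (rowIdx k (i * (k * k) + j)) (colIdx k (i * (k * k) + j)) =
        ∑ x ∈ Finset.range k, ∑ y ∈ Finset.range k,
          g (rowIdx k i * k + x) (colIdx k i * k + y) := by
      intro i
      rw [sum_range_mul]
      refine Finset.sum_congr rfl fun x hx => Finset.sum_congr rfl fun y hy => ?_
      have hx := Finset.mem_range.1 hx
      have hy := Finset.mem_range.1 hy
      have h1 : x * k + y < k * k := by
        have := Nat.mul_le_mul_right k (Nat.succ_le_of_lt hx)
        rw [Nat.succ_mul] at this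
        omega
      rw [rowIdx_mul_add hk h1, colIdx_mul_add hk h1, Nat.add_comm (x * k),
        Nat.add_mul_div_right _ _ (by omega), Nat.div_eq_of_lt hy, zero_add,
        Nat.add_mul_mod_self_right, Nat.mod_eq_of_lt hy]
    rw [pow_succ, sum_range_mul, Finset.sum_congr rfl fun i _ => h i,
      ih fun x' y' => ∑ x ∈ Finset.range k, ∑ y ∈ Finset.range k, g (x' * k + x) (y' * k + y),
      pow_succ, sum_range_mul]
    refine Finset.sum_congr rfl fun x' _ => ?_
    rw [Finset.sum_comm]
    refine Finset.sum_congr rfl fun x _ => ?_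
    rw [sum_range_mul]

theorem mul_add_eq_iff {a b a' b' : ℕ} (hb : b < k) (hb' : b' < k) :
    a * k + b = a' * k + b' ↔ a = a' ∧ b = b' := by
  constructor
  · intro h
    have h1 : (a * k + b) / k = (a' * k + b') / k := by rw [h]
    rw [Nat.add_comm, Nat.add_comm (a' * k), Nat.add_mul_div_right _ _ (by omega),
      Nat.add_mul_div_right _ _ (by omega), Nat.div_eq_of_lt hb, Nat.div_eq_of_lt hb', zero_add,
      zero_add] at h1
    subst h1
    exact ⟨rfl, by omega⟩
  · rintro ⟨rfl, rfl⟩; rfl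

/-! ### Tensor powers of a bilinear algorithm multiply large matrices -/

namespace BilinearAlgorithm

variable {R : ℕ} (S : BilinearAlgorithm k R)

/-- Splitting `r` into its last digit and the rest factors the sum into the identity for `d` and the
defining identity of the algorithm. On the other side, rows and columns agree if and only if they
agree in the last digit and in the rest. -/
theorem sum_tensorPow (hk : 1 < k) (d : ℕ) : ∀ i < (k * k) ^ d, ∀ j < (k * k) ^ d,
    ∀ l < (k * k) ^ d, ∑ r ∈ Finset.range (R ^ d), tensorPow S.α (k * k) R d r i *
      tensorPow S.β (k * k) R d r j * tensorPow (fun l r => S.γ r l) R (k * k) d l r =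
      if colIdx k i = rowIdx k j ∧ rowIdx k i = rowIdx k l ∧ colIdx k j = colIdx k l
      then (S.D : ℤ) ^ d else 0 := by
  induction d with
  | zero => intro i hi j hj l hl; simp at hi hj hl; subst hi hj hl; simp [tensorPow, rowIdx_zero, colIdx_zero]
  | succ d ih =>
    intro i hi j hj l hl
    have hc : 0 < k * k := by positivity
    have hdiv : ∀ i, i < (k * k) ^ (d + 1) → i / (k * k) < (k * k) ^ d := fun i hi =>
      Nat.div_lt_of_lt_mul (by rwa [pow_succ, mul_comm] at hi)
    have hm : ∀ i, i % (k * k) / k < k := fun i => Nat.div_lt_of_lt_mul (Nat.mod_lt _ hc)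
    have hm' : ∀ i, i % k < k := fun i => Nat.mod_lt _ (by omega)
    have key := ih _ (hdiv i hi) _ (hdiv j hj) _ (hdiv l hl)
    have key2 := S.sum_eq _ (Nat.mod_lt i hc) _ (Nat.mod_lt j hc) _ (Nat.mod_lt l hc)
    simp only [Nat.mod_mul_right_mod] at key2
    rw [rowIdx_eq hk i, rowIdx_eq hk j, rowIdx_eq hk l, colIdx_eq hk i, colIdx_eq hk j,
      colIdx_eq hk l, pow_succ R, sum_range_mul]
    simp only [mul_add_eq_iff (hm' i) (hm j), mul_add_eq_iff (hm i) (hm l),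
      mul_add_eq_iff (hm' j) (hm' l)]
    have : ∀ r ∈ Finset.range (R ^ d), ∀ r' ∈ Finset.range R,
        tensorPow S.α (k * k) R (d + 1) (r * R + r') i *
        tensorPow S.β (k * k) R (d + 1) (r * R + r') j *
        tensorPow (fun l r => S.γ r l) R (k * k) (d + 1) l (r * R + r') =
        (tensorPow S.α (k * k) R d r (i / (k * k)) * tensorPow S.β (k * k) R d r (j / (k * k)) *
          tensorPow (fun l r => S.γ r l) R (k * k) d (l / (k * k)) r) *
        (S.α r' (i % (k * k)) * S.β r' (j % (k * k)) * S.γ r' (l % (k * k))) := by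
      intro r _ r' hr'
      have hr' := Finset.mem_range.1 hr'
      have h5 : (r * R + r') / R = r := by
        rw [Nat.add_comm, Nat.add_mul_div_right _ _ (by omega), Nat.div_eq_of_lt hr', zero_add]
      have h6 : (r * R + r') % R = r' := by
        rw [Nat.add_comm, Nat.add_mul_mod_self_right, Nat.mod_eq_of_lt hr']
      simp only [tensorPow, h5, h6]
      ring
    rw [Finset.sum_congr rfl fun r hr => Finset.sum_congr rfl (this r hr),
      ← Finset.sum_mul_sum, key, key2, ite_zero_mul_ite_zero,
      pow_succ]
    refine if_congr ?_ rfl rfl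
    tauto

/-- The matrix product by means of tensor powers of a bilinear algorithm. -/
def product (d : ℕ) (A B : ℕ → ℤ) : ℕ → ℤ :=
  yates (fun l r => S.γ r l) R (k * k) d
    (fun r => yates S.α (k * k) R d A d r * yates S.β (k * k) R d B d r) d

/-- Both factors are transformed, multiplied pointwise and transformed back. Exchanging the sums
leaves the kernel of `sum_tensorPow`; after summing by rows and columns only the terms with matching
inner index survive. -/
theorem product_eq (hk : 1 < k) {d : ℕ} (A B : ℕ → ℕ → ℤ) {l : ℕ} (hl : l < (k * k) ^ d) :
    S.product d (fun i => A (rowIdx k i) (colIdx k i)) (fun i => B (rowIdx k i) (colIdx k i)) l =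
      (S.D : ℤ) ^ d * ∑ y ∈ Finset.range (k ^ d), A (rowIdx k l) y * B y (colIdx k l) := by
  have h1 : ∀ r ∈ Finset.range (R ^ d), tensorPow (fun l r => S.γ r l) R (k * k) d l r *
      (yates S.α (k * k) R d (fun i => A (rowIdx k i) (colIdx k i)) d r *
        yates S.β (k * k) R d (fun i => B (rowIdx k i) (colIdx k i)) d r) =
      ∑ i ∈ Finset.range ((k * k) ^ d), ∑ j ∈ Finset.range ((k * k) ^ d),
        A (rowIdx k i) (colIdx k i) * B (rowIdx k j) (colIdx k j) *
        (tensorPow S.α (k * k) R d r i * tensorPow S.β (k * k) R d r j *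
          tensorPow (fun l r => S.γ r l) R (k * k) d l r) := by
    intro r hr
    have hr := Finset.mem_range.1 hr
    rw [yates_self _ _ hr, yates_self _ _ hr, Finset.sum_mul_sum, Finset.mul_sum]
    refine Finset.sum_congr rfl fun i _ => ?_
    rw [Finset.mul_sum]
    refine Finset.sum_congr rfl fun j _ => ?_
    ring
  rw [product, yates_self _ _ hl, Finset.sum_congr rfl h1, Finset.sum_comm]
  have h2 : ∀ i ∈ Finset.range ((k * k) ^ d), ∑ r ∈ Finset.range (R ^ d),
      ∑ j ∈ Finset.range ((k * k) ^ d),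
        A (rowIdx k i) (colIdx k i) * B (rowIdx k j) (colIdx k j) *
        (tensorPow S.α (k * k) R d r i * tensorPow S.β (k * k) R d r j *
          tensorPow (fun l r => S.γ r l) R (k * k) d l r) =
      ∑ j ∈ Finset.range ((k * k) ^ d),
        A (rowIdx k i) (colIdx k i) * B (rowIdx k j) (colIdx k j) *
        (if colIdx k i = rowIdx k j ∧ rowIdx k i = rowIdx k l ∧ colIdx k j = colIdx k l
          then (S.D : ℤ) ^ d else 0) := by
    intro i hi
    rw [Finset.sum_comm]
    refine Finset.sum_congr rfl fun j hj => ?_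
    rw [← Finset.mul_sum, S.sum_tensorPow hk d i (Finset.mem_range.1 hi) j
      (Finset.mem_range.1 hj) l hl]
  rw [Finset.sum_congr rfl h2]
  have h3 : ∀ x y : ℕ, ∑ j ∈ Finset.range ((k * k) ^ d),
      A x y * B (rowIdx k j) (colIdx k j) *
        (if y = rowIdx k j ∧ x = rowIdx k l ∧ colIdx k j = colIdx k l
          then (S.D : ℤ) ^ d else 0) = ∑ x' ∈ Finset.range (k ^ d), ∑ y' ∈ Finset.range (k ^ d),
      A x y * B x' y' * (if y = x' ∧ x = rowIdx k l ∧ y' = colIdx k l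
          then (S.D : ℤ) ^ d else 0) := fun x y =>
    sum_rowIdx_colIdx hk d fun x' y' => A x y * B x' y' *
      (if y = x' ∧ x = rowIdx k l ∧ y' = colIdx k l then (S.D : ℤ) ^ d else 0)
  rw [Finset.sum_congr rfl fun i _ => h3 (rowIdx k i) (colIdx k i),
    sum_rowIdx_colIdx hk d fun x y => ∑ x' ∈ Finset.range (k ^ d), ∑ y' ∈ Finset.range (k ^ d),
      A x y * B x' y' * (if y = x' ∧ x = rowIdx k l ∧ y' = colIdx k l
          then (S.D : ℤ) ^ d else 0)]
  obtain ⟨hr, hc⟩ := idx_lt hk hl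
  rw [Finset.sum_eq_single_of_mem _ (Finset.mem_range.2 hr) fun x _ hx =>
    Finset.sum_eq_zero fun y _ => Finset.sum_eq_zero fun x' _ => Finset.sum_eq_zero fun y' _ => by
      rw [if_neg fun h => hx h.2.1, mul_zero], Finset.mul_sum]
  refine Finset.sum_congr rfl fun y hy => ?_
  rw [Finset.sum_eq_single_of_mem y hy fun x' _ hx => Finset.sum_eq_zero fun y' _ => by
      rw [if_neg fun h => hx h.1.symm, mul_zero],
    Finset.sum_eq_single_of_mem _ (Finset.mem_range.2 hc) fun y' _ hy' => by
      rw [if_neg fun h => hy' h.2.2, mul_zero], if_pos ⟨rfl, rfl, rfl⟩]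
  ring

end BilinearAlgorithm

end

/-! ### Residues -/

/-- The residue of an integer as a natural number. -/
def residue (M : ℕ) (z : ℤ) : ℕ := (z % M).toNat

theorem residue_cast {M : ℕ} (hM : 0 < M) (z : ℤ) : (residue M z : ℤ) = z % M :=
  Int.toNat_of_nonneg (Int.emod_nonneg _ (by omega))

theorem residue_modEq {M : ℕ} (hM : 0 < M) (z : ℤ) : (residue M z : ℤ) ≡ z [ZMOD M] := by
  rw [residue_cast hM]; exact Int.mod_modEq z M

theorem mod_eq_residue {M : ℕ} (hM : 0 < M) {a : ℕ} {z : ℤ} (h : (a : ℤ) ≡ z [ZMOD M]) :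
    a % M = residue M z := by
  zify
  rw [residue_cast hM]; exact h

theorem residue_lt {M : ℕ} (hM : 0 < M) (z : ℤ) : residue M z < M := by
  zify
  rw [residue_cast hM]; exact Int.emod_lt_of_pos _ (by omega)

theorem residue_natCast {M a : ℕ} (h : a < M) : residue M (a : ℤ) = a := by
  rw [← mod_eq_residue (by omega) (Int.ModEq.refl _), Nat.mod_eq_of_lt h]

/-- A natural number in the residue class of `z` modulo `M`. -/
theorem toNat_add_modEq {M : ℕ} (hM : 0 < M) (z : ℤ) :
    ((z.toNat + (M - 1) * (-z).toNat : ℕ) : ℤ) ≡ z [ZMOD M] := by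
  rw [Int.modEq_iff_dvd]
  push_cast [Nat.cast_sub (Nat.one_le_of_lt hM)]
  refine ⟨-((-z).toNat : ℤ), ?_⟩
  have := Int.toNat_sub_toNat_neg z
  linear_combination -this

/-! ### Cutwidth of induced subgraphs and of concatenations -/

section Width

variable {V : Type*} [Fintype V]

instance nonempty_ordering : Nonempty (Ordering V) := ⟨Fintype.equivFin V⟩

theorem dirCutwidth_le (G : Digraph V) (π : Ordering V) : dirCutwidth G ≤ width G π :=
  Nat.sInf_le ⟨π, rfl⟩

theorem exists_width_eq (G : Digraph V) : ∃ π : Ordering V, width G π = dirCutwidth G :=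
  Nat.sInf_mem (Set.range_nonempty _)

theorem ncard_cut_le (G : Digraph V) (π : Ordering V) (i : ℕ) :
    (cut G π i).ncard ≤ width G π := by
  by_cases hi : i ∈ Finset.Icc 1 (Fintype.card V - 1)
  · exact Finset.le_sup (f := fun i => (cut G π i).ncard) hi
  · have : cut G π i = ∅ := by
      ext ⟨u, v⟩
      simp only [cut, Set.mem_ofPred_eq, Set.mem_empty_iff_false, iff_false, not_and]
      intro _ h1 h2
      have h3 := (π u).2
      exact hi (Finset.mem_Icc.2 (by omega))
    rw [this]; simp

theorem width_le {G : Digraph V} {π : Ordering V} {w : ℕ}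
    (h : ∀ i ≤ Fintype.card V, 0 < i → (cut G π i).ncard ≤ w) : width G π ≤ w :=
  Finset.sup_le fun i hi => by
    rw [Finset.mem_Icc] at hi
    exact h i (by omega) (by omega)

theorem ncard_cut_eq (G : Digraph V) (π : Ordering V) {i : ℕ} {T : Finset V}
    (hT : ∀ v, v ∈ T ↔ (π v : ℕ) < i) : (cut G π i).ncard = cutSize G T := by
  unfold cut cutSize
  congr 1
  ext ⟨u, v⟩
  simp only [Set.mem_ofPred_eq, hT]
  exact and_congr_right fun _ => by omega

theorem exists_ordering_le_iff {f : V → ℕ} (hf : Function.Injective f) :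
    ∃ ρ : Ordering V, ∀ u v, ρ u ≤ ρ v ↔ f u ≤ f v := by
  classical
  have hcard : (Finset.univ.image f).card = Fintype.card V := by
    rw [Finset.card_image_of_injective _ hf, Finset.card_univ]
  let o := (Finset.univ.image f).orderIsoOfFin hcard
  let g : V ≃ (Finset.univ.image f) :=
    Equiv.ofBijective (fun v => ⟨f v, Finset.mem_image_of_mem f (Finset.mem_univ v)⟩)
      ⟨fun u v h => hf (Subtype.ext_iff.1 h), fun ⟨x, hx⟩ => by
        obtain ⟨v, -, rfl⟩ := Finset.mem_image.1 hx
        exact ⟨v, rfl⟩⟩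
  refine ⟨g.trans o.symm.toEquiv, fun u v => ?_⟩
  change o.symm (g u) ≤ o.symm (g v) ↔ _
  rw [o.symm.le_iff_le]
  rfl

omit [Fintype V] in
theorem ncard_image_cut (G : Digraph V) (S : Finset V) (ρ : Ordering S) (i : ℕ) :
    ((Prod.map (↑) (↑) : S × S → V × V) '' cut (induced G S) ρ i).ncard =
      (cut (induced G S) ρ i).ncard :=
  Set.ncard_image_of_injective _ (Subtype.val_injective.prodMap Subtype.val_injective)

/-- An optimal ordering of `V` is restricted to `S`. The cut of the restriction at `i` is contained
in the cut of `π` just before the vertex of `S` that has rank `i` when ranks are counted from `0`.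
-/
theorem dirCutwidth_induced_le (G : Digraph V) (S : Finset V) :
    dirCutwidth (induced G S) ≤ dirCutwidth G := by
  obtain ⟨π, hπ⟩ := exists_width_eq G
  rw [← hπ]
  obtain ⟨ρ, hρ⟩ := exists_ordering_le_iff (f := fun v : S => (π v : ℕ))
    (fun u v h => Subtype.ext (π.injective (Fin.ext h)))
  refine (dirCutwidth_le _ ρ).trans (width_le fun i hi hi0 => ?_)
  rcases Nat.lt_or_ge i (Fintype.card S) with h | h
  · have key : ∀ v : S, (ρ v : ℕ) < i ↔ (π v : ℕ) < π (ρ.symm ⟨i, h⟩) := by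
      intro v
      have := hρ (ρ.symm ⟨i, h⟩) v
      rw [Equiv.apply_symm_apply, Fin.le_def] at this
      simp only at this
      omega
    refine le_trans ?_ (ncard_cut_le G π (π (ρ.symm ⟨i, h⟩)))
    rw [← ncard_image_cut]
    refine Set.ncard_le_ncard ?_ (Set.toFinite _)
    rintro _ ⟨⟨u, v⟩, ⟨h1, h2, h3⟩, rfl⟩
    have := key u
    have := key v
    refine ⟨h1, ?_, ?_⟩ <;> simp only [Prod.map] at * <;> omega
  · have : cut (induced G S) ρ i = ∅ := by
      ext ⟨u, v⟩
      simp only [cut, Set.mem_ofPred_eq, Set.mem_empty_iff_false, iff_false, not_and]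
      intro _ h1
      have := (ρ u).2
      omega
    rw [this]; simp

/-- The first `k` vertices of an optimal ordering compete with `L`, and the arcs entering them are
one of the cuts of that ordering. -/
theorem cutSize_le_dirCutwidth {G : Digraph V} {k : ℕ} (hk : k ≤ Fintype.card V) {L : Finset V}
    (hL : IsMinCut G k L) : cutSize G L ≤ dirCutwidth G := by
  classical
  obtain ⟨π, hπ⟩ := exists_width_eq G
  have hT : ∀ v, v ∈ Finset.univ.filter (fun v => (π v : ℕ) < k) ↔ (π v : ℕ) < k := by simp
  have hcard : (Finset.univ.filter fun v => (π v : ℕ) < k).card = k := by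
    rw [← Finset.card_map π.toEmbedding]
    have : (Finset.univ.filter fun v => (π v : ℕ) < k).map π.toEmbedding =
        Finset.univ.filter fun j : Fin (Fintype.card V) => (j : ℕ) < k := by
      ext j
      simp only [Finset.mem_map, Finset.mem_filter, Finset.mem_univ, true_and,
        Equiv.coe_toEmbedding]
      exact ⟨fun ⟨v, hv, h⟩ => h ▸ hv, fun h => ⟨π.symm j, by simpa using h, by simp⟩⟩
    rw [this, Fin.card_filter_val_lt, min_eq_right hk]
  rw [← hπ]
  exact (hL.2 _ hcard).trans ((ncard_cut_eq G π hT).symm.trans_le (ncard_cut_le G π k))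

/-- At a position up to `|L|` the heads of cut arcs are in `L`, and at a later position their tails
are outside `L`. In both cases a cut arc either stays on that side, where it belongs to a cut of its
ordering, or enters `L`. The two sides are never charged together, hence the maximum. -/
theorem width_concat_le [DecidableEq V] {G : Digraph V} {π : Ordering V} {L : Finset V}
    {πL : Ordering L} {πR : Ordering (Lᶜ : Finset V)} (h : IsConcat π L πL πR) :
    width G π ≤ max (width (induced G L) πL) (width (induced G Lᶜ) πR) + cutSize G L := by
  have hlt : ∀ v, v ∈ L ↔ (π v : ℕ) < L.card := by
    intro v
    constructor
    · intro hv
      have h1 := h.1 ⟨v, hv⟩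
      have h2 := (πL ⟨v, hv⟩).2
      have h3 := Fintype.card_coe L
      simp only at h1
      omega
    · intro hv
      by_contra hn
      have h1 := h.2 ⟨v, Finset.mem_compl.2 hn⟩
      simp only at h1
      omega
  refine width_le fun i _ _ => ?_
  rcases le_total i L.card with hi | hi
  · have hsub : cut G π i ⊆ ((Prod.map (↑) (↑) : L × L → V × V) '' cut (induced G L) πL i) ∪
        {a : V × V | G.Adj a.1 a.2 ∧ a.1 ∉ L ∧ a.2 ∈ L} := by
      rintro ⟨u, v⟩ ⟨h1, h2, h3⟩
      have hv : v ∈ L := (hlt v).2 (by simp only at h3; omega)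
      by_cases hu : u ∈ L
      · left
        refine ⟨(⟨u, hu⟩, ⟨v, hv⟩), ⟨h1, ?_, ?_⟩, rfl⟩
        · rw [← h.1]; exact h2
        · rw [← h.1]; exact h3
      · exact .inr ⟨h1, hu, hv⟩
    have h4 := Set.ncard_le_ncard hsub (Set.toFinite _)
    have h5 := Set.ncard_union_le ((Prod.map (↑) (↑) : L × L → V × V) '' cut (induced G L) πL i)
      {a : V × V | G.Adj a.1 a.2 ∧ a.1 ∉ L ∧ a.2 ∈ L}
    rw [ncard_image_cut] at h5
    have h6 := ncard_cut_le (induced G L) πL i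
    have h7 := le_max_left (width (induced G L) πL) (width (induced G Lᶜ) πR)
    unfold cutSize
    omega
  · have hsub : cut G π i ⊆ ((Prod.map (↑) (↑) : (Lᶜ : Finset V) × (Lᶜ : Finset V) → V × V) ''
        cut (induced G Lᶜ) πR (i - L.card)) ∪
        {a : V × V | G.Adj a.1 a.2 ∧ a.1 ∉ L ∧ a.2 ∈ L} := by
      rintro ⟨u, v⟩ ⟨h1, h2, h3⟩
      have hu : u ∉ L := fun hu => by
        have := (hlt u).1 hu
        simp only at h2
        omega
      by_cases hv : v ∈ L
      · exact .inr ⟨h1, hu, hv⟩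
      · left
        refine ⟨(⟨u, Finset.mem_compl.2 hu⟩, ⟨v, Finset.mem_compl.2 hv⟩), ⟨h1, ?_, ?_⟩, rfl⟩
        · have := h.2 ⟨u, Finset.mem_compl.2 hu⟩
          simp only at *
          omega
        · have := h.2 ⟨v, Finset.mem_compl.2 hv⟩
          simp only at *
          omega
    have h4 := Set.ncard_le_ncard hsub (Set.toFinite _)
    have h5 := Set.ncard_union_le ((Prod.map (↑) (↑) :
      (Lᶜ : Finset V) × (Lᶜ : Finset V) → V × V) '' cut (induced G Lᶜ) πR (i - L.card))
      {a : V × V | G.Adj a.1 a.2 ∧ a.1 ∉ L ∧ a.2 ∈ L}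
    rw [ncard_image_cut] at h5
    have h6 := ncard_cut_le (induced G Lᶜ) πR (i - L.card)
    have h7 := le_max_right (width (induced G L) πL) (width (induced G Lᶜ) πR)
    unfold cutSize
    omega

/-- The concatenation of optimal orderings of the two sides of a minimum balanced cut has at most
twice the optimal width. -/
theorem width_concat_le_two_mul [DecidableEq V] {G : Digraph V} {π : Ordering V} {L : Finset V}
    {πL : Ordering L} {πR : Ordering (Lᶜ : Finset V)} (h : IsConcat π L πL πR) {k : ℕ}
    (hk : k ≤ Fintype.card V) (hL : IsMinCut G k L)
    (h1 : width (induced G L) πL = dirCutwidth (induced G L))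
    (h2 : width (induced G Lᶜ) πR = dirCutwidth (induced G Lᶜ)) :
    width G π ≤ 2 * dirCutwidth G := by
  have h3 := width_concat_le (G := G) h
  have h4 := cutSize_le_dirCutwidth hk hL
  have h5 := dirCutwidth_induced_le G L
  have h6 := dirCutwidth_induced_le G Lᶜ
  rw [h1, h2] at h3
  have := max_le h5 h6
  omega

end Width

/-! ### Dynamic programming over vertex sets -/

section DynamicProgramming

variable {W : Type*} [Fintype W] [DecidableEq W]

/-- The set `T` can be built up by adding vertices one at a time such that every nonempty
intermediate set (including `T`) has at most `c` entering arcs. -/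
inductive Reaches (H : Digraph W) (c : ℕ) : Finset W → Prop
  | empty : Reaches H c ∅
  | insert {v : W} {T : Finset W} : v ∉ T → Reaches H c T → cutSize H (insert v T) ≤ c →
      Reaches H c (insert v T)

/-- The smallest `c` such that `T` can be built up with cuts of size at most `c`. -/
noncomputable def optWidth (H : Digraph W) (T : Finset W) : ℕ := sInf {c | Reaches H c T}

variable {H : Digraph W} {c : ℕ} {T : Finset W}

omit [Fintype W] in
theorem Reaches.mono (h : Reaches H c T) {c' : ℕ} (hc : c ≤ c') : Reaches H c' T := by
  induction h with
  | empty => exact .empty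
  | insert hv _ h ih => exact .insert hv ih (h.trans hc)

omit [Fintype W] in
theorem reaches_iff : Reaches H c T ↔
    T = ∅ ∨ cutSize H T ≤ c ∧ ∃ v ∈ T, Reaches H c (T.erase v) := by
  constructor
  · rintro (_ | ⟨hv, h, hc⟩)
    · exact .inl rfl
    · exact .inr ⟨hc, _, Finset.mem_insert_self _ _, by rwa [Finset.erase_insert hv]⟩
  · rintro (rfl | ⟨hc, v, hv, h⟩)
    · exact .empty
    · rw [← Finset.insert_erase hv] at hc ⊢
      exact .insert (Finset.notMem_erase v T) h hc

omit [DecidableEq W] in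
theorem cutSize_le_sq (H : Digraph W) (T : Finset W) :
    cutSize H T ≤ Fintype.card W * Fintype.card W := by
  unfold cutSize
  refine (Set.ncard_le_ncard (Set.subset_univ _) (Set.toFinite _)).trans ?_
  rw [Set.ncard_univ, Nat.card_eq_fintype_card, Fintype.card_prod]

theorem reaches_sq (H : Digraph W) (T : Finset W) :
    Reaches H (Fintype.card W * Fintype.card W) T := by
  induction T using Finset.induction_on with
  | empty => exact .empty
  | insert v T hv ih => exact .insert hv ih (cutSize_le_sq _ _)

theorem optWidth_le_iff : optWidth H T ≤ c ↔ Reaches H c T :=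
  ⟨fun h => (Nat.sInf_mem (s := {c | Reaches H c T}) ⟨_, reaches_sq H T⟩).mono h,
    fun h => Nat.sInf_le h⟩

theorem optWidth_le_sq (H : Digraph W) (T : Finset W) :
    optWidth H T ≤ Fintype.card W * Fintype.card W := optWidth_le_iff.2 (reaches_sq H T)

theorem cutSize_le_optWidth (h : T.Nonempty) : cutSize H T ≤ optWidth H T := by
  rcases reaches_iff.1 (optWidth_le_iff.1 (le_refl (optWidth H T))) with h' | h'
  · exact absurd h' h.ne_empty
  · exact h'.1

theorem exists_optWidth_erase_le (h : T.Nonempty) :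
    ∃ v ∈ T, optWidth H (T.erase v) ≤ optWidth H T := by
  rcases reaches_iff.1 (optWidth_le_iff.1 (le_refl (optWidth H T))) with h' | ⟨-, v, hv, h'⟩
  · exact absurd h' h.ne_empty
  · exact ⟨v, hv, optWidth_le_iff.2 h'⟩

/-- Prefixes of the ordering grow by one vertex at a time, and the arcs entering a prefix form a cut
of the ordering. -/
theorem reaches_of_ordering (H : Digraph W) (π : Ordering W) (i : ℕ) :
    i ≤ Fintype.card W → Reaches H (width H π) (Finset.univ.filter fun v => (π v : ℕ) < i) := by
  induction i with
  | zero => intro _; simpa using Reaches.empty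
  | succ i ih =>
    intro hi
    have : (Finset.univ.filter fun v => (π v : ℕ) < i + 1) =
        insert (π.symm ⟨i, hi⟩) (Finset.univ.filter fun v => (π v : ℕ) < i) := by
      ext v
      simp only [Finset.mem_filter, Finset.mem_univ, true_and, Finset.mem_insert,
        Equiv.eq_symm_apply, Fin.ext_iff]
      omega
    have hcut := (ncard_cut_eq H π (i := i + 1)
      (T := Finset.univ.filter fun v => (π v : ℕ) < i + 1) (by simp)).symm.trans_le
      (ncard_cut_le H π (i + 1))
    rw [this] at hcut ⊢
    exact .insert (by simp) (ih (by omega)) hcut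

theorem optWidth_univ_le (H : Digraph W) : optWidth H Finset.univ ≤ dirCutwidth H := by
  obtain ⟨π, hπ⟩ := exists_width_eq H
  rw [← hπ, optWidth_le_iff]
  have := reaches_of_ordering H π (Fintype.card W) le_rfl
  rwa [Finset.filter_true_of_mem fun v _ => (π v).2] at this

/-- Removing vertices one at a time without increasing the optimal width of the rest yields an
optimal ordering. -/
theorem exists_ordering_of_chain (H : Digraph W) {T : ℕ → Finset W} (h0 : T 0 = Finset.univ)
    (hT : ∀ t < Fintype.card W, ∃ v ∈ T t, T (t + 1) = (T t).erase v ∧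
      optWidth H (T (t + 1)) ≤ optWidth H (T t)) :
    ∃ π : Ordering W, (∀ v, (π v : ℕ) = Fintype.card W -
      ((Finset.range (Fintype.card W + 1)).filter fun t => v ∈ T t).card) ∧
      width H π = dirCutwidth H := by
  set m := Fintype.card W with hm
  have hcard : ∀ t ≤ m, (T t).card = m - t := by
    intro t
    induction t with
    | zero => intro _; rw [h0, Finset.card_univ, ← hm]; rfl
    | succ t ih =>
      intro ht
      obtain ⟨v, hv, he, -⟩ := hT t ht
      rw [he, Finset.card_erase_of_mem hv, ih (by omega)]
      omega
  have hopt : ∀ t ≤ m, optWidth H (T t) ≤ optWidth H Finset.univ := by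
    intro t
    induction t with
    | zero => intro _; rw [h0]
    | succ t ih =>
      intro ht
      obtain ⟨v, hv, -, h⟩ := hT t ht
      exact h.trans (ih (by omega))
  have hanti : ∀ s t, s ≤ t → t ≤ m → T t ⊆ T s := by
    intro s t hst
    induction t, hst using Nat.le_induction with
    | base => intro _; exact Finset.Subset.refl _
    | succ t _ ih =>
      intro ht
      obtain ⟨v, hv, he, -⟩ := hT t ht
      rw [he]
      exact (Finset.erase_subset _ _).trans (ih (by omega))
  have hlast : T m = ∅ := Finset.card_eq_zero.1 (by rw [hcard m le_rfl, Nat.sub_self])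
  -- The sets decrease, so `v` belongs to `T t` exactly for `t < N v`. The vertex removed first must
  -- come last, which is why the position is `m - N v`; exactly one vertex leaves at each step, so
  -- `N` is injective.
  set N : W → ℕ := fun v => ((Finset.range (m + 1)).filter fun t => v ∈ T t).card with hN
  have hmem : ∀ v, ∀ t ≤ m, (v ∈ T t ↔ t < N v) := by
    intro v t ht
    constructor
    · intro h
      have : Finset.range (t + 1) ⊆ (Finset.range (m + 1)).filter fun t => v ∈ T t := by
        intro s hs
        rw [Finset.mem_range] at hs
        exact Finset.mem_filter.2 ⟨Finset.mem_range.2 (by omega), hanti s t (by omega) ht h⟩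
      have := Finset.card_le_card this
      rw [Finset.card_range] at this
      exact this
    · intro h
      by_contra hv
      have : (Finset.range (m + 1)).filter (fun t => v ∈ T t) ⊆ Finset.range t := by
        intro s hs
        obtain ⟨h1, h2⟩ := Finset.mem_filter.1 hs
        rw [Finset.mem_range] at h1 ⊢
        by_contra hst
        exact hv (hanti t s (by omega) (by omega) h2)
      have := Finset.card_le_card this
      rw [Finset.card_range] at this
      exact absurd this (by simp only [hN] at h; omega)
  have hpos : ∀ v, 0 < N v := fun v => (hmem v 0 (Nat.zero_le _)).1 (by rw [h0]; simp)
  have hle : ∀ v, N v ≤ m := fun v => by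
    have := hmem v m le_rfl
    rw [hlast] at this
    simp only [Finset.notMem_empty, false_iff, not_lt] at this
    exact this
  have hinj : Function.Injective N := by
    intro v w h
    have h1 := hpos v
    have h2 := hle v
    obtain ⟨x, -, he, -⟩ := hT (N v - 1) (by omega)
    rw [Nat.sub_add_cancel h1] at he
    have key : ∀ u, N u = N v → u = x := by
      intro u hu
      have h3 := (hmem u (N v - 1) (by omega)).2 (by omega)
      have h4 : u ∉ T (N v) := fun h => by
        have := (hmem u (N v) h2).1 h
        omega
      by_contra hne
      exact h4 (he ▸ Finset.mem_erase.2 ⟨hne, h3⟩)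
    exact (key v rfl).trans (key w h.symm).symm
  let π : Ordering W := Equiv.ofBijective
    (fun v => (⟨m - N v, by have := hpos v; have := hle v; omega⟩ : Fin (Fintype.card W)))
    ((Fintype.bijective_iff_injective_and_card _).2 ⟨fun v w h => hinj (by
      have h3 := hle v
      have h4 := hle w
      have := Fin.mk.inj h
      omega), by simp⟩)
  have hπ : ∀ v, (π v : ℕ) = m - N v := fun v => rfl
  refine ⟨π, hπ, le_antisymm ?_ (dirCutwidth_le H π)⟩
  refine (width_le fun i hi hi0 => ?_).trans (optWidth_univ_le H)
  rw [ncard_cut_eq H π (T := T (m - i))]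
  · have hne : (T (m - i)).Nonempty := Finset.card_pos.1 (by rw [hcard _ (by omega)]; omega)
    exact (cutSize_le_optWidth hne).trans (hopt _ (by omega))
  · intro v
    have h3 := hpos v
    have h4 := hle v
    rw [hmem v _ (by omega), hπ]
    omega

end DynamicProgramming

/-! ### Values of table expressions -/

/-- In every state with the arrays `A` in which the first variables have the values `vs`, the
expression `e` has the value `v`. -/
def HasValue (I : Mem) (A : State) (vs : List ℕ) (e : TExpr) (v : ℕ) : Prop :=
  ∀ ρ : State, (∀ a, a ≠ 0 → ρ a = A a) → (∀ i (h : i < vs.length), ρ 0 i = vs[i]) →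
    e.eval I ρ = v

namespace TExpr

/-- The variable `x`. -/
def var (x : ℕ) : TExpr := .arr 0 (.const x)

/-- A bounded sum. -/
def sum (x : ℕ) (N : Bound) (e : TExpr) : TExpr := .fold false x N e

/-- The least value of `x` for which `e` is not zero. -/
def find (x : ℕ) (N : Bound) (e : TExpr) : TExpr := .fold true x N e

/-- The remainder. -/
def mod (a b : TExpr) : TExpr := .sub a (.mul (.div a b) b)

/-- The truth value of `a < b`. -/
def lt (a b : TExpr) : TExpr := .sub (.const 1) (.sub (.const 1) (.sub b a))

/-- The truth value of `a ≤ b`. -/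
def le (a b : TExpr) : TExpr := .sub (.const 1) (.sub a b)

/-- The truth value of `a = b`. -/
def eq (a b : TExpr) : TExpr := .sub (.const 1) (.add (.sub a b) (.sub b a))

/-- The value of `a` if `c` is `1` and of `b` if `c` is `0`. -/
def ite (c a b : TExpr) : TExpr := .add (.mul c a) (.mul (.sub (.const 1) c) b)

/-- A sum with a constant number of terms. -/
def finSum (g : ℕ → TExpr) : ℕ → TExpr
  | 0 => .const 0
  | m + 1 => .add (finSum g m) (g m)

/-- A loop bound as a table expression. -/
def ofBound : Bound → TExpr
  | .const k => .const k
  | .n => .inp (.const 0)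
  | .add a b => .add (ofBound a) (ofBound b)
  | .mul a b => .mul (ofBound a) (ofBound b)
  | .div a b => .div (ofBound a) (ofBound b)

/-- The entry of the adjacency matrix. -/
def adj (u v : TExpr) : TExpr :=
  .inp (.add (.add (.const 1) (.mul u (.inp (.const 0)))) v)

end TExpr

namespace HasValue

open TExpr

variable {I : Mem} {A : State} {vs : List ℕ} {e f g : TExpr} {v w u : ℕ}

theorem weaken (h : HasValue I A vs e v) (ws : List ℕ) : HasValue I A (vs ++ ws) e v :=
  fun ρ h1 h2 => h ρ h1 fun i hi => by
    rw [h2 i (by simp; omega), List.getElem_append_left hi]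

theorem congr (h : HasValue I A vs e v) (hv : v = w) : HasValue I A vs e w := hv ▸ h

theorem const (k : ℕ) : HasValue I A vs (.const k) k := fun _ _ _ => rfl

theorem var {x : ℕ} (hx : x < vs.length) : HasValue I A vs (.var x) vs[x] :=
  fun _ _ h2 => h2 x hx

theorem add (he : HasValue I A vs e v) (hf : HasValue I A vs f w) :
    HasValue I A vs (.add e f) (v + w) := fun ρ h1 h2 => by
  rw [TExpr.eval, he ρ h1 h2, hf ρ h1 h2]

theorem sub (he : HasValue I A vs e v) (hf : HasValue I A vs f w) :
    HasValue I A vs (.sub e f) (v - w) := fun ρ h1 h2 => by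
  rw [TExpr.eval, he ρ h1 h2, hf ρ h1 h2]

theorem mul (he : HasValue I A vs e v) (hf : HasValue I A vs f w) :
    HasValue I A vs (.mul e f) (v * w) := fun ρ h1 h2 => by
  rw [TExpr.eval, he ρ h1 h2, hf ρ h1 h2]

theorem div (he : HasValue I A vs e v) (hf : HasValue I A vs f w) :
    HasValue I A vs (.div e f) (v / w) := fun ρ h1 h2 => by
  rw [TExpr.eval, he ρ h1 h2, hf ρ h1 h2]

/-- No value of `f` is required: a guard that evaluates to `0` may be multiplied with an expression
that reads table entries not yet defined. -/
theorem zero_mul (he : HasValue I A vs e 0) (f : TExpr) : HasValue I A vs (.mul e f) 0 :=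
  fun ρ h1 h2 => by rw [TExpr.eval, he ρ h1 h2, Nat.zero_mul]

theorem arr {a i : ℕ} (ha : a ≠ 0) (he : HasValue I A vs e i) (hA : A a i = v) :
    HasValue I A vs (.arr a e) v := fun ρ h1 h2 => by
  rw [TExpr.eval, he ρ h1 h2, h1 a ha, hA]

theorem mod (he : HasValue I A vs e v) (hf : HasValue I A vs f w) :
    HasValue I A vs (.mod e f) (v % w) :=
  (he.sub ((he.div hf).mul hf)).congr (by rw [Nat.mod_eq_sub_div_mul])

theorem lt (he : HasValue I A vs e v) (hf : HasValue I A vs f w) :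
    HasValue I A vs (.lt e f) (if v < w then 1 else 0) :=
  ((const 1).sub ((const 1).sub (hf.sub he))).congr (by split_ifs <;> omega)

theorem le (he : HasValue I A vs e v) (hf : HasValue I A vs f w) :
    HasValue I A vs (.le e f) (if v ≤ w then 1 else 0) :=
  ((const 1).sub (he.sub hf)).congr (by split_ifs <;> omega)

theorem eq (he : HasValue I A vs e v) (hf : HasValue I A vs f w) :
    HasValue I A vs (.eq e f) (if v = w then 1 else 0) :=
  ((const 1).sub ((he.sub hf).add (hf.sub he))).congr (by split_ifs <;> omega)

theorem ite {p : Prop} [Decidable p] (he : HasValue I A vs e (if p then 1 else 0))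
    (hf : p → HasValue I A vs f v) (hg : ¬ p → HasValue I A vs g w) :
    HasValue I A vs (.ite e f g) (if p then v else w) := by
  by_cases hp : p
  · rw [if_pos hp] at he ⊢
    exact ((he.mul (hf hp)).add (((const 1).sub he).zero_mul g)).congr (by omega)
  · rw [if_neg hp] at he ⊢
    exact ((he.zero_mul f).add (((const 1).sub he).mul (hg hp))).congr (by omega)

/-- The bound variable is numbered by the length of the context, so nested folds use distinct
variables and those of the context keep their values. -/
theorem fold {b : Bool} {N : Bound} {g : ℕ → ℕ} {x n : ℕ} (hn : N.val (I 0) = n)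
    (hx : x = vs.length) (he : ∀ j < n, HasValue I A (vs ++ [j]) e (g j)) :
    HasValue I A vs (.fold b x N e) (foldVal b g n) := fun ρ h1 h2 => by
  subst hx
  rw [TExpr.eval, hn]
  refine foldVal_congr fun j hj => he j hj _ (fun a ha => ?_) fun i hi => ?_
  · rw [setVar_arr _ _ _ _ ha, h1 a ha]
  · rw [setVar_var]
    rw [List.length_append, List.length_singleton] at hi
    split_ifs with h
    · subst h; simp
    · rw [List.getElem_append_left (by omega), h2 i (by omega)]

theorem sum {N : Bound} {g : ℕ → ℕ} {x n : ℕ} (hn : N.val (I 0) = n)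
    (hx : x = vs.length) (he : ∀ j < n, HasValue I A (vs ++ [j]) e (g j)) :
    HasValue I A vs (.sum x N e) (∑ j ∈ Finset.range n, g j) :=
  (fold hn hx he).congr (foldVal_sum g n)

theorem find {N : Bound} {g : ℕ → ℕ} {x n : ℕ} (hn : N.val (I 0) = n)
    (hx : x = vs.length) (he : ∀ j < n, HasValue I A (vs ++ [j]) e (g j)) :
    HasValue I A vs (.find x N e) (foldVal true g n) := fold hn hx he

theorem finSum {g : ℕ → TExpr} {v : ℕ → ℕ} {m : ℕ} (h : ∀ i < m, HasValue I A vs (g i) (v i)) :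
    HasValue I A vs (.finSum g m) (∑ i ∈ Finset.range m, v i) := by
  induction m with
  | zero => exact const 0
  | succ m ih =>
    rw [Finset.sum_range_succ]
    exact (ih fun i hi => h i (by omega)).add (h m (by omega))

theorem ofBound (B : Bound) : HasValue I A vs (.ofBound B) (B.val (I 0)) := by
  induction B with
  | const k => exact const k
  | n => exact fun ρ _ _ => by simp [TExpr.ofBound, TExpr.eval, Bound.val]
  | add a b ha hb => exact ha.add hb
  | mul a b ha hb => exact ha.mul hb
  | div a b ha hb => exact ha.div hb

open Classical in
theorem adj {n : ℕ} {G : Digraph (Fin n)} (he : HasValue (graphInput G) A vs e v)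
    (hf : HasValue (graphInput G) A vs f w) (hv : v < n) (hw : w < n) :
    HasValue (graphInput G) A vs (.adj e f) (if G.Adj ⟨v, hv⟩ ⟨w, hw⟩ then 1 else 0) := by
  intro ρ h1 h2
  have h0 : graphInput G 0 = n := by simp [graphInput]
  have hle : 1 + v * n + w ≤ n * n := by
    have := Nat.mul_le_mul_right n (Nat.succ_le_of_lt hv)
    rw [Nat.succ_mul] at this
    omega
  simp only [TExpr.adj, TExpr.eval, he ρ h1 h2, hf ρ h1 h2, h0, Nat.zero_mul,
    Nat.sub_eq_zero_of_le hle, Nat.sub_zero, Nat.mul_one]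
  rw [graphInput, if_neg (by omega)]
  refine if_congr ⟨?_, fun h => ⟨_, _, rfl, h⟩⟩ rfl rfl
  rintro ⟨i, j, h, hG⟩
  have h3 : v * n + w = i * n + j := by omega
  rw [mul_add_eq_iff hw j.2] at h3
  obtain ⟨rfl, rfl⟩ := h3
  exact hG

theorem eval_eq {ρ : State} {i : ℕ} (h : HasValue I ρ [i] e v) (hi : ρ 0 0 = i) :
    e.eval I ρ = v :=
  h ρ (fun _ _ => rfl) fun j hj => by
    obtain rfl : j = 0 := by simpa using hj
    exact hi

theorem eval_eq_nil {ρ : State} (h : HasValue I ρ [] e v) : e.eval I ρ = v :=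
  h ρ (fun _ _ => rfl) fun j hj => by simp at hj

end HasValue

/-! ### Tables of powers, of rows and columns, and of Yates' algorithm -/

namespace TExpr

/-- The entry with index variable `0` of the table `a` of the powers of `b`. -/
def geom (a b : ℕ) : TExpr :=
  .ite (.eq (.var 0) (.const 0)) (.const 1) (.mul (.const b) (.arr a (.sub (.var 0) (.const 1))))

/-- The entry with index variable `0` of a table for `digitMap`. -/
def digits (a c k : ℕ) (g : TExpr) : TExpr :=
  .ite (.eq (.var 0) (.const 0)) (.const 0)
    (.add (.mul (.arr a (.div (.var 0) (.const c))) (.const k)) g)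

/-- The entry `f i j` of a constant matrix modulo `M`. -/
def coeff (f : ℕ → ℕ → ℤ) (b a : ℕ) (M i j : TExpr) : TExpr :=
  .finSum (fun i' => .finSum (fun j' => .mul (.mul (.eq i (.const i')) (.eq j (.const j')))
    (.add (.const (f i' j').toNat) (.mul (.sub M (.const 1)) (.const (-f i' j').toNat)))) a) b

/-- The entry with index variable `0` of the table `t` of the levels of Yates' algorithm. The
levels have length `len`, `pa` and `pb` give the powers of `a` and `b`, `M` is the modulus and
`src` the vector to which the algorithm is applied. -/
def yatesLevel (f : ℕ → ℕ → ℤ) (a b t : ℕ) (d : Bound) (len M : TExpr) (pa pb src : TExpr → TExpr) :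
    TExpr :=
  let s := .div (.var 0) len
  let l := .mod (.var 0) len
  .mul (.lt l (.mul (pa (.sub (.ofBound d) s)) (pb s)))
    (.ite (.eq s (.const 0)) (src l)
      (.mod (.sum 1 (.const a) (.mul (coeff f b a M (.mod l (.const b)) (.var 1))
        (.arr t (.add (.mul (.sub s (.const 1)) len)
          (.add (.mul (.var 1) (.mul (pa (.sub (.ofBound d) s)) (pb (.sub s (.const 1)))))
            (.div l (.const b))))))) M))

end TExpr

namespace HasValue

open TExpr

variable {I : Mem} {A : State} {vs : List ℕ} {e : TExpr} {i : ℕ}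

theorem geom {a b : ℕ} (ha : a ≠ 0) (hA : ∀ j < i, A a j = b ^ j) :
    HasValue I A [i] (.geom a b) (b ^ i) := by
  have hi : HasValue I A [i] (.var 0) i := var (vs := [i]) (x := 0) (by simp)
  refine ((hi.eq (const 0)).ite (fun _ => const 1) (w := b * b ^ (i - 1)) fun h => ?_).congr ?_
  · exact (const b).mul (arr ha (hi.sub (const 1)) (hA _ (by omega)))
  · split_ifs with h
    · rw [h, pow_zero]
    · rw [← pow_succ', Nat.sub_add_cancel (by omega)]

theorem digits {a c k : ℕ} {g : ℕ → ℕ} (hc : 1 < c) (hg : g 0 = 0) (ha : a ≠ 0)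
    (hA : ∀ j < i, A a j = digitMap g c k j) (he : HasValue I A [i] e (g (i % c))) :
    HasValue I A [i] (.digits a c k e) (digitMap g c k i) := by
  have hi : HasValue I A [i] (.var 0) i := var (vs := [i]) (x := 0) (by simp)
  refine ((hi.eq (const 0)).ite (fun _ => const 0)
    (w := digitMap g c k (i / c) * k + g (i % c)) fun h => ?_).congr ?_
  · exact ((arr ha (hi.div (const c)) (hA _ (Nat.div_lt_self (by omega) hc))).mul
      (const k)).add he
  · split_ifs with h
    · rw [h, digitMap]; simp
    · rw [← digitMap_eq k hc hg]

/-- A constant matrix is looked up by a sum over all positions in which only the matching one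
survives. A negative coefficient `-c` is encoded as `(M - 1) * c`, its natural representative modulo
`M` by `toNat_add_modEq`. -/
theorem coeff (f : ℕ → ℕ → ℤ) {a b : ℕ} {Me ie je : TExpr} {M j : ℕ}
    (hM : HasValue I A vs Me M) (hi : HasValue I A vs ie i) (hj : HasValue I A vs je j)
    (hib : i < b) (hja : j < a) :
    HasValue I A vs (.coeff f b a Me ie je) ((f i j).toNat + (M - 1) * (-f i j).toNat) := by
  refine (finSum fun i' _ => finSum fun j' _ => ((hi.eq (const i')).mul (hj.eq (const j'))).mul
    ((const _).add ((hM.sub (const 1)).mul (const _)))).congr ?_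
  rw [Finset.sum_eq_single_of_mem i (Finset.mem_range.2 hib) fun i' _ h => by
      simp [Ne.symm h], Finset.sum_eq_single_of_mem j (Finset.mem_range.2 hja) fun j' _ h => by
      simp [Ne.symm h]]
  simp

end HasValue

/-- The table of the levels of Yates' algorithm modulo `M`, where each level takes `len` cells. -/
def yatesTable (f : ℕ → ℕ → ℤ) (a b d len M : ℕ) (x : ℕ → ℤ) (i : ℕ) : ℕ :=
  if i % len < a ^ (d - i / len) * b ^ (i / len) then
    residue M (yates f a b d x (i / len) (i % len)) else 0

theorem yatesTable_level (f : ℕ → ℕ → ℤ) {a b d len M : ℕ} (x : ℕ → ℤ) {s l : ℕ}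
    (hl : l < a ^ (d - s) * b ^ s) (hlen : a ^ (d - s) * b ^ s ≤ len) :
    yatesTable f a b d len M x (s * len + l) = residue M (yates f a b d x s l) := by
  have h1 : (s * len + l) / len = s := by
    rw [Nat.add_comm, Nat.add_mul_div_right _ _ (by omega), Nat.div_eq_of_lt (by omega), zero_add]
  have h2 : (s * len + l) % len = l := by
    rw [Nat.add_comm, Nat.add_mul_mod_self_right, Nat.mod_eq_of_lt (by omega)]
  rw [yatesTable, h1, h2, if_pos hl]

/-- All levels share one table with stride `len`. A cell of level `s` reads only level `s - 1`, that
is, smaller indices, so the table can be filled in order. The guard makes the unused tail of each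
level zero, and without it the recurrence would read cells with no meaning. -/
theorem HasValue.yatesLevel {I : Mem} {A : State} (f : ℕ → ℕ → ℤ) {a b t d len M i : ℕ}
    {dB : Bound} {lenE ME : TExpr} {pa pb src : TExpr → TExpr} {x : ℕ → ℤ} (ht : t ≠ 0)
    (hd : dB.val (I 0) = d) (hb : 0 < b) (hM : 0 < M)
    (hlen' : ∀ s ≤ d, a ^ (d - s) * b ^ s ≤ len)
    (hi : i < (d + 1) * len)
    (hE : HasValue I A [i] lenE len) (hME : HasValue I A [i] ME M)
    (hpa : ∀ vs e s, s ≤ d → HasValue I A vs e s → HasValue I A vs (pa e) (a ^ s))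
    (hpb : ∀ vs e s, s ≤ d → HasValue I A vs e s → HasValue I A vs (pb e) (b ^ s))
    (hsrc : ∀ e l, l < a ^ d → HasValue I A [i] e l → HasValue I A [i] (src e) (residue M (x l)))
    (hA : ∀ j < i, A t j = yatesTable f a b d len M x j) :
    HasValue I A [i] (TExpr.yatesLevel f a b t dB lenE ME pa pb src)
      (yatesTable f a b d len M x i) := by
  have h0 : HasValue I A [i] (.var 0) i := var (vs := [i]) (x := 0) (by simp)
  have hs := h0.div hE
  have hl := h0.mod hE
  have hsd : i / len ≤ d := Nat.lt_succ_iff.1 (Nat.div_lt_of_lt_mul (by rwa [mul_comm]))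
  obtain ⟨s, hsdef⟩ : ∃ s, s = i / len := ⟨_, rfl⟩
  obtain ⟨l, hldef⟩ : ∃ l, l = i % len := ⟨_, rfl⟩
  rw [← hsdef] at hs hsd
  rw [← hldef] at hl
  have hD : HasValue I A [i] (.ofBound dB) d := (ofBound dB).congr hd
  have hg := hl.lt ((hpa _ _ _ (by omega) (hD.sub hs)).mul (hpb _ _ _ hsd hs))
  rw [yatesTable, ← hsdef, ← hldef]
  unfold TExpr.yatesLevel
  split_ifs at hg ⊢ with h
  · refine (hg.mul ((hs.eq (const 0)).ite (v := residue M (x l))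
      (w := residue M (yates f a b d x s l)) (fun h0 => ?_) fun h0 => ?_)).congr ?_
    · refine hsrc _ _ ?_ hl
      rw [h0] at h; simpa using h
    · refine (mod (sum (g := fun j => ((f (l % b) j).toNat + (M - 1) * (-f (l % b) j).toNat) *
        residue M (yates f a b d x (s - 1) (j * (a ^ (d - s) * b ^ (s - 1)) + l / b)))
        rfl rfl fun j hj => ?_) hME).congr ?_
      · have hs' := hs.weaken [j]
        have hl' := hl.weaken [j]
        have hE' := hE.weaken [j]
        have hD' := hD.weaken [j]
        have hj' : HasValue I A ([i] ++ [j]) (.var 1) j :=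
          var (vs := [i] ++ [j]) (x := 1) (by simp)
        refine (coeff f (hME.weaken [j]) (hl'.mod (const b)) hj' (Nat.mod_lt _ hb) hj).mul
          (arr ht (((hs'.sub (const 1)).mul hE').add
          ((hj'.mul ((hpa _ _ _ (by omega) (hD'.sub hs')).mul
            (hpb _ _ _ (by omega) (hs'.sub (const 1))))).add (hl'.div (const b)))) ?_)
        have h1 : l / b < a ^ (d - s) * b ^ (s - 1) := by
          refine Nat.div_lt_of_lt_mul ?_
          rwa [mul_left_comm, ← pow_succ', Nat.sub_add_cancel (by omega)]
        have h2 : j * (a ^ (d - s) * b ^ (s - 1)) + l / b < a ^ (d - (s - 1)) * b ^ (s - 1) := by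
          rw [show d - (s - 1) = d - s + 1 by omega, pow_succ', mul_assoc]
          have := Nat.mul_le_mul_right (a ^ (d - s) * b ^ (s - 1)) (Nat.succ_le_of_lt hj)
          rw [Nat.succ_mul] at this
          simp only [Bound.val] at *
          omega
        have h3 := hlen' (s - 1) (by omega)
        rw [hA, yatesTable_level f x h2 h3]
        have h4 : i = (s - 1) * len + len + l := by
          rw [← Nat.succ_mul, Nat.succ_eq_add_one, Nat.sub_add_cancel (by omega), hsdef, hldef,
            Nat.div_add_mod']
        omega
      · refine mod_eq_residue hM ?_
        obtain ⟨s', hs'⟩ := Nat.exists_eq_succ_of_ne_zero h0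
        rw [hs', yates]
        push_cast
        simp only [Bound.val, Nat.succ_eq_add_one]
        refine Int.ModEq.sum fun j _ => Int.ModEq.mul ?_ (residue_modEq hM _)
        have := toNat_add_modEq hM (f (l % b) j)
        push_cast at this
        exact this
    · split_ifs with h0
      · rw [h0]; simp [yates]
      · simp
  · exact hg.zero_mul _

/-! ### Binary representations of sets -/

theorem testBit_sub_two_pow {T j : ℕ} (h : T.testBit j = true) (i : ℕ) :
    (T - 2 ^ j).testBit i = (T.testBit i && decide (i ≠ j)) := by
  have h1 : ∑ i ∈ T.bitIndices.toFinset.erase j, 2 ^ i = T - 2 ^ j := by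
    have h2 := Finset.add_sum_erase T.bitIndices.toFinset (fun i => 2 ^ i)
      (List.mem_toFinset.2 (Nat.mem_bitIndices.2 h))
    rw [Finset.sum_toFinset_bitIndices_two_pow] at h2
    omega
  have h3 := Finset.toFinset_bitIndices_sum_two_pow (T.bitIndices.toFinset.erase j)
  rw [h1] at h3
  have h4 : i ∈ (T - 2 ^ j).bitIndices.toFinset ↔ i ∈ T.bitIndices.toFinset.erase j := by rw [h3]
  rw [List.mem_toFinset, Finset.mem_erase, List.mem_toFinset, Nat.mem_bitIndices,
    Nat.mem_bitIndices] at h4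
  rw [Bool.eq_iff_iff, h4]
  simp [and_comm]

theorem lt_of_testBit {T m j : ℕ} (hT : T < 2 ^ m) (h : T.testBit j = true) : j < m := by
  by_contra hj
  rw [Nat.testBit_lt_two_pow (hT.trans_le (Nat.pow_le_pow_right (by norm_num) (by omega)))] at h
  exact absurd h (by simp)

theorem div_two_pow_mod_two (x u : ℕ) : x / 2 ^ u % 2 = if x.testBit u = true then 1 else 0 := by
  rw [Nat.testBit_eq_decide_div_mod_eq]
  have := Nat.mod_lt (x / 2 ^ u) two_pos
  simp only [decide_eq_true_eq]
  split_ifs <;> omega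

theorem foldVal_search_eq {g : ℕ → ℕ} {N o : ℕ} (ho : o < N) (h0 : ∀ j < o, g j = 0)
    (h : g o ≠ 0) : foldVal true g N = o := by
  obtain ⟨h1, h2, h3⟩ := foldVal_search g N
  rcases lt_trichotomy (foldVal true g N) o with hlt | heq | hgt
  · exact absurd (h0 _ hlt) (h3 (hlt.trans ho))
  · exact heq
  · exact absurd (h2 o hgt) h

open Classical in
theorem cutSize_eq_sum {V : Type*} [Fintype V] (H : Digraph V) (T : Finset V) :
    cutSize H T = ∑ u, ∑ v, if H.Adj u v ∧ u ∉ T ∧ v ∈ T then 1 else 0 := by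
  rw [cutSize, Set.ncard_eq_toFinset_card', ← Fintype.sum_prod_type',
    ← Finset.card_filter]
  congr 1
  ext a
  simp

/-! ### The tables for the two sides of the cut -/

namespace HasValue

open TExpr

variable {I : Mem} {A : State} {vs : List ℕ} {e f : TExpr}

theorem guard {p : Prop} [Decidable p] {v : ℕ} (he : HasValue I A vs e (if p then 1 else 0))
    (hf : p → HasValue I A vs f v) : HasValue I A vs (.mul e f) (if p then v else 0) := by
  by_cases hp : p
  · rw [if_pos hp] at he ⊢
    exact (he.mul (hf hp)).congr (by omega)
  · rw [if_neg hp] at he ⊢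
    exact he.zero_mul f

end HasValue

namespace TExpr

/-- Bit `u` of `x`; array `1` holds the powers of two. -/
def bit (x u : TExpr) : TExpr := .mod (.div x (.arr 1 u)) (.const 2)

/-- The number of vertices before `v` that satisfy `side`. The bound variable is `b`. -/
def rank (side : TExpr → TExpr) (b : ℕ) (v : TExpr) : TExpr :=
  .sum b .n (.mul (.lt (.var b) v) (side (.var b)))

/-- The vertex whose rank is given by variable `0`. -/
def elem (side : TExpr → TExpr) : TExpr :=
  .find 1 .n (.mul (side (.var 1)) (.eq (rank side 2 (.var 1)) (.var 0)))

/-- The number of arcs that enter the set with the binary representation `T`. -/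
def enter (t : ℕ) (m : Bound) (b : ℕ) (T : TExpr) : TExpr :=
  .sum b m (.sum (b + 1) m (.mul (adj (.arr t (.var b)) (.arr t (.var (b + 1))))
    (.mul (.sub (.const 1) (bit T (.var b))) (bit T (.var (b + 1))))))

/-- The optimal width of the set with the binary representation given by variable `0`. -/
def opt (t : ℕ) (m : Bound) : TExpr :=
  .find 1 (.add (.mul .n .n) (.const 1)) (.mul (.le (enter t m 2 (.var 0)) (.var 1))
    (.add (.eq (.var 0) (.const 0)) (.sum 2 m (.mul (bit (.var 0) (.var 2))
      (.le (.arr (t + 1) (.sub (.var 0) (.arr 1 (.var 2)))) (.var 1))))))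

/-- The sets that are obtained by removing vertices one at a time. -/
def chain (t : ℕ) (m : Bound) : TExpr :=
  let P := .arr (t + 2) (.sub (.var 0) (.const 1))
  .ite (.eq (.var 0) (.const 0)) (.sub (.arr 1 (.ofBound m)) (.const 1))
    (.sub P (.arr 1 (.find 1 m (.mul (bit P (.var 1))
      (.le (.arr (t + 1) (.sub P (.arr 1 (.var 1)))) (.arr (t + 1) P))))))

/-- The position of the vertex whose rank is given by variable `0`. -/
def pos (t : ℕ) (m : Bound) : TExpr :=
  .sub (.ofBound m) (.sum 1 (.add m (.const 1)) (bit (.arr (t + 2) (.var 1)) (.var 0)))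

end TExpr

open Classical in
/-- The indicator function of a set of vertices. -/
noncomputable def ind {n : ℕ} (S : Finset (Fin n)) (v : ℕ) : ℕ :=
  if ∃ h : v < n, (⟨v, h⟩ : Fin n) ∈ S then 1 else 0

/-- The number of elements of `S` before `v`. -/
noncomputable def rankOf {n : ℕ} (S : Finset (Fin n)) (v : ℕ) : ℕ :=
  (S.filter fun u : Fin n => (u : ℕ) < v).card

section Side

variable {n : ℕ} (G : Digraph (Fin n)) (S : Finset (Fin n))

theorem rankOf_eq_sum (v : ℕ) :
    rankOf S v = ∑ u ∈ Finset.range n, if u < v then ind S u else 0 := by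
  classical
  rw [rankOf, Finset.card_filter, ← Fin.sum_univ_eq_sum_range (fun u => if u < v then ind S u else 0),
    ← Finset.sum_filter_add_sum_filter_not Finset.univ (· ∈ S)]
  rw [Finset.sum_eq_zero (s := Finset.univ.filter (· ∉ S)) fun u hu => ?_, add_zero,
    Finset.filter_mem_eq_inter, Finset.univ_inter]
  · refine Finset.sum_congr rfl fun u hu => ?_
    have : ind S u = 1 := if_pos ⟨u.2, hu⟩
    rw [this]
  · have : ind S u = 0 := if_neg fun ⟨_, h⟩ => (Finset.mem_filter.1 hu).2 h
    rw [this, ite_self]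

theorem rankOf_lt_rankOf {u v : Fin n} (hu : u ∈ S) (h : u < v) : rankOf S u < rankOf S v := by
  refine Finset.card_lt_card ⟨fun w hw => ?_, fun hs => ?_⟩
  · simp only [Finset.mem_filter] at hw ⊢
    exact ⟨hw.1, hw.2.trans h⟩
  · exact absurd (Finset.mem_filter.1 (hs (Finset.mem_filter.2 ⟨hu, h⟩))).2 (lt_irrefl _)

theorem rankOf_lt_card {v : Fin n} (hv : v ∈ S) : rankOf S v < S.card :=
  Finset.card_lt_card ⟨Finset.filter_subset _ _, fun hs =>
    absurd (Finset.mem_filter.1 (hs hv)).2 (lt_irrefl _)⟩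

theorem rankOf_inj {u v : Fin n} (hu : u ∈ S) (hv : v ∈ S) (h : rankOf S u = rankOf S v) :
    u = v := by
  rcases lt_trichotomy u v with h' | h' | h'
  · exact absurd h (rankOf_lt_rankOf S hu h').ne
  · exact h'
  · exact absurd h (rankOf_lt_rankOf S hv h').ne'

/-- The numbering of `S` by ranks. -/
noncomputable def rankEquiv : S ≃ Fin S.card :=
  Equiv.ofBijective (fun v => ⟨rankOf S (v : Fin n), rankOf_lt_card S v.2⟩)
    ((Fintype.bijective_iff_injective_and_card _).2
      ⟨fun u v h => Subtype.ext (rankOf_inj S u.2 v.2 (Fin.mk.inj h)), by simp⟩)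

theorem rankEquiv_apply (v : S) : (rankEquiv S v : ℕ) = rankOf S (v : Fin n) := rfl

theorem rankOf_symm (j : Fin S.card) : rankOf S ((rankEquiv S).symm j : Fin n) = j := by
  rw [← rankEquiv_apply, Equiv.apply_symm_apply]

theorem sum_range_card {M : Type*} [AddCommMonoid M] (f : ℕ → M) :
    ∑ j ∈ Finset.range S.card, f j = ∑ v : S, f (rankOf S (v : Fin n)) := by
  rw [← Fin.sum_univ_eq_sum_range, ← (rankEquiv S).sum_comp]
  rfl

/-- The element of `S` with rank `j`. -/
noncomputable def elemOf (j : ℕ) : ℕ :=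
  foldVal true (fun v => ind S v * if rankOf S v = j then 1 else 0) n

theorem elemOf_rankOf {v : Fin n} (hv : v ∈ S) : elemOf S (rankOf S v) = v := by
  refine foldVal_search_eq v.2 (fun u hu => ?_) ?_
  · by_cases h : ∃ h : u < n, (⟨u, h⟩ : Fin n) ∈ S
    · obtain ⟨h1, h2⟩ := h
      have := rankOf_lt_rankOf S h2 (v := v) hu
      rw [if_neg this.ne, mul_zero]
    · rw [ind, if_neg h, zero_mul]
  · rw [ind, if_pos ⟨v.2, hv⟩]; simp

theorem elemOf_le (j : ℕ) : elemOf S j ≤ n := (foldVal_search _ _).1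

/-- The subset of `S` with the binary representation `T`. -/
noncomputable def decode (T : ℕ) : Finset S :=
  Finset.univ.filter fun v => T.testBit (rankOf S (v : Fin n)) = true

theorem mem_decode {T : ℕ} {v : S} :
    v ∈ decode S T ↔ T.testBit (rankOf S (v : Fin n)) = true := by simp [decode]

theorem decode_full : decode S (2 ^ S.card - 1) = Finset.univ := by
  ext v
  simp [mem_decode, Nat.testBit_two_pow_sub_one, rankOf_lt_card S v.2]

theorem decode_sub {T : ℕ} {v : S} (h : v ∈ decode S T) :
    decode S (T - 2 ^ rankOf S (v : Fin n)) = (decode S T).erase v := by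
  ext w
  rw [Finset.mem_erase, mem_decode, mem_decode, testBit_sub_two_pow ((mem_decode S).1 h)]
  simp only [Bool.and_eq_true, decide_eq_true_eq]
  rw [and_comm]
  refine and_congr_left fun _ => not_congr ⟨fun h => Subtype.ext (rankOf_inj S w.2 v.2 h), ?_⟩
  rintro rfl; rfl

theorem decode_eq_empty {T : ℕ} (hT : T < 2 ^ S.card) : decode S T = ∅ ↔ T = 0 := by
  constructor
  · intro h
    refine Nat.eq_of_testBit_eq fun j => ?_
    rw [Nat.zero_testBit]
    by_contra hj
    rw [Bool.not_eq_false] at hj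
    have hm := lt_of_testBit hT hj
    have : (rankEquiv S).symm ⟨j, hm⟩ ∈ decode S T := by
      rw [mem_decode, rankOf_symm]; exact hj
    rw [h] at this
    exact absurd this (Finset.notMem_empty _)
  · rintro rfl; simp [decode]

/-- The optimal width of the set with the binary representation `T`. -/
noncomputable def optOf (T : ℕ) : ℕ := optWidth (induced G S) (decode S T)

theorem optOf_le_sq (T : ℕ) : optOf G S T ≤ n * n := by
  refine (optWidth_le_sq _ _).trans ?_
  have : Fintype.card S ≤ n := by
    rw [Fintype.card_coe]; simpa using Finset.card_le_univ S
  exact Nat.mul_le_mul this this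

/-- The rank of the vertex that is removed from the set with the binary representation `T`. -/
noncomputable def removed (T : ℕ) : ℕ :=
  foldVal true (fun j => if T.testBit j = true then
    (if optOf G S (T - 2 ^ j) ≤ optOf G S T then 1 else 0) else 0) S.card

/-- The chain of sets that are obtained by removing vertices one at a time. -/
noncomputable def chainOf : ℕ → ℕ
  | 0 => 2 ^ S.card - 1
  | t + 1 => chainOf t - 2 ^ removed G S (chainOf t)

/-- The position of the vertex of rank `j` in the ordering of `S`. -/
noncomputable def posOf (j : ℕ) : ℕ :=
  S.card - ∑ t ∈ Finset.range (S.card + 1), if (chainOf G S t).testBit j = true then 1 else 0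

theorem chainOf_lt (t : ℕ) : chainOf G S t < 2 ^ S.card := by
  induction t with
  | zero => exact Nat.sub_lt (by positivity) one_pos
  | succ t ih => exact (Nat.sub_le _ _).trans_lt ih

/-- The search cannot fail: in a best way of building up the set, some vertex is added last, and
without it the optimal width is no larger (`exists_optWidth_erase_le`). -/
theorem removed_spec {T : ℕ} (h : (decode S T).Nonempty) : ∃ v ∈ decode S T,
    removed G S T = rankOf S (v : Fin n) ∧ optOf G S (T - 2 ^ removed G S T) ≤ optOf G S T := by
  obtain ⟨v, hv, hle⟩ := exists_optWidth_erase_le (H := induced G S) h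
  rw [← decode_sub S hv] at hle
  have hlt : removed G S T < S.card := by
    obtain ⟨h1, h2, -⟩ := foldVal_search (fun j => if T.testBit j = true then
      (if optOf G S (T - 2 ^ j) ≤ optOf G S T then 1 else 0) else 0) S.card
    refine lt_of_le_of_ne h1 fun he => ?_
    rw [show foldVal true _ _ = S.card from he] at h2
    have := h2 _ (rankOf_lt_card S v.2)
    rw [if_pos ((mem_decode S).1 hv), if_pos (show optOf G S _ ≤ optOf G S T from hle)] at this
    exact one_ne_zero this
  have hne := (foldVal_search (fun j => if T.testBit j = true then
      (if optOf G S (T - 2 ^ j) ≤ optOf G S T then 1 else 0) else 0) S.card).2.2 hlt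
  change (if T.testBit (removed G S T) = true then
    (if optOf G S (T - 2 ^ removed G S T) ≤ optOf G S T then 1 else 0) else 0) ≠ 0 at hne
  split_ifs at hne with h1 h2
  · refine ⟨(rankEquiv S).symm ⟨_, hlt⟩, ?_, ?_, h2⟩
    · rw [mem_decode, rankOf_symm]; exact h1
    · rw [rankOf_symm]
  · exact absurd rfl hne
  · exact absurd rfl hne

/-- The positions define an optimal ordering. -/
theorem exists_ordering_posOf : ∃ π : Ordering S,
    (∀ v : S, (π v : ℕ) = posOf G S (rankOf S (v : Fin n))) ∧
      width (induced G S) π = dirCutwidth (induced G S) := by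
  have hstep : ∀ t, (decode S (chainOf G S t)).Nonempty → ∃ v ∈ decode S (chainOf G S t),
      decode S (chainOf G S (t + 1)) = (decode S (chainOf G S t)).erase v ∧
      optWidth (induced G S) (decode S (chainOf G S (t + 1))) ≤
        optWidth (induced G S) (decode S (chainOf G S t)) := by
    intro t ht
    obtain ⟨v, hv, h1, h2⟩ := removed_spec G S ht
    refine ⟨v, hv, ?_, h2⟩
    rw [chainOf, h1, decode_sub S hv]
  have hcard : ∀ t ≤ S.card, (decode S (chainOf G S t)).card = S.card - t := by
    intro t
    induction t with
    | zero => intro _; rw [chainOf, decode_full]; simp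
    | succ t ih =>
      intro ht
      have h := ih (by omega)
      obtain ⟨v, hv, he, -⟩ := hstep t (Finset.card_pos.1 (by omega))
      rw [he, Finset.card_erase_of_mem hv, h]
      omega
  obtain ⟨π, hπ, hw⟩ := exists_ordering_of_chain (induced G S)
    (T := fun t => decode S (chainOf G S t)) (by simp only [chainOf]; exact decode_full S)
    fun t ht => hstep t (Finset.card_pos.1 (by
      rw [Fintype.card_coe] at ht
      rw [hcard t (by omega)]; omega))
  refine ⟨π, fun v => ?_, hw⟩
  rw [hπ, posOf, Finset.card_filter, Fintype.card_coe]
  simp only [mem_decode]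

/-! ### Table expressions for the dynamic programming on one side -/

section Tables

variable {G S} {A : State} {side : TExpr → TExpr} {m : Bound} {t : ℕ} {vs : List ℕ}

theorem HasValue.bit {I : Mem} {xe ue : TExpr} {x u : ℕ} (h1 : A 1 u = 2 ^ u)
    (hx : HasValue I A vs xe x) (hu : HasValue I A vs ue u) :
    HasValue I A vs (.bit xe ue) (if x.testBit u = true then 1 else 0) :=
  ((hx.div (.arr one_ne_zero hu h1)).mod (.const 2)).congr (div_two_pow_mod_two x u)

theorem HasValue.last {I : Mem} {b u : ℕ} (hb : b = vs.length) :
    HasValue I A (vs ++ [u]) (.var b) u := by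
  subst hb
  exact (HasValue.var (vs := vs ++ [u]) (x := vs.length) (by simp)).congr (by simp)

theorem HasValue.index {I : Mem} {u : ℕ} : HasValue I A [u] (.var 0) u :=
  HasValue.last (vs := []) rfl

theorem graphInput_zero : graphInput G 0 = n := by simp [graphInput]

theorem val_n : Bound.n.val (graphInput G 0) = n := graphInput_zero

section
variable (hside : ∀ vs e v, v < n → HasValue (graphInput G) A vs e v →
  HasValue (graphInput G) A vs (side e) (ind S v))

include hside

theorem HasValue.rank {ve : TExpr} {v b : ℕ} (hb : b = vs.length)
    (hv : HasValue (graphInput G) A vs ve v) :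
    HasValue (graphInput G) A vs (.rank side b ve) (rankOf S v) :=
  (HasValue.sum val_n hb fun u hu => ((HasValue.last hb).lt (hv.weaken [u])).guard fun _ =>
    hside _ _ _ hu (.last hb)).congr (rankOf_eq_sum S v).symm

theorem HasValue.elem {j : ℕ} : HasValue (graphInput G) A [j] (.elem side) (elemOf S j) :=
  HasValue.find val_n rfl fun v hv => (hside _ _ _ hv (.last rfl)).mul
    ((HasValue.rank hside rfl (.last rfl)).eq (.weaken .index [v]))

end

variable (hm : m.val (graphInput G 0) = S.card) (hpow : ∀ u < S.card, A 1 u = 2 ^ u)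
  (helem : ∀ j < S.card, A t j = elemOf S j)

include hm hpow helem

theorem HasValue.enter (ht : t ≠ 0) {Te : TExpr} {T b : ℕ} (hb : b = vs.length)
    (hT : HasValue (graphInput G) A vs Te T) :
    HasValue (graphInput G) A vs (.enter t m b Te)
      (cutSize (induced G S) (decode S T)) := by
  classical
  have hle : S.card ≤ n := by simpa using Finset.card_le_univ S
  have key : ∀ i, (hi : i < S.card) → elemOf S i < n := fun i hi => by
    have := elemOf_rankOf S ((rankEquiv S).symm ⟨i, hi⟩).2
    rw [rankOf_symm] at this
    rw [this]; exact Fin.is_lt _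
  refine (HasValue.sum (g := fun i => ∑ j ∈ Finset.range S.card,
      (if ∃ (hi : elemOf S i < n) (hj : elemOf S j < n), G.Adj ⟨_, hi⟩ ⟨_, hj⟩ then 1 else 0) *
      ((1 - if T.testBit i = true then 1 else 0) * if T.testBit j = true then 1 else 0))
    hm hb fun i hi => HasValue.sum hm (by simp [hb]) fun j hj => ?_).congr ?_
  · have hi' : HasValue (graphInput G) A (vs ++ [i] ++ [j]) (.var b) i := (HasValue.last hb).weaken [j]
    have hj' : HasValue (graphInput G) A (vs ++ [i] ++ [j]) (.var (b + 1)) j := .last (by simp [hb])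
    have hT' := (hT.weaken [i]).weaken [j]
    refine .mul ((HasValue.adj (.arr ht hi' (helem i hi)) (.arr ht hj' (helem j hj)) (key i hi)
      (key j hj)).congr (if_congr ?_ rfl rfl))
      (((HasValue.const 1).sub (hT'.bit (hpow i hi) hi')).mul (hT'.bit (hpow j hj) hj'))
    exact ⟨fun h => ⟨_, _, h⟩, fun ⟨_, _, h⟩ => h⟩
  · rw [sum_range_card, cutSize_eq_sum]
    refine Finset.sum_congr rfl fun u _ => ?_
    rw [sum_range_card]
    refine Finset.sum_congr rfl fun v _ => ?_
    simp only [elemOf_rankOf S u.2, elemOf_rankOf S v.2, mem_decode]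
    have : (∃ (hi : ((u : Fin n) : ℕ) < n) (hj : ((v : Fin n) : ℕ) < n),
        G.Adj ⟨_, hi⟩ ⟨_, hj⟩) ↔ (induced G S).Adj u v :=
      ⟨fun ⟨_, _, h⟩ => h, fun h => ⟨u.1.2, v.1.2, h⟩⟩
    simp only [this]
    split_ifs <;> simp_all

/-- The expression searches for the least `c` that satisfies the recursion `reaches_iff`. Candidates
up to `n * n` suffice by `optOf_le_sq`, and removing a bit from `T` gives a smaller number, whose
entry is already present. -/
theorem HasValue.opt (ht : t ≠ 0) {T : ℕ} (hT : T < 2 ^ S.card)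
    (hopt : ∀ T' < T, A (t + 1) T' = optOf G S T') :
    HasValue (graphInput G) A [T] (.opt t m) (optOf G S T) := by
  classical
  refine (HasValue.find (n := n * n + 1) (g := fun c =>
    (if cutSize (induced G S) (decode S T) ≤ c then 1 else 0) * ((if T = 0 then 1 else 0) +
      ∑ j ∈ Finset.range S.card, if T.testBit j = true then
        (if optOf G S (T - 2 ^ j) ≤ c then 1 else 0) else 0)) ?_ rfl fun c hc => ?_).congr ?_
  · simp [Bound.val, graphInput_zero]
  · have h0 : HasValue (graphInput G) A ([T] ++ [c]) (.var 0) T := HasValue.index.weaken [c]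
    have h1 : HasValue (graphInput G) A ([T] ++ [c]) (.var 1) c := .last rfl
    refine ((HasValue.enter hm hpow helem ht rfl h0).le h1).mul ((h0.eq (.const 0)).add
      (HasValue.sum hm rfl fun j hj => ?_))
    have h2 : HasValue (graphInput G) A ([T] ++ [c] ++ [j]) (.var 2) j := .last rfl
    have hp := hpow j hj
    refine ((h0.weaken [j]).bit hp h2).guard fun hbit => .le (.arr (Nat.succ_ne_zero t)
      ((h0.weaken [j]).sub (.arr one_ne_zero h2 hp)) (hopt _ ?_)) (h1.weaken [j])
    have := Nat.ge_two_pow_of_testBit hbit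
    have := Nat.two_pow_pos j
    omega
  · have hg : ∀ c, (if cutSize (induced G S) (decode S T) ≤ c then 1 else 0) *
        ((if T = 0 then 1 else 0) + ∑ j ∈ Finset.range S.card, if T.testBit j = true then
        (if optOf G S (T - 2 ^ j) ≤ c then 1 else 0) else 0) ≠ 0 ↔ optOf G S T ≤ c := by
      intro c
      have h2 : (∑ j ∈ Finset.range S.card, if T.testBit j = true then
          (if optOf G S (T - 2 ^ j) ≤ c then 1 else 0) else 0) ≠ 0 ↔
          ∃ v ∈ decode S T, Reaches (induced G S) c ((decode S T).erase v) := by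
        rw [sum_range_card, ← Nat.pos_iff_ne_zero, Finset.sum_pos_iff]
        simp only [Nat.pos_iff_ne_zero]
        refine ⟨fun ⟨v, _, h⟩ => ?_, fun ⟨v, hv, h⟩ => ⟨v, Finset.mem_univ v, ?_⟩⟩
        · split_ifs at h with h1 h2
          · have hv := (mem_decode S).2 h1
            refine ⟨v, hv, ?_⟩
            rw [← decode_sub S hv]
            exact optWidth_le_iff.1 h2
          · exact absurd rfl h
          · exact absurd rfl h
        · rw [if_pos ((mem_decode S).1 hv), if_pos]
          · exact one_ne_zero
          · rw [optOf, decode_sub S hv]; exact optWidth_le_iff.2 h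
      rw [optOf, optWidth_le_iff, reaches_iff, ← h2, decode_eq_empty S hT]
      by_cases hT0 : T = 0
      · have h3 : cutSize (induced G S) (decode S T) = 0 := by
          rw [(decode_eq_empty S hT).2 hT0, cutSize_eq_sum]
          simp
        rw [h3]
        simp [hT0]
      · simp only [hT0, if_false, zero_add, false_or, mul_ne_zero_iff]
        refine and_congr ?_ Iff.rfl
        split_ifs <;> simp_all
    refine foldVal_search_eq (Nat.lt_succ_of_le (optOf_le_sq G S T)) (fun c hc => ?_) ?_
    · by_contra h
      exact absurd ((hg c).1 h) (by omega)
    · exact (hg _).2 le_rfl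

variable (hpow' : A 1 S.card = 2 ^ S.card)
  (hopt : ∀ T < 2 ^ S.card, A (t + 1) T = optOf G S T)

include hpow' hopt

omit helem in
theorem HasValue.chain {s : ℕ} (hchain : ∀ s' < s, A (t + 2) s' = chainOf G S s') :
    HasValue (graphInput G) A [s] (.chain t m) (chainOf G S s) := by
  refine ((HasValue.index.eq (.const 0)).ite
    (v := 2 ^ S.card - 1) (w := chainOf G S s) (fun h => ?_) fun h => ?_).congr ?_
  · exact .sub (.arr one_ne_zero ((HasValue.ofBound m).congr hm) hpow') (.const 1)
  · obtain ⟨s, rfl⟩ := Nat.exists_eq_succ_of_ne_zero h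
    have hP : HasValue (graphInput G) A [s + 1]
        (.arr (t + 2) (.sub (.var 0) (.const 1))) (chainOf G S s) :=
      .arr (Nat.succ_ne_zero _) (HasValue.index.sub (.const 1)) (hchain _ (by omega))
    have hlt := chainOf_lt G S s
    have hr : removed G S (chainOf G S s) ≤ S.card := (foldVal_search _ _).1
    refine hP.sub (.arr one_ne_zero (HasValue.find (g := fun j => if (chainOf G S s).testBit j = true then
      (if optOf G S (chainOf G S s - 2 ^ j) ≤ optOf G S (chainOf G S s) then 1 else 0) else 0)
      hm rfl fun j hj => ?_) ?_)
    · have h1 : HasValue (graphInput G) A ([s + 1] ++ [j]) (.var 1) j := .last rfl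
      have hP' := hP.weaken [j]
      refine (hP'.bit (hpow j hj) h1).guard fun _ => .le (.arr (Nat.succ_ne_zero t)
        (hP'.sub (.arr one_ne_zero h1 (hpow j hj))) (hopt _ ((Nat.sub_le _ _).trans_lt hlt)))
        (.arr (Nat.succ_ne_zero t) hP' (hopt _ hlt))
    -- A failed search, as for the empty set, returns `S.card`; therefore the power of two with this
    -- exponent is also needed in the table.
    · rcases hr.lt_or_eq with h | h
      · exact hpow _ h
      · change A 1 (removed G S (chainOf G S s)) = 2 ^ removed G S (chainOf G S s)
        rw [h, hpow']
  · split_ifs with h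
    · rw [h, chainOf]
    · rfl

omit hopt helem hpow' in
theorem HasValue.pos {j : ℕ} (hj : j < S.card)
    (hchain : ∀ s < S.card + 1, A (t + 2) s = chainOf G S s) :
    HasValue (graphInput G) A [j] (.pos t m) (posOf G S j) := by
  refine .sub ((HasValue.ofBound m).congr hm) (HasValue.sum (by simp [Bound.val, hm]) rfl
    fun s hs => ?_)
  exact .bit (hpow j hj) (.arr (Nat.succ_ne_zero _) (.last rfl) (hchain s hs))
    (HasValue.index.weaken [s])

end Tables

end Side

/-! ### Digits of generating functions -/

/-- The digit at place `s` is `K` times the number of `y` with `t y = s`. There are no carries,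
since that is at most `K * N < X`; the factor `K > 0` does not affect whether the digit vanishes. -/
theorem digit_ne_zero_iff {K N X : ℕ} (hK : 0 < K) (hX : K * N < X) (t : ℕ → ℕ) (s : ℕ) :
    (K * ∑ y ∈ Finset.range N, X ^ t y) / X ^ s % X ≠ 0 ↔ ∃ y < N, t y = s := by
  have hX0 : 0 < X := by omega
  set c := ((Finset.range N).filter fun y => t y = s).card with hc
  have hcN : c ≤ N := by simpa using Finset.card_filter_le (Finset.range N) fun y => t y = s
  obtain ⟨low, r, hlow, hsum⟩ : ∃ low r, low < X ^ s ∧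
      K * ∑ y ∈ Finset.range N, X ^ t y = low + (K * c + X * r) * X ^ s := by
    refine ⟨K * ∑ y ∈ (Finset.range N).filter (fun y => t y < s), X ^ t y,
      K * ∑ y ∈ (Finset.range N).filter (fun y => s < t y), X ^ (t y - s - 1), ?_, ?_⟩
    · have h1 : ∑ y ∈ (Finset.range N).filter (fun y => t y < s), X ^ t y * X ≤ N * X ^ s := by
        refine (Finset.sum_le_card_nsmul _ _ (X ^ s) fun y hy => ?_).trans ?_
        · rw [← pow_succ]
          exact Nat.pow_le_pow_right hX0 (Finset.mem_filter.1 hy).2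
        · rw [smul_eq_mul]
          refine Nat.mul_le_mul_right _ ?_
          simpa using Finset.card_filter_le (Finset.range N) fun y => t y < s
      rw [← Finset.sum_mul] at h1
      have h2 : 0 < X ^ s := by positivity
      have h3 : K * (N * X ^ s) < X * X ^ s := by
        rw [← mul_assoc]; exact Nat.mul_lt_mul_of_pos_right hX h2
      refine Nat.lt_of_mul_lt_mul_left (a := X) ?_
      calc _ = K * ((∑ y ∈ (Finset.range N).filter (fun y => t y < s), X ^ t y) * X) := by ring
        _ ≤ K * (N * X ^ s) := Nat.mul_le_mul_left _ h1
        _ < _ := h3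
    · have h1 : ∀ y, X ^ t y = (if t y < s then X ^ t y else 0) +
          ((if t y = s then X ^ s else 0) + if s < t y then X ^ (t y - s - 1) * X * X ^ s else 0) := by
        intro y
        rcases lt_trichotomy (t y) s with h | h | h
        · rw [if_pos h, if_neg h.ne, if_neg h.not_gt]; rfl
        · rw [if_neg (by omega), if_pos h, if_neg (by omega), h]; simp
        · rw [if_neg (by omega), if_neg (by omega), if_pos h, ← pow_succ, ← pow_add]
          simp only [zero_add]
          congr 1; omega
      rw [Finset.sum_congr rfl fun y _ => h1 y, Finset.sum_add_distrib, Finset.sum_add_distrib,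
        ← Finset.sum_filter, ← Finset.sum_filter, ← Finset.sum_filter, Finset.sum_const,
        ← Finset.sum_mul, ← Finset.sum_mul, ← hc, smul_eq_mul]
      ring
  have hpos : 0 < X ^ s := by positivity
  rw [hsum, Nat.add_mul_div_right _ _ hpos, Nat.div_eq_of_lt hlow, zero_add,
    Nat.add_mul_mod_self_left, Nat.mod_eq_of_lt
      (lt_of_le_of_lt (Nat.mul_le_mul_left K hcN) hX), mul_ne_zero_iff, hc, Finset.card_ne_zero]
  constructor
  · rintro ⟨-, y, hy⟩
    rw [Finset.mem_filter, Finset.mem_range] at hy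
    exact ⟨y, hy⟩
  · rintro ⟨y, hy⟩
    exact ⟨hK.ne', y, Finset.mem_filter.2 ⟨Finset.mem_range.2 hy.1, hy.2⟩⟩

/-! ### Cuts that are given by three blocks of vertices -/

/-- Membership in the set of vertices that is given by the sets `x`, `y`, `z` of vertices in three
blocks of `h` vertices each. -/
def member (h x y z u : ℕ) : Bool :=
  x.testBit u || (decide (h ≤ u) && y.testBit (u - h)) ||
    (decide (2 * h ≤ u) && z.testBit (u - 2 * h))

/-- The pairs of vertices within the first two blocks, those within the last two blocks that
remain, and all others. -/
def blockPair (h : ℕ) (k : Fin 3) (u v : ℕ) : Bool :=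
  match k with
  | 0 => decide (u < 2 * h) && decide (v < 2 * h)
  | 1 => !(decide (u < 2 * h) && decide (v < 2 * h)) && (decide (h ≤ u) && decide (h ≤ v))
  | 2 => !(decide (u < 2 * h) && decide (v < 2 * h)) && !(decide (h ≤ u) && decide (h ≤ v))

section Cut

variable {n : ℕ} (G : Digraph (Fin n)) (h : ℕ)

open Classical in
/-- The number of arcs that enter the set given by `x`, `y`, `z`, among the pairs of vertices
that are selected by `sel`. -/
noncomputable def cutPart (sel : ℕ → ℕ → Bool) (x y z : ℕ) : ℕ :=
  ∑ u ∈ Finset.range n, ∑ v ∈ Finset.range n, (if sel u v = true then 1 else 0) *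
    ((if ∃ (hu : u < n) (hv : v < n), G.Adj ⟨u, hu⟩ ⟨v, hv⟩ then 1 else 0) *
      ((1 - if member h x y z u = true then 1 else 0) *
        if member h x y z v = true then 1 else 0))

/-- The size of the set given by `x`, `y`, `z`, where the numbers from `n` on count `n + 1` times
each. -/
def weight (n x y z : ℕ) : ℕ :=
  ∑ u ∈ Finset.range (3 * h), (if member h x y z u = true then 1 else 0) *
    if u < n then 1 else n + 1

/-- The exponent for a pair of sets in the first two blocks. -/
noncomputable def expA (x y : ℕ) : ℕ :=
  cutPart G h (blockPair h 0) x y 0 + (n * n + 1) * weight h n x y 0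

/-- The exponent for a pair of sets in the last two blocks. -/
noncomputable def expB (y z : ℕ) : ℕ :=
  cutPart G h (blockPair h 1) 0 y z + (n * n + 1) * weight h n 0 0 z

/-- The exponent for a pair of sets in the first and the last block. -/
noncomputable def expC (x z : ℕ) : ℕ := cutPart G h (blockPair h 2) x 0 z

/-- The set of vertices that is given by `x`, `y`, `z`. -/
def blockSet (n x y z : ℕ) : Finset (Fin n) :=
  Finset.univ.filter fun u => member h x y z u = true

variable {h}

theorem testBit_eq_false_of_le {x u : ℕ} (hx : x < 2 ^ h) (hu : h ≤ u) : x.testBit u = false :=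
  Nat.testBit_lt_two_pow (hx.trans_le (Nat.pow_le_pow_right (by norm_num) hu))

theorem weight_le (n x y z : ℕ) : weight h n x y z ≤ 3 * h * (n + 1) := by
  refine (Finset.sum_le_card_nsmul _ _ (n + 1) fun v _ => ?_).trans (by simp)
  split_ifs <;> simp

/-- The three classes of `blockPair` partition the pairs of vertices, and for the pairs of a class
both memberships depend only on the two sets that its exponent sees. The weight of the first two
blocks is booked in `expA` and that of the last in `expB`. A cut has at most `n * n` arcs, so the
factor `n * n + 1` lets size and weight be read off the sum. -/
theorem expA_add_expB_add_expC {x y z : ℕ} (hx : x < 2 ^ h) (hy : y < 2 ^ h) :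
    expA G h x y + expB G h y z + expC G h x z =
      cutSize G (blockSet h n x y z) + (n * n + 1) * weight h n x y z := by
  classical
  have hc : cutPart G h (blockPair h 0) x y 0 + cutPart G h (blockPair h 1) 0 y z +
      cutPart G h (blockPair h 2) x 0 z = cutSize G (blockSet h n x y z) := by
    rw [cutSize_eq_sum]
    simp only [cutPart]
    rw [← Finset.sum_add_distrib, ← Finset.sum_add_distrib, Finset.sum_range]
    refine Finset.sum_congr rfl fun u _ => ?_
    rw [← Finset.sum_add_distrib, ← Finset.sum_add_distrib, Finset.sum_range]
    refine Finset.sum_congr rfl fun v _ => ?_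
    have hadj : (∃ (hu : (u : ℕ) < n) (hv : (v : ℕ) < n), G.Adj ⟨u, hu⟩ ⟨v, hv⟩) ↔ G.Adj u v :=
      ⟨fun ⟨_, _, h⟩ => h, fun h => ⟨u.2, v.2, h⟩⟩
    have hA : ∀ u, u < 2 * h → member h x y 0 u = member h x y z u := fun u hu => by
      simp [member, show ¬ 2 * h ≤ u by omega]
    have hB : ∀ u, h ≤ u → member h 0 y z u = member h x y z u := fun u hu => by
      simp [member, testBit_eq_false_of_le hx hu]
    have hC : ∀ u, (u < h ∨ 2 * h ≤ u) → member h x 0 z u = member h x y z u := fun u hu => by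
      rcases hu with hu | hu
      · simp [member, show ¬ h ≤ u by omega]
      · simp [member, testBit_eq_false_of_le hy (show h ≤ u - h by omega)]
    simp only [hadj, blockSet, Finset.mem_filter, Finset.mem_univ, true_and]
    have hval : (if G.Adj u v ∧ ¬ member h x y z u = true ∧ member h x y z v = true then 1 else 0)
        = (if G.Adj u v then 1 else 0) * ((1 - if member h x y z u = true then 1 else 0) *
          if member h x y z v = true then 1 else 0) := by
      split_ifs <;> simp_all
    rw [hval]
    by_cases h1 : (u : ℕ) < 2 * h ∧ (v : ℕ) < 2 * h
    · simp [blockPair, h1.1, h1.2, hA _ h1.1, hA _ h1.2]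
    · by_cases h2 : h ≤ (u : ℕ) ∧ h ≤ (v : ℕ)
      · have h3 : ¬ ((u : ℕ) < 2 * h ∧ (v : ℕ) < 2 * h) := h1
        have h4 : (decide ((u : ℕ) < 2 * h) && decide ((v : ℕ) < 2 * h)) = false := by
          rw [← Bool.decide_and]; simpa using h3
        simp [blockPair, h2.1, h2.2, h4, hB _ h2.1, hB _ h2.2]
      · have h4 : (decide ((u : ℕ) < 2 * h) && decide ((v : ℕ) < 2 * h)) = false := by
          rw [← Bool.decide_and]; simpa using h1
        have h5 : (decide (h ≤ (u : ℕ)) && decide (h ≤ (v : ℕ))) = false := by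
          rw [← Bool.decide_and]; simpa using h2
        simp [blockPair, h4, h5, hC u (by omega), hC v (by omega)]
  have hw : weight h n x y 0 + weight h n 0 0 z = weight h n x y z := by
    simp only [weight]
    rw [← Finset.sum_add_distrib]
    refine Finset.sum_congr rfl fun u _ => ?_
    rw [← Nat.add_mul]
    congr 1
    by_cases hu : 2 * h ≤ u
    · simp [member, hu, testBit_eq_false_of_le hx (show h ≤ u by omega),
        testBit_eq_false_of_le hy (show h ≤ u - h by omega)]
    · simp [member, hu]
  rw [expA, expB, expC, ← hc, ← hw]
  ring

theorem exists_blocks (hn : n ≤ 3 * h) (L : Finset (Fin n)) : ∃ x < 2 ^ h, ∃ y < 2 ^ h,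
    ∃ z < 2 ^ h, blockSet h n x y z = L ∧ weight h n x y z = L.card := by
  classical
  have key : ∀ s, ∃ x < 2 ^ h, ∀ u, x.testBit u = decide (u < h ∧ ∃ hu : s + u < n,
      (⟨s + u, hu⟩ : Fin n) ∈ L) := fun s =>
    ⟨Nat.ofBits fun u : Fin h => decide (∃ hu : s + u < n, (⟨s + u, hu⟩ : Fin n) ∈ L),
      Nat.ofBits_lt_two_pow _, fun u => by
      by_cases hu : u < h
      · rw [Nat.testBit_ofBits_lt _ _ hu]; simp [hu]
      · rw [Nat.testBit_ofBits_ge _ _ (by omega)]; simp [hu]⟩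
  obtain ⟨x, hx, hx'⟩ := key 0
  obtain ⟨y, hy, hy'⟩ := key h
  obtain ⟨z, hz, hz'⟩ := key (2 * h)
  have hmem : ∀ u, u < 3 * h → (member h x y z u = true ↔
      ∃ hu : u < n, (⟨u, hu⟩ : Fin n) ∈ L) := by
    intro u hu
    simp only [member, hx', hy', hz', Bool.or_eq_true, Bool.and_eq_true, decide_eq_true_eq,
      zero_add]
    constructor
    · rintro ((⟨-, h1⟩ | ⟨h2, -, h1⟩) | ⟨h2, -, h1⟩)
      · exact h1
      · simpa only [Nat.add_sub_cancel' h2] using h1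
      · simpa only [Nat.add_sub_cancel' h2] using h1
    · intro h1
      rcases Nat.lt_or_ge u h with h2 | h2
      · exact .inl (.inl ⟨h2, h1⟩)
      · rcases Nat.lt_or_ge u (2 * h) with h3 | h3
        · exact .inl (.inr ⟨h2, by omega, by simpa only [Nat.add_sub_cancel' h2] using h1⟩)
        · exact .inr ⟨h3, by omega, by simpa only [Nat.add_sub_cancel' h3] using h1⟩
  refine ⟨x, hx, y, hy, z, hz, ?_, ?_⟩
  · ext u
    rw [blockSet, Finset.mem_filter, hmem u (by omega)]
    simp
  · have h1 : ∀ u ∈ Finset.range (3 * h), ((if member h x y z u = true then 1 else 0) *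
        if u < n then 1 else n + 1) = if ∃ hu : u < n, (⟨u, hu⟩ : Fin n) ∈ L then 1 else 0 := by
      intro u hu
      rw [if_congr (hmem u (Finset.mem_range.1 hu)) rfl rfl]
      split_ifs with h2 h3
      · rfl
      · exact absurd h2.1 h3
      · rfl
      · simp
    rw [weight, Finset.sum_congr rfl h1, show 3 * h = n + (3 * h - n) by omega,
      Finset.sum_range_add, Finset.sum_range,
      Finset.sum_eq_zero (s := Finset.range (3 * h - n)) fun u _ => by simp, add_zero]
    simp

/-- The three blocks may contain numbers from `n` on that are not vertices. Using one of them
already costs `n + 1`, so a weight of at most `n` rules them out. -/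
theorem card_blockSet_of_weight (hn : n ≤ 3 * h) {x y z : ℕ} (hw : weight h n x y z ≤ n) :
    (blockSet h n x y z).card = weight h n x y z := by
  have h1 : weight h n x y z = (∑ u : Fin n, if member h x y z u = true then 1 else 0) +
      ∑ u ∈ Finset.range (3 * h - n), (if member h x y z (n + u) = true then 1 else 0) *
        (n + 1) := by
    rw [weight]
    conv_lhs => rw [show 3 * h = n + (3 * h - n) by omega]
    rw [Finset.sum_range_add, Finset.sum_range]
    congr 1
    · exact Finset.sum_congr rfl fun u _ => by simp
    · exact Finset.sum_congr rfl fun u _ => by simp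
  rw [← Finset.sum_mul] at h1
  have h2 : ∑ u ∈ Finset.range (3 * h - n), (if member h x y z (n + u) = true then 1 else 0) = 0 := by
    by_contra h3
    have := Nat.mul_le_mul_right (n + 1) (Nat.one_le_iff_ne_zero.2 h3)
    omega
  rw [h1, h2, zero_mul, add_zero, blockSet, Finset.card_filter]

end Cut

/-! ### Minimum search -/

/-- The minimum of `V j * N + j` over all `j ≤ i`. -/
def bestOf (V : ℕ → ℕ) (N : ℕ) : ℕ → ℕ
  | 0 => V 0 * N
  | i + 1 => min (bestOf V N i) (V (i + 1) * N + (i + 1))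

theorem bestOf_le (V : ℕ → ℕ) (N : ℕ) {i j : ℕ} (h : j ≤ i) : bestOf V N i ≤ V j * N + j := by
  induction i with
  | zero => obtain rfl : j = 0 := by omega
            exact le_rfl
  | succ i ih =>
    rcases Nat.le_succ_iff.1 h with h | rfl
    · exact (min_le_left _ _).trans (ih h)
    · exact min_le_right _ _

theorem exists_bestOf_eq (V : ℕ → ℕ) (N i : ℕ) : ∃ j ≤ i, bestOf V N i = V j * N + j := by
  induction i with
  | zero => exact ⟨0, le_rfl, rfl⟩
  | succ i ih =>
    obtain ⟨j, hj, h⟩ := ih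
    rcases min_choice (bestOf V N i) (V (i + 1) * N + (i + 1)) with h' | h'
    · exact ⟨j, by omega, h'.trans h⟩
    · exact ⟨i + 1, le_rfl, h'⟩

/-- The largest number up to `i` that satisfies `p`, or `0`. -/
def lastOf (p : ℕ → Prop) [DecidablePred p] : ℕ → ℕ
  | 0 => 0
  | i + 1 => if p (i + 1) then i + 1 else lastOf p i

theorem lastOf_le (p : ℕ → Prop) [DecidablePred p] (i : ℕ) : lastOf p i ≤ i := by
  induction i with
  | zero => exact le_rfl
  | succ i ih => rw [lastOf]; split_ifs <;> omega

theorem lastOf_spec {p : ℕ → Prop} [DecidablePred p] {i j : ℕ} (hj : j ≤ i) (h : p j) :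
    p (lastOf p i) := by
  induction i with
  | zero => obtain rfl : j = 0 := by omega
            exact h
  | succ i ih =>
    rw [lastOf]
    split_ifs with h1
    · exact h1
    · rcases Nat.le_succ_iff.1 hj with h2 | rfl
      · exact ih h2
      · exact absurd h h1

/-- The position of the matrix entry in row `x` and column `y`. -/
theorem exists_rowIdx_colIdx {k : ℕ} (hk : 1 < k) {d x y : ℕ} (hx : x < k ^ d) (hy : y < k ^ d) :
    ∃ i < (k * k) ^ d, rowIdx k i = x ∧ colIdx k i = y := by
  by_contra! hno
  -- If no position belonged to `(x, y)`, summing the indicator of this pair over all positions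
  -- would give `0`, but summing it over rows and columns gives `1`.
  have h1 := sum_rowIdx_colIdx hk d fun x' y' => if x' = x ∧ y' = y then 1 else 0
  rw [Finset.sum_eq_zero fun i hi => if_neg fun h => hno i (Finset.mem_range.1 hi) h.1 h.2] at h1
  have h2 := (Finset.sum_eq_zero_iff.1 ((Finset.sum_eq_zero_iff.1 h1.symm) x
    (Finset.mem_range.2 hx))) y (Finset.mem_range.2 hy)
  simp at h2

/-! ### Recovering a minimum cut from the selected pair -/

section Selection

variable {n : ℕ} (G : Digraph (Fin n)) {h : ℕ}

/-- A triple of sets with a minimum exponent gives a minimum balanced cut. -/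
theorem isMinCut_blockSet {k d : ℕ} (hk : 1 < k) (hkd : k ^ d = 2 ^ h) (hn : n ≤ 3 * h)
    {V : ℕ → ℕ} (hV : ∀ i < (k * k) ^ d, V i = foldVal true (fun w =>
      if ∃ y < 2 ^ h, expA G h (rowIdx k i) y + expB G h y (colIdx k i) +
        expC G h (rowIdx k i) (colIdx k i) = w + (n * n + 1) * (n / 2) then 1 else 0) (n * n + 1))
    {b i : ℕ} (hb : b = bestOf V ((k * k) ^ d) ((k * k) ^ d - 1)) (hi : i = b % (k * k) ^ d) :
    IsMinCut G (n / 2) (blockSet h n (rowIdx k i) (lastOf (fun y =>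
      expA G h (rowIdx k i) y + expB G h y (colIdx k i) + expC G h (rowIdx k i) (colIdx k i) =
        b / (k * k) ^ d + (n * n + 1) * (n / 2)) (2 ^ h - 1)) (colIdx k i)) := by
  have hN : 0 < (k * k) ^ d := by positivity
  obtain ⟨j, hj, hbj⟩ := exists_bestOf_eq V ((k * k) ^ d) ((k * k) ^ d - 1)
  have hjN : j < (k * k) ^ d := by omega
  -- The number `b` is `V j * N + j` with `j < N`, so its remainder is the minimizing index and its
  -- quotient the minimum.
  have hij : i = j := by
    rw [hi, hb, hbj, Nat.add_comm, Nat.add_mul_mod_self_right, Nat.mod_eq_of_lt hjN]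
  have hW : b / (k * k) ^ d = V i := by
    rw [hb, hbj, Nat.add_comm, Nat.add_mul_div_right _ _ hN, Nat.div_eq_of_lt hjN, zero_add, hij]
  have hiN : i < (k * k) ^ d := hij ▸ hjN
  have hmin : ∀ l < (k * k) ^ d, V i ≤ V l := by
    intro l hl
    have h1 := bestOf_le V ((k * k) ^ d) (i := (k * k) ^ d - 1) (j := l) (by omega)
    rw [hbj, ← hij] at h1
    by_contra hlt
    have h2 := Nat.mul_le_mul_right ((k * k) ^ d) (Nat.succ_le_of_lt (not_le.1 hlt))
    rw [Nat.succ_mul] at h2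
    omega
  have hVle : ∀ l < (k * k) ^ d, ∀ w, w ≤ n * n → (∃ y < 2 ^ h, expA G h (rowIdx k l) y +
      expB G h y (colIdx k l) + expC G h (rowIdx k l) (colIdx k l) =
        w + (n * n + 1) * (n / 2)) → V l ≤ w := by
    intro l hl w hw hy
    by_contra hlt
    rw [hV l hl] at hlt
    have := (foldVal_search _ _).2.1 w (not_le.1 hlt)
    rw [if_pos hy] at this
    exact one_ne_zero this
  have hall : ∀ L' : Finset (Fin n), L'.card = n / 2 → V i ≤ cutSize G L' := by
    intro L' hL'
    obtain ⟨x, hx, y, hy, z, hz, h1, h2⟩ := exists_blocks hn L'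
    obtain ⟨l, hl, rfl, rfl⟩ := exists_rowIdx_colIdx hk (hkd ▸ hx) (hkd ▸ hz)
    refine (hmin l hl).trans (hVle l hl _ ?_ ⟨y, hy, ?_⟩)
    · simpa using cutSize_le_sq G L'
    · rw [expA_add_expB_add_expC G hx hy, h1, h2, hL']
  obtain ⟨L0, -, hL0⟩ := Finset.exists_subset_card_eq (s := (Finset.univ : Finset (Fin n)))
    (n := n / 2) (by simpa using Nat.div_le_self n 2)
  have hVn : V i ≤ n * n := (hall L0 hL0).trans (by simpa using cutSize_le_sq G L0)
  have hex : ∃ y < 2 ^ h, expA G h (rowIdx k i) y + expB G h y (colIdx k i) +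
      expC G h (rowIdx k i) (colIdx k i) = V i + (n * n + 1) * (n / 2) := by
    by_contra hno
    have h3 := (foldVal_search (fun w =>
      if ∃ y < 2 ^ h, expA G h (rowIdx k i) y + expB G h y (colIdx k i) +
        expC G h (rowIdx k i) (colIdx k i) = w + (n * n + 1) * (n / 2) then 1 else 0)
        (n * n + 1)).2.2
    rw [← hV i hiN] at h3
    exact h3 (by omega) (if_neg hno)
  obtain ⟨y, hy, hey⟩ := hex
  rw [hW]
  -- The values `V` only certify that a matching set in the second block exists. It is found by a
  -- scan for this single pair, over all `2 ^ h` candidates.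
  set y' := lastOf (fun y => expA G h (rowIdx k i) y + expB G h y (colIdx k i) +
      expC G h (rowIdx k i) (colIdx k i) = V i + (n * n + 1) * (n / 2)) (2 ^ h - 1) with hy'
  have hspec : expA G h (rowIdx k i) y' + expB G h y' (colIdx k i) +
      expC G h (rowIdx k i) (colIdx k i) = V i + (n * n + 1) * (n / 2) :=
    lastOf_spec (p := fun y => expA G h (rowIdx k i) y + expB G h y (colIdx k i) +
      expC G h (rowIdx k i) (colIdx k i) = V i + (n * n + 1) * (n / 2))
      (i := 2 ^ h - 1) (j := y) (by omega) hey
  have hylt : y' < 2 ^ h := lt_of_le_of_lt (lastOf_le _ _) (Nat.sub_lt (by positivity) one_pos)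
  have hx : rowIdx k i < 2 ^ h := hkd ▸ (idx_lt hk hiN).1
  rw [expA_add_expB_add_expC G hx hylt, Nat.add_comm, Nat.add_comm (V i)] at hspec
  have hcs : cutSize G (blockSet h n (rowIdx k i) y' (colIdx k i)) ≤ n * n := by
    simpa using cutSize_le_sq G (blockSet h n (rowIdx k i) y' (colIdx k i))
  have hdiv : weight h n (rowIdx k i) y' (colIdx k i) = n / 2 := by
    have h5 : ∀ a b, b ≤ n * n → ((n * n + 1) * a + b) / (n * n + 1) = a := fun a b hb => by
      rw [Nat.mul_add_div (by omega), Nat.div_eq_of_lt (by omega), add_zero]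
    rw [← h5 (weight h n (rowIdx k i) y' (colIdx k i)) _ hcs, hspec, h5 _ _ hVn]
  have hcut : cutSize G (blockSet h n (rowIdx k i) y' (colIdx k i)) = V i := by
    rw [hdiv] at hspec; omega
  refine ⟨?_, fun L' hL' => hcut.trans_le (hall L' hL')⟩
  rw [card_blockSet_of_weight hn (by rw [hdiv]; exact Nat.div_le_self n 2), hdiv]

end Selection

/-! ### Expressions for the exponents -/

namespace TExpr

/-- Membership of `u` in the set given by `x`, `y`, `z`. -/
def member (h : Bound) (x y z u : TExpr) : TExpr :=
  .lt (.const 0) (.add (bit x u) (.add (.mul (.le (.ofBound h) u) (bit y (.sub u (.ofBound h))))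
    (.mul (.le (.mul (.const 2) (.ofBound h)) u)
      (bit z (.sub u (.mul (.const 2) (.ofBound h)))))))

/-- The selection of pairs of vertices by blocks. -/
def blockPair (h : Bound) (k : Fin 3) (u v : TExpr) : TExpr :=
  let p := .mul (.lt u (.mul (.const 2) (.ofBound h))) (.lt v (.mul (.const 2) (.ofBound h)))
  let r := .mul (.le (.ofBound h) u) (.le (.ofBound h) v)
  match k with
  | 0 => p
  | 1 => .mul (.sub (.const 1) p) r
  | 2 => .mul (.sub (.const 1) p) (.sub (.const 1) r)

/-- The number of selected arcs that enter a set. The bound variables are `b` and `b + 1`. -/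
def cutPart (h : Bound) (k : Fin 3) (b : ℕ) (x y z : TExpr) : TExpr :=
  .sum b .n (.sum (b + 1) .n (.mul (blockPair h k (.var b) (.var (b + 1)))
    (.mul (.adj (.var b) (.var (b + 1))) (.mul (.sub (.const 1) (member h x y z (.var b)))
      (member h x y z (.var (b + 1)))))))

/-- The weighted size of a set. The bound variable is `b`. -/
def weight (h : Bound) (b : ℕ) (x y z : TExpr) : TExpr :=
  .sum b (.mul (.const 3) h) (.mul (member h x y z (.var b))
    (.ite (.lt (.var b) (.ofBound .n)) (.const 1) (.ofBound (.add .n (.const 1)))))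

/-- The exponent for a pair of sets in the first two blocks. -/
def expA (h : Bound) (b : ℕ) (x y : TExpr) : TExpr :=
  .add (cutPart h 0 b x y (.const 0))
    (.mul (.ofBound (.add (.mul .n .n) (.const 1))) (weight h b x y (.const 0)))

/-- The exponent for a pair of sets in the last two blocks. -/
def expB (h : Bound) (b : ℕ) (y z : TExpr) : TExpr :=
  .add (cutPart h 1 b (.const 0) y z)
    (.mul (.ofBound (.add (.mul .n .n) (.const 1))) (weight h b (.const 0) (.const 0) z))

/-- The exponent for a pair of sets in the first and the last block. -/
def expC (h : Bound) (b : ℕ) (x z : TExpr) : TExpr := cutPart h 2 b x (.const 0) z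

end TExpr

namespace HasValue

section Member

variable {I : Mem} {A : State} {vs : List ℕ} {B : Bound} {h : ℕ} {xe ye ze ue ve : TExpr}
  {x y z u v : ℕ} (hB : B.val (I 0) = h)

include hB

theorem member (hpow : ∀ w ≤ u, A 1 w = 2 ^ w) (hx : HasValue I A vs xe x)
    (hy : HasValue I A vs ye y) (hz : HasValue I A vs ze z) (hu : HasValue I A vs ue u) :
    HasValue I A vs (.member B xe ye ze ue)
      (if DirCutwidth.member h x y z u = true then 1 else 0) := by
  have hh : HasValue I A vs (.ofBound B) h := (ofBound B).congr hB
  have h2 := (const (I := I) (A := A) (vs := vs) 2).mul hh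
  refine ((const 0).lt ((bit (hpow _ le_rfl) hx hu).add
    (((hh.le hu).mul (bit (hpow _ (Nat.sub_le _ _)) hy (hu.sub hh))).add
    ((h2.le hu).mul (bit (hpow _ (Nat.sub_le _ _)) hz (hu.sub h2)))))).congr
    (if_congr ?_ rfl rfl)
  rw [DirCutwidth.member]
  simp only [Bool.or_eq_true, Bool.and_eq_true, decide_eq_true_eq]
  by_cases h1 : x.testBit u = true <;> by_cases h3 : h ≤ u <;>
    by_cases h4 : y.testBit (u - h) = true <;> by_cases h5 : 2 * h ≤ u <;>
    by_cases h6 : z.testBit (u - 2 * h) = true <;> simp [h1, h3, h4, h5, h6]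

theorem blockPair (k : Fin 3) (hu : HasValue I A vs ue u) (hv : HasValue I A vs ve v) :
    HasValue I A vs (.blockPair B k ue ve)
      (if DirCutwidth.blockPair h k u v = true then 1 else 0) := by
  have hh : HasValue I A vs (.ofBound B) h := (ofBound B).congr hB
  have h2 := (const (I := I) (A := A) (vs := vs) 2).mul hh
  have hp := (hu.lt h2).mul (hv.lt h2)
  have hr := (hh.le hu).mul (hh.le hv)
  fin_cases k
  · refine hp.congr ?_
    by_cases h1 : u < 2 * h <;> by_cases h3 : v < 2 * h <;> simp [DirCutwidth.blockPair, h1, h3]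
  · refine (((const 1).sub hp).mul hr).congr ?_
    by_cases h1 : u < 2 * h <;> by_cases h3 : v < 2 * h <;> by_cases h4 : h ≤ u <;>
      by_cases h5 : h ≤ v <;> simp [DirCutwidth.blockPair, h1, h3, h4, h5]
  · refine (((const 1).sub hp).mul ((const 1).sub hr)).congr ?_
    by_cases h1 : u < 2 * h <;> by_cases h3 : v < 2 * h <;> by_cases h4 : h ≤ u <;>
      by_cases h5 : h ≤ v <;> simp [DirCutwidth.blockPair, h1, h3, h4, h5]

end Member

section Exponents

variable {n : ℕ} {G : Digraph (Fin n)} {A : State} {vs : List ℕ} {B : Bound} {h b : ℕ}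
  {xe ye ze : TExpr} {x y z : ℕ} (hB : B.val (graphInput G 0) = h)

include hB

theorem cutPart (k : Fin 3) (hpow : ∀ w < n, A 1 w = 2 ^ w) (hb : b = vs.length)
    (hx : HasValue (graphInput G) A vs xe x) (hy : HasValue (graphInput G) A vs ye y)
    (hz : HasValue (graphInput G) A vs ze z) : HasValue (graphInput G) A vs
      (.cutPart B k b xe ye ze) (DirCutwidth.cutPart G h (DirCutwidth.blockPair h k) x y z) := by
  classical
  refine sum val_n hb fun u hu => sum val_n (by simp [hb]) fun v hv => ?_
  have hu' : HasValue (graphInput G) A (vs ++ [u] ++ [v]) (.var b) u := (last hb).weaken [v]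
  have hv' : HasValue (graphInput G) A (vs ++ [u] ++ [v]) (.var (b + 1)) v := last (by simp [hb])
  have hx' := (hx.weaken [u]).weaken [v]
  have hy' := (hy.weaken [u]).weaken [v]
  have hz' := (hz.weaken [u]).weaken [v]
  refine (blockPair hB k hu' hv').mul (((adj hu' hv' hu hv).congr (if_congr ?_ rfl rfl)).mul
    (((const 1).sub (member hB (fun w hw => hpow w (by omega)) hx' hy' hz' hu')).mul
      (member hB (fun w hw => hpow w (by omega)) hx' hy' hz' hv')))
  exact ⟨fun h => ⟨_, _, h⟩, fun ⟨_, _, h⟩ => h⟩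

theorem weight (hpow : ∀ w < 3 * h, A 1 w = 2 ^ w) (hb : b = vs.length)
    (hx : HasValue (graphInput G) A vs xe x) (hy : HasValue (graphInput G) A vs ye y)
    (hz : HasValue (graphInput G) A vs ze z) : HasValue (graphInput G) A vs
      (.weight B b xe ye ze) (DirCutwidth.weight h n x y z) := by
  refine sum (by simp [Bound.val, hB]) hb fun u hu => ?_
  refine (member hB (fun w hw => hpow w (by omega)) (hx.weaken [u]) (hy.weaken [u]) (hz.weaken [u])
    (last hb)).mul (((last hb).lt ((ofBound .n).congr val_n)).ite (fun _ => const 1) fun _ =>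
      (ofBound (.add .n (.const 1))).congr ?_)
  simp [Bound.val, graphInput_zero]

theorem expA (hpow : ∀ w < 3 * h, A 1 w = 2 ^ w) (hn : n ≤ 3 * h) (hb : b = vs.length)
    (hx : HasValue (graphInput G) A vs xe x) (hy : HasValue (graphInput G) A vs ye y) :
    HasValue (graphInput G) A vs (.expA B b xe ye) (DirCutwidth.expA G h x y) :=
  (cutPart hB 0 (fun w hw => hpow w (by omega)) hb hx hy (const 0)).add
    (((ofBound _).congr (by simp [Bound.val, graphInput_zero])).mul
      (weight hB hpow hb hx hy (const 0)))

theorem expB (hpow : ∀ w < 3 * h, A 1 w = 2 ^ w) (hn : n ≤ 3 * h) (hb : b = vs.length)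
    (hy : HasValue (graphInput G) A vs ye y) (hz : HasValue (graphInput G) A vs ze z) :
    HasValue (graphInput G) A vs (.expB B b ye ze) (DirCutwidth.expB G h y z) :=
  (cutPart hB 1 (fun w hw => hpow w (by omega)) hb (const 0) hy hz).add
    (((ofBound _).congr (by simp [Bound.val, graphInput_zero])).mul
      (weight hB hpow hb (const 0) (const 0) hz))

theorem expC (hpow : ∀ w < 3 * h, A 1 w = 2 ^ w) (hn : n ≤ 3 * h) (hb : b = vs.length)
    (hx : HasValue (graphInput G) A vs xe x) (hz : HasValue (graphInput G) A vs ze z) :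
    HasValue (graphInput G) A vs (.expC B b xe ze) (DirCutwidth.expC G h x z) :=
  cutPart hB 2 (fun w hw => hpow w (by omega)) hb hx (const 0) hz

end Exponents

end HasValue

/-! ### The sizes of the numbers and of the tables -/

section Sizes

variable {q R : ℕ} (S : BilinearAlgorithm (2 ^ q) R) (n : ℕ)

/-- The depth of the recursion for matrix multiplication. -/
def depth (q n : ℕ) : ℕ := n / (3 * q) + 1

/-- The number of vertices in a block. -/
def blockLen (q n : ℕ) : ℕ := q * depth q n

/-- An upper bound for all exponents. -/
def topExp (q n : ℕ) : ℕ := (n * n + 1) * (3 * blockLen q n * (n + 1) + 1)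

/-- The number of bits of a digit. -/
def baseBits : ℕ := blockLen q n + S.D.size * depth q n + 1

/-- The number of bits of the modulus. -/
def modBits : ℕ := baseBits S n * (topExp q n + 1)

/-- The number of powers of two in the table. -/
def powLen : ℕ := modBits S n + 3 * blockLen q n + n + 2

theorem le_three_mul_blockLen {q : ℕ} (hq : 0 < q) (n : ℕ) : n ≤ 3 * blockLen q n := by
  have := Nat.lt_mul_div_succ n (show 0 < 3 * q by omega)
  rw [blockLen, depth, ← mul_assoc]
  exact this.le

theorem two_pow_pow_depth (q n : ℕ) : (2 ^ q) ^ depth q n = 2 ^ blockLen q n := by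
  rw [← pow_mul, blockLen]

theorem two_pow_mul_pow (q s : ℕ) : (2 ^ q * 2 ^ q) ^ s = 2 ^ (2 * q * s) := by
  rw [← pow_add, ← pow_mul, two_mul]

theorem sq_lt_topExp (q n : ℕ) : n * n < topExp q n :=
  Nat.lt_of_succ_le (Nat.le_mul_of_pos_right _ (Nat.succ_pos _))

theorem topExp_lt_modBits : topExp q n < modBits S n :=
  Nat.lt_of_succ_le (Nat.le_mul_of_pos_left _ (Nat.succ_pos _))

/-- The entries of the product are `D ^ d` times sums of `2 ^ h` powers of the base. This inequality
is the condition under which such a sum has no carries. -/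
theorem base_bound : S.D ^ depth q n * 2 ^ blockLen q n < 2 ^ baseBits S n := by
  have h1 : S.D ^ depth q n ≤ 2 ^ (S.D.size * depth q n) := by
    rw [pow_mul]; exact Nat.pow_le_pow_left (Nat.lt_size_self _).le _
  calc _ ≤ 2 ^ (S.D.size * depth q n) * 2 ^ blockLen q n := Nat.mul_le_mul_right _ h1
    _ = 2 ^ (blockLen q n + S.D.size * depth q n) := by rw [← pow_add, add_comm]
    _ < _ := Nat.pow_lt_pow_right (by norm_num) (Nat.lt_succ_self _)

theorem two_pow_modBits : 2 ^ modBits S n = (2 ^ baseBits S n) ^ (topExp q n + 1) := by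
  rw [← pow_mul, modBits]

end Sizes

/-! ### The digits of an entry of the product -/

/-- As all exponents are at most `s`, the true entry is below `X * X ^ s = M`, so nothing is lost
modulo `M`. Multiplication by `X ^ c` shifts the digits and thereby adds the third exponent, which
does not depend on `y`. -/
theorem BilinearAlgorithm.digit_product_ne_zero_iff {k R : ℕ} (S : BilinearAlgorithm k R)
    (hk : 1 < k) {d X M s i : ℕ} (a b : ℕ → ℕ → ℕ) (hX : S.D ^ d * k ^ d < X)
    (hM : M = X ^ (s + 1))
    (hab : ∀ x < k ^ d, ∀ y < k ^ d, ∀ z, a x y + b y z ≤ s) (hi : i < (k * k) ^ d) (c w : ℕ) :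
    residue M (S.product d (fun l => ((X ^ a (rowIdx k l) (colIdx k l) : ℕ) : ℤ))
      (fun l => ((X ^ b (rowIdx k l) (colIdx k l) : ℕ) : ℤ)) i) * X ^ c / X ^ w % X ≠ 0 ↔
      ∃ y < k ^ d, a (rowIdx k i) y + b y (colIdx k i) + c = w := by
  have h1 := S.product_eq hk (d := d) (fun x y => ((X ^ a x y : ℕ) : ℤ))
    (fun x y => ((X ^ b x y : ℕ) : ℤ)) hi
  have h2 : (S.D : ℤ) ^ d * ∑ y ∈ Finset.range (k ^ d),
      ((X ^ a (rowIdx k i) y : ℕ) : ℤ) * ((X ^ b y (colIdx k i) : ℕ) : ℤ) =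
      ((S.D ^ d * ∑ y ∈ Finset.range (k ^ d), X ^ (a (rowIdx k i) y + b y (colIdx k i)) : ℕ) : ℤ) := by
    push_cast
    simp only [pow_add]
  have hX0 : 0 < X := by omega
  have h3 : S.D ^ d * ∑ y ∈ Finset.range (k ^ d), X ^ (a (rowIdx k i) y + b y (colIdx k i)) < M := by
    have h4 : ∑ y ∈ Finset.range (k ^ d), X ^ (a (rowIdx k i) y + b y (colIdx k i)) ≤
        k ^ d * X ^ s := by
      refine (Finset.sum_le_card_nsmul _ _ (X ^ s) fun y hy => ?_).trans (by simp)
      exact Nat.pow_le_pow_right hX0 (hab _ (idx_lt hk hi).1 _ (Finset.mem_range.1 hy) _)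
    calc _ ≤ S.D ^ d * (k ^ d * X ^ s) := Nat.mul_le_mul_left _ h4
      _ = S.D ^ d * k ^ d * X ^ s := by ring
      _ < X * X ^ s := Nat.mul_lt_mul_of_pos_right hX (by positivity)
      _ = M := by rw [hM, pow_succ']
  rw [h1, h2, residue_natCast h3, mul_assoc, Finset.sum_mul]
  simp only [← pow_add]
  exact digit_ne_zero_iff (pow_pos S.D_pos d) hX _ _

/-! ### The contents of the tables -/

section Contents

variable {n : ℕ} (G : Digraph (Fin n)) (k h N : ℕ)

/-- The minimum size of a balanced cut of the vertices for which the sets in the first and the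
last block are given by `i`. -/
noncomputable def cutVal (i : ℕ) : ℕ :=
  foldVal true (fun w => if ∃ y < 2 ^ h, expA G h (rowIdx k i) y + expB G h y (colIdx k i) +
    expC G h (rowIdx k i) (colIdx k i) = w + (n * n + 1) * (n / 2) then 1 else 0) (n * n + 1)

/-- The minimum cut together with its index. -/
noncomputable def bestVal (i : ℕ) : ℕ := bestOf (cutVal G k h) N i

/-- The largest number up to `y` that represents the second block of a minimum cut. -/
noncomputable def lastVal (y : ℕ) : ℕ :=
  lastOf (fun y => expA G h (rowIdx k (bestVal G k h N (N - 1) % N)) y +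
    expB G h y (colIdx k (bestVal G k h N (N - 1) % N)) +
    expC G h (rowIdx k (bestVal G k h N (N - 1) % N)) (colIdx k (bestVal G k h N (N - 1) % N)) =
    bestVal G k h N (N - 1) / N + (n * n + 1) * (n / 2)) y

/-- A minimum balanced cut. -/
noncomputable def cutSet : Finset (Fin n) :=
  blockSet h n (rowIdx k (bestVal G k h N (N - 1) % N)) (lastVal G k h N (2 ^ h - 1))
    (colIdx k (bestVal G k h N (N - 1) % N))

theorem isMinCut_cutSet {k h d : ℕ} (hk : 1 < k) (hkd : k ^ d = 2 ^ h) (hn : n ≤ 3 * h) :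
    IsMinCut G (n / 2) (cutSet G k h ((k * k) ^ d)) :=
  isMinCut_blockSet G hk hkd hn (V := cutVal G k h) (fun _ _ => rfl) rfl rfl

theorem bestVal_le (i : ℕ) : bestVal G k h N i ≤ (n * n + 1) * N := by
  refine (bestOf_le _ _ (Nat.zero_le i)).trans ?_
  rw [add_zero]
  exact Nat.mul_le_mul_right _ (foldVal_search _ _).1

open Classical in
/-- The positions in the ordering that lists first `L` and then the other vertices. -/
noncomputable def outPos (L : Finset (Fin n)) (v : ℕ) : ℕ :=
  if ind L v = 1 then posOf G L (rankOf L v) else n / 2 + posOf G Lᶜ (rankOf Lᶜ v)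

variable {k h N}
variable {q R : ℕ} (S : BilinearAlgorithm (2 ^ q) R)

/-- The exponents of the first factor as powers. -/
noncomputable def factorA (l : ℕ) : ℤ :=
  (((2 ^ baseBits S n) ^ expA G (blockLen q n) (rowIdx (2 ^ q) l) (colIdx (2 ^ q) l) : ℕ) : ℤ)

/-- The exponents of the second factor as powers. -/
noncomputable def factorB (l : ℕ) : ℤ :=
  (((2 ^ baseBits S n) ^ expB G (blockLen q n) (rowIdx (2 ^ q) l) (colIdx (2 ^ q) l) : ℕ) : ℤ)

/-- The levels for the first factor. -/
noncomputable def levelsA : ℕ → ℕ :=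
  yatesTable S.α (2 ^ q * 2 ^ q) R (depth q n) (R ^ depth q n) (2 ^ modBits S n) (factorA G S)

/-- The levels for the second factor. -/
noncomputable def levelsB : ℕ → ℕ :=
  yatesTable S.β (2 ^ q * 2 ^ q) R (depth q n) (R ^ depth q n) (2 ^ modBits S n) (factorB G S)

/-- The levels for the product. -/
noncomputable def levelsC : ℕ → ℕ :=
  yatesTable (fun l r => S.γ r l) R (2 ^ q * 2 ^ q) (depth q n) (R ^ depth q n) (2 ^ modBits S n)
    fun r => yates S.α (2 ^ q * 2 ^ q) R (depth q n) (factorA G S) (depth q n) r *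
      yates S.β (2 ^ q * 2 ^ q) R (depth q n) (factorB G S) (depth q n) r

theorem expA_add_expB_le {h x y z : ℕ} (hx : x < 2 ^ h) (hy : y < 2 ^ h) :
    expA G h x y + expB G h y z + expC G h x z < (n * n + 1) * (3 * h * (n + 1) + 1) := by
  rw [expA_add_expB_add_expC G hx hy]
  have h1 : cutSize G (blockSet h n x y z) ≤ n * n := by
    simpa using cutSize_le_sq G (blockSet h n x y z)
  have h2 := Nat.mul_le_mul_left (n * n + 1) (weight_le (h := h) n x y z)
  rw [Nat.mul_succ]
  omega

end Contents

/-! ### The expressions for the tables -/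

section Expressions

/-- The depth as a loop bound. -/
def depthB (q : ℕ) : Bound := .add (.div .n (.const (3 * q))) (.const 1)

/-- The number of vertices in a block as a loop bound. -/
def blockB (q : ℕ) : Bound := .mul (.const q) (depthB q)

/-- The number of possible sizes of a cut as a loop bound. -/
def bigB : Bound := .add (.mul .n .n) (.const 1)

/-- The upper bound for all exponents as a loop bound. -/
def topB (q : ℕ) : Bound :=
  .mul bigB (.add (.mul (.mul (.const 3) (blockB q)) (.add .n (.const 1))) (.const 1))

variable {q R : ℕ} (S : BilinearAlgorithm (2 ^ q) R)

/-- The number of bits of a digit as a loop bound. -/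
def baseB : Bound := .add (.add (blockB q) (.mul (.const S.D.size) (depthB q))) (.const 1)

/-- The number of bits of the modulus as a loop bound. -/
def modB : Bound := .mul (baseB S) (.add (topB q) (.const 1))

/-- The number of powers of two as a loop bound. -/
def powB : Bound := .add (.add (.add (modB S) (.mul (.const 3) (blockB q))) .n) (.const 2)

/-- Half the number of vertices, rounded down. -/
def halfB : Bound := .div .n (.const 2)

/-- Half the number of vertices, rounded up. -/
def halfB' : Bound := .div (.add .n (.const 1)) (.const 2)

theorem val_depthB (q n : ℕ) : (depthB q).val n = depth q n := rfl

theorem val_blockB (q n : ℕ) : (blockB q).val n = blockLen q n := rfl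

theorem val_bigB (n : ℕ) : bigB.val n = n * n + 1 := rfl

theorem val_baseB (n : ℕ) : (baseB S).val n = baseBits S n := rfl

theorem val_modB (n : ℕ) : (modB S).val n = modBits S n := rfl

theorem val_powB (n : ℕ) : (powB S).val n = powLen S n := rfl

namespace TExpr

/-- A power of the square of `2 ^ q`. -/
def powSq (q : ℕ) (e : TExpr) : TExpr := .arr 1 (.mul (.const (2 * q)) e)

/-- A power of the base of the digits. -/
def powBase (e : TExpr) : TExpr := .arr 1 (.mul (.ofBound (baseB S)) e)

/-- The number of pairs of sets in the first and the last block. -/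
def numPairs (q : ℕ) : TExpr := powSq q (.ofBound (depthB q))

/-- The length of a level. -/
def levelLen (q : ℕ) : TExpr := .arr 2 (.ofBound (depthB q))

/-- The entry `e` of the last level in the table `t`. -/
def lastLevel (q t : ℕ) (e : TExpr) : TExpr :=
  .arr t (.add (.mul (.ofBound (depthB q)) (levelLen q)) e)

/-- The modulus. -/
def modulus : TExpr := .arr 1 (.ofBound (modB S))

/-- The levels for the first factor. -/
def levelsA : TExpr :=
  yatesLevel S.α (2 ^ q * 2 ^ q) R 5 (depthB q) (levelLen q) (modulus S) (powSq q) (.arr 2)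
    fun l => powBase S (expA (blockB q) 1 (.arr 3 l) (.arr 4 l))

/-- The levels for the second factor. -/
def levelsB : TExpr :=
  yatesLevel S.β (2 ^ q * 2 ^ q) R 6 (depthB q) (levelLen q) (modulus S) (powSq q) (.arr 2)
    fun l => powBase S (expB (blockB q) 1 (.arr 3 l) (.arr 4 l))

/-- The levels for the product. -/
def levelsC : TExpr :=
  yatesLevel (fun l r => S.γ r l) R (2 ^ q * 2 ^ q) 7 (depthB q) (levelLen q) (modulus S) (.arr 2)
    (powSq q) fun r => .mod (.mul (lastLevel q 5 r) (lastLevel q 6 r)) (modulus S)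

/-- The exponent of a minimum cut whose size is given by `w`. -/
def shifted (w : TExpr) : TExpr := .add w (.mul (.ofBound bigB) (.ofBound halfB))

/-- The minimum size of a cut for the pair of sets given by variable `0`. -/
def cutVal : TExpr :=
  .find 1 bigB (.lt (.const 0) (.mod (.div (.mul (lastLevel q 7 (.var 0))
    (powBase S (expC (blockB q) 2 (.arr 3 (.var 0)) (.arr 4 (.var 0)))))
    (powBase S (shifted (.var 1)))) (powBase S (.const 1))))

/-- The minimum of all cuts up to the index in variable `0`. -/
def bestVal (q : ℕ) : TExpr :=
  let p := .arr 9 (.sub (.var 0) (.const 1))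
  .ite (.eq (.var 0) (.const 0)) (.mul (.arr 8 (.const 0)) (numPairs q))
    (.sub p (.sub p (.add (.mul (.arr 8 (.var 0)) (numPairs q)) (.var 0))))

/-- The minimum of all cuts. -/
def minVal (q : ℕ) : TExpr := .arr 9 (.sub (numPairs q) (.const 1))

/-- The set in the first block. -/
def firstSet (q : ℕ) : TExpr := .arr 3 (.mod (minVal q) (numPairs q))

/-- The set in the last block. -/
def thirdSet (q : ℕ) : TExpr := .arr 4 (.mod (minVal q) (numPairs q))

/-- The largest set in the second block up to variable `0` that gives a minimum cut. -/
def lastVal (q : ℕ) : TExpr :=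
  .ite (.eq (.var 0) (.const 0)) (.const 0)
    (.ite (.eq (.add (.add (expA (blockB q) 1 (firstSet q) (.var 0))
      (expB (blockB q) 1 (.var 0) (thirdSet q))) (expC (blockB q) 1 (firstSet q) (thirdSet q)))
      (shifted (.div (minVal q) (numPairs q)))) (.var 0) (.arr 10 (.sub (.var 0) (.const 1))))

/-- The indicator function of the minimum cut. -/
def cutInd (q : ℕ) : TExpr :=
  member (blockB q) (firstSet q)
    (.arr 10 (.sub (.arr 1 (.ofBound (blockB q))) (.const 1))) (thirdSet q) (.var 0)

/-- Membership in the minimum cut. -/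
def inside (e : TExpr) : TExpr := .arr 11 e

/-- Membership in the complement of the minimum cut. -/
def outside (e : TExpr) : TExpr := .sub (.const 1) (.arr 11 e)

/-- The positions of the vertices. -/
def outPos : TExpr :=
  .ite (inside (.var 0)) (.arr 15 (rank inside 1 (.var 0)))
    (.add (.ofBound halfB) (.arr 19 (rank outside 1 (.var 0))))

/-- The expression for the entries of each table. -/
def entry : ℕ → TExpr
  | 1 => geom 1 2
  | 2 => geom 2 R
  | 3 => digits 3 (2 ^ q * 2 ^ q) (2 ^ q)
      (.div (.mod (.var 0) (.const (2 ^ q * 2 ^ q))) (.const (2 ^ q)))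
  | 4 => digits 4 (2 ^ q * 2 ^ q) (2 ^ q)
      (.mod (.mod (.var 0) (.const (2 ^ q * 2 ^ q))) (.const (2 ^ q)))
  | 5 => levelsA S
  | 6 => levelsB S
  | 7 => levelsC S
  | 8 => cutVal S
  | 9 => bestVal q
  | 10 => lastVal q
  | 11 => cutInd q
  | 12 => elem inside
  | 13 => opt 12 halfB
  | 14 => chain 12 halfB
  | 15 => pos 12 halfB
  | 16 => elem outside
  | 17 => opt 16 halfB'
  | 18 => chain 16 halfB'
  | 19 => pos 16 halfB'
  | _ => outPos

/-- The expression for the size of each table. -/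
def size : ℕ → TExpr
  | 1 => .ofBound (powB S)
  | 2 => .add (.ofBound (depthB q)) (.const 1)
  | 3 | 4 | 8 | 9 => numPairs q
  | 5 | 6 | 7 => .mul (.add (.ofBound (depthB q)) (.const 1)) (levelLen q)
  | 10 => .arr 1 (.ofBound (blockB q))
  | 12 | 15 => .ofBound halfB
  | 13 => .arr 1 (.ofBound halfB)
  | 14 => .add (.ofBound halfB) (.const 1)
  | 16 | 19 => .ofBound halfB'
  | 17 => .arr 1 (.ofBound halfB')
  | 18 => .add (.ofBound halfB') (.const 1)
  | _ => .ofBound .n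

end TExpr

end Expressions

/-! ### Contents and lengths of the twenty tables -/

section Tables

variable {n : ℕ} (G : Digraph (Fin n)) {q R : ℕ} (S : BilinearAlgorithm (2 ^ q) R)

/-- The minimum cut that the tables determine. -/
noncomputable def minCut (q : ℕ) : Finset (Fin n) :=
  cutSet G (2 ^ q) (blockLen q n) ((2 ^ q * 2 ^ q) ^ depth q n)

/-- The contents of the tables. -/
noncomputable def content : ℕ → ℕ → ℕ
  | 1 => fun i => 2 ^ i
  | 2 => fun i => R ^ i
  | 3 => rowIdx (2 ^ q)
  | 4 => colIdx (2 ^ q)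
  | 5 => levelsA G S
  | 6 => levelsB G S
  | 7 => levelsC G S
  | 8 => cutVal G (2 ^ q) (blockLen q n)
  | 9 => bestVal G (2 ^ q) (blockLen q n) ((2 ^ q * 2 ^ q) ^ depth q n)
  | 10 => lastVal G (2 ^ q) (blockLen q n) ((2 ^ q * 2 ^ q) ^ depth q n)
  | 11 => ind (minCut G q)
  | 12 => elemOf (minCut G q)
  | 13 => optOf G (minCut G q)
  | 14 => chainOf G (minCut G q)
  | 15 => posOf G (minCut G q)
  | 16 => elemOf (minCut G q)ᶜ
  | 17 => optOf G (minCut G q)ᶜ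
  | 18 => chainOf G (minCut G q)ᶜ
  | 19 => posOf G (minCut G q)ᶜ
  | 20 => outPos G (minCut G q)
  | _ => fun _ => 0

/-- The sizes of the tables. -/
def tableLen (n : ℕ) : ℕ → ℕ
  | 1 => powLen S n
  | 2 => depth q n + 1
  | 3 | 4 | 8 | 9 => (2 ^ q * 2 ^ q) ^ depth q n
  | 5 | 6 | 7 => (depth q n + 1) * R ^ depth q n
  | 10 => 2 ^ blockLen q n
  | 11 | 20 => n
  | 12 | 15 => n / 2
  | 13 => 2 ^ (n / 2)
  | 14 => n / 2 + 1
  | 16 | 19 => (n + 1) / 2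
  | 17 => 2 ^ ((n + 1) / 2)
  | 18 => (n + 1) / 2 + 1
  | _ => 0

end Tables

/-! ### The expressions compute the contents of the tables -/

section Values

variable {n : ℕ} {G : Digraph (Fin n)} {q R : ℕ} {S : BilinearAlgorithm (2 ^ q) R} {A : State}
  {vs : List ℕ} {e f : TExpr} {i j : ℕ}

theorem HasValue.bound {B : Bound} {b : ℕ} (h : B.val n = b) :
    HasValue (graphInput G) A vs (.ofBound B) b :=
  (HasValue.ofBound B).congr (by rw [graphInput_zero, h])

theorem depth_le_powLen : 2 * q * depth q n < powLen S n := by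
  rw [powLen, mul_assoc]
  change 2 * blockLen q n < _
  omega

section Powers

variable (h1 : ∀ u < powLen S n, A 1 u = 2 ^ u)

include h1

theorem HasValue.powSq (hi : i ≤ depth q n) (he : HasValue (graphInput G) A vs e i) :
    HasValue (graphInput G) A vs (.powSq q e) ((2 ^ q * 2 ^ q) ^ i) := by
  refine .arr one_ne_zero ((HasValue.const _).mul he) ?_
  rw [two_pow_mul_pow]
  exact h1 _ ((Nat.mul_le_mul_left _ hi).trans_lt depth_le_powLen)

theorem HasValue.numPairs : HasValue (graphInput G) A vs (.numPairs q)
    ((2 ^ q * 2 ^ q) ^ depth q n) :=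
  HasValue.powSq h1 le_rfl (.bound rfl)

theorem HasValue.modulus : HasValue (graphInput G) A vs (.modulus S) (2 ^ modBits S n) :=
  .arr one_ne_zero (.bound (val_modB S n)) (h1 _ (by rw [powLen]; omega))

theorem HasValue.powBase (hi : i ≤ topExp q n) (he : HasValue (graphInput G) A vs e i) :
    HasValue (graphInput G) A vs (.powBase S e) ((2 ^ baseBits S n) ^ i) := by
  refine .arr one_ne_zero ((HasValue.bound (val_baseB S n)).mul he) ?_
  rw [← pow_mul]
  refine h1 _ ?_
  have := Nat.mul_le_mul_left (baseBits S n) (Nat.le_succ_of_le hi)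
  rw [powLen, modBits]
  simp only [Nat.succ_eq_add_one] at this
  omega

theorem hasPowers {w : ℕ} (hw : w < 3 * blockLen q n) : A 1 w = 2 ^ w :=
  h1 w (by rw [powLen]; omega)

end Powers

theorem HasValue.row (h3 : ∀ j < i, A 3 j = rowIdx (2 ^ q) j) (hq : 0 < q) :
    HasValue (graphInput G) A [i] (.digits 3 (2 ^ q * 2 ^ q) (2 ^ q)
      (.div (.mod (.var 0) (.const (2 ^ q * 2 ^ q))) (.const (2 ^ q)))) (rowIdx (2 ^ q) i) := by
  have hk : 1 < 2 ^ q := Nat.one_lt_two_pow hq.ne'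
  exact HasValue.digits (g := (· / 2 ^ q)) (Nat.one_lt_mul_iff.2 ⟨by omega, by omega, .inl hk⟩)
    (Nat.zero_div _) (by norm_num) h3 ((HasValue.index.mod (.const _)).div (.const _))

theorem HasValue.col (h4 : ∀ j < i, A 4 j = colIdx (2 ^ q) j) (hq : 0 < q) :
    HasValue (graphInput G) A [i] (.digits 4 (2 ^ q * 2 ^ q) (2 ^ q)
      (.mod (.mod (.var 0) (.const (2 ^ q * 2 ^ q))) (.const (2 ^ q)))) (colIdx (2 ^ q) i) := by
  have hk : 1 < 2 ^ q := Nat.one_lt_two_pow hq.ne'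
  exact HasValue.digits (g := (· % 2 ^ q)) (Nat.one_lt_mul_iff.2 ⟨by omega, by omega, .inl hk⟩)
    (Nat.zero_mod _) (by norm_num) h4 ((HasValue.index.mod (.const _)).mod (.const _))

/-! ### Tables for the matrix product and the minimum cut -/

section Levels

variable (h1 : ∀ u < powLen S n, A 1 u = 2 ^ u) (h2 : ∀ u < depth q n + 1, A 2 u = R ^ u)
  (h3 : ∀ u < (2 ^ q * 2 ^ q) ^ depth q n, A 3 u = rowIdx (2 ^ q) u)
  (h4 : ∀ u < (2 ^ q * 2 ^ q) ^ depth q n, A 4 u = colIdx (2 ^ q) u)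

include h2 in
theorem HasValue.levelLen :
    HasValue (graphInput G) A vs (.levelLen q) (R ^ depth q n) :=
  .arr two_ne_zero (.bound rfl) (h2 _ (Nat.lt_succ_self _))

theorem pow_mul_pow_le {a b d s : ℕ} (hab : a ≤ b) (hs : s ≤ d) :
    a ^ (d - s) * b ^ s ≤ b ^ d := by
  calc _ ≤ b ^ (d - s) * b ^ s := Nat.mul_le_mul_right _ (Nat.pow_le_pow_left hab _)
    _ = b ^ d := by rw [← pow_add, Nat.sub_add_cancel hs]

theorem pow_mul_pow_le' {a b d s : ℕ} (hab : a ≤ b) (hs : s ≤ d) :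
    b ^ (d - s) * a ^ s ≤ b ^ d := by
  calc _ ≤ b ^ (d - s) * b ^ s := Nat.mul_le_mul_left _ (Nat.pow_le_pow_left hab _)
    _ = b ^ d := by rw [← pow_add, Nat.sub_add_cancel hs]

theorem exponents_le {x y : ℕ} (hx : x < (2 ^ q) ^ depth q n)
    (hy : y < (2 ^ q) ^ depth q n) (z : ℕ) :
    expA G (blockLen q n) x y + expB G (blockLen q n) y z + expC G (blockLen q n) x z ≤
      topExp q n := by
  rw [two_pow_pow_depth] at hx hy
  exact (expA_add_expB_le G hx hy).le

theorem expB_le {y : ℕ} (hy : y < (2 ^ q) ^ depth q n) (z : ℕ) :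
    expB G (blockLen q n) y z ≤ topExp q n := by
  have := exponents_le (G := G) (x := 0) (by positivity) hy z
  omega

theorem residue_power {a : ℕ} (ha : a ≤ topExp q n) :
    residue (2 ^ modBits S n) (((2 ^ baseBits S n) ^ a : ℕ) : ℤ) = (2 ^ baseBits S n) ^ a := by
  refine residue_natCast ?_
  rw [two_pow_modBits]
  exact Nat.pow_lt_pow_right (Nat.one_lt_two_pow (Nat.succ_ne_zero _)) (by omega)

include h1 h2 h3 h4 in
theorem HasValue.levelsA (hq : 0 < q) (hR : 2 ^ q * 2 ^ q ≤ R)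
    (hi : i < (depth q n + 1) * R ^ depth q n)
    (h5 : ∀ u < i, A 5 u = DirCutwidth.levelsA G S u) :
    HasValue (graphInput G) A [i] (.levelsA S) (DirCutwidth.levelsA G S i) := by
  have hk : 1 < 2 ^ q := Nat.one_lt_two_pow hq.ne'
  have hR0 : 0 < R := lt_of_lt_of_le (by positivity) hR
  refine HasValue.yatesLevel S.α (by norm_num) (by rw [graphInput_zero]; rfl) hR0 (by positivity)
    (fun s hs => pow_mul_pow_le hR hs) hi (.levelLen h2) (.modulus h1)
    (fun vs e s hs he => .powSq h1 hs he)
    (fun vs e s hs he => .arr two_ne_zero he (h2 _ (by omega))) (fun e l hl he => ?_) h5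
  have hle := (exponents_le (G := G) (idx_lt hk hl).1 (idx_lt hk hl).2 0)
  rw [factorA, residue_power (by omega)]
  exact .powBase h1 (by omega) (.expA (by rw [graphInput_zero]; rfl) (fun w hw => hasPowers h1 hw)
    (le_three_mul_blockLen hq n) rfl (.arr (by norm_num) he (h3 l hl))
    (.arr (by norm_num) he (h4 l hl)))

include h1 h2 h3 h4 in
theorem HasValue.levelsB (hq : 0 < q) (hR : 2 ^ q * 2 ^ q ≤ R)
    (hi : i < (depth q n + 1) * R ^ depth q n)
    (h6 : ∀ u < i, A 6 u = DirCutwidth.levelsB G S u) :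
    HasValue (graphInput G) A [i] (.levelsB S) (DirCutwidth.levelsB G S i) := by
  have hk : 1 < 2 ^ q := Nat.one_lt_two_pow hq.ne'
  have hR0 : 0 < R := lt_of_lt_of_le (by positivity) hR
  refine HasValue.yatesLevel S.β (by norm_num) (by rw [graphInput_zero]; rfl) hR0 (by positivity)
    (fun s hs => pow_mul_pow_le hR hs) hi (.levelLen h2) (.modulus h1)
    (fun vs e s hs he => .powSq h1 hs he)
    (fun vs e s hs he => .arr two_ne_zero he (h2 _ (by omega))) (fun e l hl he => ?_) h6
  have hle := expB_le (G := G) (idx_lt hk hl).1 (colIdx (2 ^ q) l)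
  rw [factorB, residue_power hle]
  exact .powBase h1 hle (.expB (by rw [graphInput_zero]; rfl) (fun w hw => hasPowers h1 hw)
    (le_three_mul_blockLen hq n) rfl (.arr (by norm_num) he (h3 l hl))
    (.arr (by norm_num) he (h4 l hl)))

variable (h5 : ∀ u < (depth q n + 1) * R ^ depth q n, A 5 u = DirCutwidth.levelsA G S u)
  (h6 : ∀ u < (depth q n + 1) * R ^ depth q n, A 6 u = DirCutwidth.levelsB G S u)
  (h7 : ∀ u < (depth q n + 1) * R ^ depth q n, A 7 u = DirCutwidth.levelsC G S u)

include h2 in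
theorem HasValue.lastLevel {f : ℕ → ℕ → ℤ} {a b t l : ℕ} {x : ℕ → ℤ} (ht : t ≠ 0)
    (hA : ∀ u < (depth q n + 1) * R ^ depth q n, A t u =
      yatesTable f a b (depth q n) (R ^ depth q n) (2 ^ modBits S n) x u)
    (hb : b ^ depth q n ≤ R ^ depth q n) (hl : l < b ^ depth q n)
    (he : HasValue (graphInput G) A vs e l) : HasValue (graphInput G) A vs (.lastLevel q t e)
      (residue (2 ^ modBits S n) (yates f a b (depth q n) x (depth q n) l)) := by
  refine .arr ht (((HasValue.bound (val_depthB q n)).mul (.levelLen h2)).add he) ?_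
  have h := yatesTable_level f (M := 2 ^ modBits S n) x (d := depth q n) (s := depth q n) (l := l)
    (a := a) (b := b) (len := R ^ depth q n) (by simpa using hl) (by simpa using hb)
  rw [← h]
  refine hA _ ?_
  rw [Nat.succ_mul]
  omega

include h1 h2 h5 h6 in
theorem HasValue.levelsC (hR : 2 ^ q * 2 ^ q ≤ R)
    (hi : i < (depth q n + 1) * R ^ depth q n)
    (h7 : ∀ u < i, A 7 u = DirCutwidth.levelsC G S u) :
    HasValue (graphInput G) A [i] (.levelsC S) (DirCutwidth.levelsC G S i) := by
  refine HasValue.yatesLevel (fun l r => S.γ r l) (by norm_num) (by rw [graphInput_zero]; rfl)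
    (by positivity) (by positivity)
    (fun s hs => pow_mul_pow_le' hR hs) hi (.levelLen h2) (.modulus h1)
    (fun vs e s hs he => .arr two_ne_zero he (h2 _ (by omega)))
    (fun vs e s hs he => .powSq h1 hs he) (fun e l hl he => ?_) h7
  refine (((HasValue.lastLevel h2 (by norm_num) h5 le_rfl hl he).mul
    (HasValue.lastLevel h2 (by norm_num) h6 le_rfl hl he)).mod (.modulus h1)).congr
    (mod_eq_residue (by positivity) ?_)
  rw [Nat.cast_mul]
  exact Int.ModEq.mul (residue_modEq (by positivity) _) (residue_modEq (by positivity) _)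

theorem HasValue.shifted {w : ℕ} (he : HasValue (graphInput G) A vs e w) :
    HasValue (graphInput G) A vs (.shifted e) (w + (n * n + 1) * (n / 2)) :=
  he.add ((HasValue.bound (val_bigB n)).mul (.bound rfl))

include h1 h2 h3 h4 h7 in
-- The definition asks for some `y` among `2 ^ h` sets; the expression looks at a single digit of a
-- single entry of the product instead. This is where the exponential gain of matrix multiplication
-- enters.
theorem HasValue.cutVal (hq : 0 < q) (hR : 2 ^ q * 2 ^ q ≤ R)
    (hi : i < (2 ^ q * 2 ^ q) ^ depth q n) :
    HasValue (graphInput G) A [i] (.cutVal S)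
      (DirCutwidth.cutVal G (2 ^ q) (blockLen q n) i) := by
  have hk : 1 < 2 ^ q := Nat.one_lt_two_pow hq.ne'
  refine HasValue.find (by rw [graphInput_zero]; rfl) rfl fun w hw => ?_
  have h0 : HasValue (graphInput G) A ([i] ++ [w]) (.var 0) i := HasValue.index.weaken [w]
  have hle := exponents_le (G := G) (idx_lt hk hi).1 (y := 0) (by positivity)
    (colIdx (2 ^ q) i)
  -- The power of the base used to extract the digit must be in the table of powers of two, which
  -- covers exponents of the base up to `topExp`.
  have htop : w + (n * n + 1) * (n / 2) ≤ topExp q n := by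
    rw [topExp, Nat.mul_succ]
    have h3 : n / 2 ≤ 3 * blockLen q n * (n + 1) :=
      (Nat.div_le_self n 2).trans ((le_three_mul_blockLen hq n).trans
        (Nat.le_mul_of_pos_right _ (Nat.succ_pos _)))
    have h4 := Nat.mul_le_mul_left (n * n + 1) h3
    omega
  have hC : HasValue (graphInput G) A ([i] ++ [w]) (.lastLevel q 7 (.var 0))
      (residue (2 ^ modBits S n) (S.product (depth q n) (factorA G S) (factorB G S) i)) :=
    HasValue.lastLevel h2 (by norm_num) h7 (Nat.pow_le_pow_left hR _) hi h0
  have hX := HasValue.powBase (S := S) (G := G) (vs := [i] ++ [w]) h1 (i := 1)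
    ((Nat.succ_le_of_lt (Nat.zero_lt_of_lt (sq_lt_topExp q n)))) (.const 1)
  rw [pow_one] at hX
  have hE := HasValue.powBase (S := S) h1 (show DirCutwidth.expC G (blockLen q n) (rowIdx (2 ^ q) i)
    (colIdx (2 ^ q) i) ≤ topExp q n by omega)
    (.expC (B := blockB q) (b := 2) (by rw [graphInput_zero]; rfl)
      (fun w hw => hasPowers h1 hw) (le_three_mul_blockLen hq n) rfl
      (.arr (by norm_num) h0 (h3 i hi)) (.arr (by norm_num) h0 (h4 i hi)))
  refine ((HasValue.const 0).lt (((hC.mul hE).div (.powBase h1 htop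
    (.shifted (.last rfl)))).mod hX)).congr (if_congr ?_ rfl rfl)
  rw [Nat.pos_iff_ne_zero, ← two_pow_pow_depth]
  refine S.digit_product_ne_zero_iff hk (DirCutwidth.expA G (blockLen q n))
    (DirCutwidth.expB G (blockLen q n))
    ?_ (two_pow_modBits S n) (fun x hx y hy z => ?_) hi _ _
  · rw [two_pow_pow_depth]
    exact base_bound S n
  · have := exponents_le (G := G) hx hy z
    omega

variable (h8 : ∀ u < (2 ^ q * 2 ^ q) ^ depth q n, A 8 u = DirCutwidth.cutVal G (2 ^ q) (blockLen q n) u)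
  (h9 : ∀ u < (2 ^ q * 2 ^ q) ^ depth q n, A 9 u =
    DirCutwidth.bestVal G (2 ^ q) (blockLen q n) ((2 ^ q * 2 ^ q) ^ depth q n) u)
  (h10 : ∀ u < 2 ^ blockLen q n, A 10 u =
    DirCutwidth.lastVal G (2 ^ q) (blockLen q n) ((2 ^ q * 2 ^ q) ^ depth q n) u)

include h1 h8 in
theorem HasValue.bestVal (hi : i < (2 ^ q * 2 ^ q) ^ depth q n)
    (h9 : ∀ u < i, A 9 u = DirCutwidth.bestVal G (2 ^ q) (blockLen q n)
      ((2 ^ q * 2 ^ q) ^ depth q n) u) :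
    HasValue (graphInput G) A [i] (.bestVal q)
      (DirCutwidth.bestVal G (2 ^ q) (blockLen q n) ((2 ^ q * 2 ^ q) ^ depth q n) i) := by
  refine ((HasValue.index.eq (.const 0)).ite
    (v := DirCutwidth.bestVal G (2 ^ q) (blockLen q n) ((2 ^ q * 2 ^ q) ^ depth q n) 0)
    (w := DirCutwidth.bestVal G (2 ^ q) (blockLen q n) ((2 ^ q * 2 ^ q) ^ depth q n) i)
    (fun h => ?_) fun h => ?_).congr ?_
  · exact (HasValue.arr (by norm_num) (.const 0) (h8 0 (by omega))).mul (.numPairs h1)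
  · obtain ⟨j, rfl⟩ := Nat.exists_eq_succ_of_ne_zero h
    have hp : HasValue (graphInput G) A [j + 1] (.arr 9 (.sub (.var 0) (.const 1))) _ :=
      .arr (by norm_num) (HasValue.index.sub (.const 1)) (h9 j (Nat.lt_succ_self j))
    refine (hp.sub (hp.sub (((HasValue.arr (by norm_num) .index (h8 _ hi)).mul
      (.numPairs h1)).add .index))).congr ?_
    -- With truncated subtraction `p - (p - x)` is the minimum of `p` and `x`.
    rw [Nat.sub_sub_eq_min]
    rfl
  · split_ifs with h
    · rw [h]
    · rfl

include h1 h9 in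
theorem HasValue.minVal : HasValue (graphInput G) A vs (.minVal q)
    (DirCutwidth.bestVal G (2 ^ q) (blockLen q n) ((2 ^ q * 2 ^ q) ^ depth q n)
      ((2 ^ q * 2 ^ q) ^ depth q n - 1)) :=
  .arr (by norm_num) ((HasValue.numPairs h1).sub (.const 1))
    (h9 _ (Nat.sub_lt (by positivity) one_pos))

include h1 h3 h9 in
theorem HasValue.firstSet : HasValue (graphInput G) A vs (.firstSet q)
    (rowIdx (2 ^ q) (DirCutwidth.bestVal G (2 ^ q) (blockLen q n) ((2 ^ q * 2 ^ q) ^ depth q n)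
      ((2 ^ q * 2 ^ q) ^ depth q n - 1) % (2 ^ q * 2 ^ q) ^ depth q n)) :=
  .arr (by norm_num) ((HasValue.minVal h1 h9).mod (.numPairs h1))
    (h3 _ (Nat.mod_lt _ (by positivity)))

include h1 h4 h9 in
theorem HasValue.thirdSet : HasValue (graphInput G) A vs (.thirdSet q)
    (colIdx (2 ^ q) (DirCutwidth.bestVal G (2 ^ q) (blockLen q n) ((2 ^ q * 2 ^ q) ^ depth q n)
      ((2 ^ q * 2 ^ q) ^ depth q n - 1) % (2 ^ q * 2 ^ q) ^ depth q n)) :=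
  .arr (by norm_num) ((HasValue.minVal h1 h9).mod (.numPairs h1))
    (h4 _ (Nat.mod_lt _ (by positivity)))

include h1 h3 h4 h9 in
theorem HasValue.lastVal (hq : 0 < q)
    (h10 : ∀ u < i, A 10 u =
      DirCutwidth.lastVal G (2 ^ q) (blockLen q n) ((2 ^ q * 2 ^ q) ^ depth q n) u) :
    HasValue (graphInput G) A [i] (.lastVal q)
      (DirCutwidth.lastVal G (2 ^ q) (blockLen q n) ((2 ^ q * 2 ^ q) ^ depth q n) i) := by
  have hn := le_three_mul_blockLen hq n
  have hB : (blockB q).val (graphInput G 0) = blockLen q n := by rw [graphInput_zero]; rfl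
  have hx := HasValue.firstSet (vs := [i]) h1 h3 h9
  have hz := HasValue.thirdSet (vs := [i]) h1 h4 h9
  have hw : ∀ w < 3 * blockLen q n, A 1 w = 2 ^ w := fun w hw => hasPowers h1 hw
  refine ((HasValue.index.eq (.const 0)).ite (v := 0)
    (w := DirCutwidth.lastVal G (2 ^ q) (blockLen q n) ((2 ^ q * 2 ^ q) ^ depth q n) i)
    (fun h => .const 0) fun h => ?_).congr ?_
  · refine ((((HasValue.expA hB hw hn rfl hx .index).add (.expB hB hw hn rfl .index hz)).add
      (.expC hB hw hn rfl hx hz)).eq (.shifted ((HasValue.minVal h1 h9).div (.numPairs h1)))).ite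
      (fun _ => .index) (fun _ => .arr (by norm_num) (HasValue.index.sub (.const 1))
        (h10 _ (by omega))) |>.congr ?_
    obtain ⟨j, rfl⟩ := Nat.exists_eq_succ_of_ne_zero h
    rfl
  · split_ifs with h
    · rw [h]; rfl
    · rfl

include h1 h3 h4 h9 h10 in
theorem HasValue.cutInd (hi : i < n) :
    HasValue (graphInput G) A [i] (.cutInd q) (ind (minCut G q) i) := by
  have hB : (blockB q).val (graphInput G 0) = blockLen q n := by rw [graphInput_zero]; rfl
  refine (HasValue.member hB (fun w hw => h1 w (by rw [powLen]; omega)) (.firstSet h1 h3 h9)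
    (.arr (by norm_num) ((HasValue.arr one_ne_zero (.bound (val_blockB q n))
      (h1 _ (by rw [powLen]; omega))).sub (.const 1))
      (h10 _ (Nat.sub_lt (by positivity) one_pos))) (.thirdSet h1 h4 h9) .index).congr ?_
  rw [ind]
  refine if_congr ?_ rfl rfl
  rw [minCut, cutSet, blockSet]
  simp [hi]

end Levels

/-! ### The two sides of the cut and the output table -/

section Sides

variable {L : Finset (Fin n)} (h11 : ∀ u < n, A 11 u = ind L u)

include h11

theorem HasValue.inside (vs : List ℕ) (e : TExpr) (v : ℕ) (hv : v < n)
    (he : HasValue (graphInput G) A vs e v) :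
    HasValue (graphInput G) A vs (.inside e) (ind L v) :=
  .arr (by norm_num) he (h11 v hv)

theorem HasValue.outside (vs : List ℕ) (e : TExpr) (v : ℕ) (hv : v < n)
    (he : HasValue (graphInput G) A vs e v) :
    HasValue (graphInput G) A vs (.outside e) (ind Lᶜ v) := by
  refine ((HasValue.const 1).sub (.arr (by norm_num) he (h11 v hv))).congr ?_
  simp only [ind, hv, exists_true_left, Finset.mem_compl]
  split_ifs <;> simp_all

theorem HasValue.outPos (hL : L.card = n / 2) (hL' : Lᶜ.card = (n + 1) / 2) (hi : i < n)
    (h15 : ∀ u < n / 2, A 15 u = posOf G L u)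
    (h19 : ∀ u < (n + 1) / 2, A 19 u = posOf G Lᶜ u) :
    HasValue (graphInput G) A [i] .outPos (DirCutwidth.outPos G L i) := by
  have hin := HasValue.inside (G := G) h11 _ _ i hi .index
  have hval : ind L i = if (⟨i, hi⟩ : Fin n) ∈ L then 1 else 0 := by simp [ind, hi]
  rw [DirCutwidth.outPos]
  refine (hin.congr ?_).ite (fun h => ?_) fun h => ?_
  · rw [hval]; split_ifs <;> simp_all
  · have hmem : (⟨i, hi⟩ : Fin n) ∈ L := by
      by_contra hno
      rw [hval, if_neg hno] at h
      exact zero_ne_one h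
    exact .arr (by norm_num) (.rank (HasValue.inside h11) rfl .index)
      (h15 _ (hL ▸ rankOf_lt_card L hmem))
  · have hmem : (⟨i, hi⟩ : Fin n) ∈ Lᶜ := by
      rw [Finset.mem_compl]
      intro hno
      rw [hval, if_pos hno] at h
      exact h rfl
    exact (HasValue.bound rfl).add (.arr (by norm_num) (.rank (HasValue.outside h11) rfl .index)
      (h19 _ (hL' ▸ rankOf_lt_card Lᶜ hmem)))

end Sides

end Values

theorem computes_map {I : Mem} {sz : ℕ → ℕ} {F : ℕ → ℕ → ℕ} (N e : ℕ → TExpr) (k : ℕ) :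
    ∀ a, (∀ b, a ≤ b → b < a + k → ∀ τ : State,
      (∀ c, 0 < c → c < b → ∀ i < sz c, τ c i = F c i) → (N b).eval I τ = sz b ∧
        ∀ i < sz b, (∀ j < i, τ b j = F b j) → τ 0 0 = i → (e b).eval I τ = F b i) →
      Computes I sz F a ((List.range' a k).map fun b => (N b, e b)) := by
  induction k with
  | zero => exact fun a _ => trivial
  | succ k ih =>
    exact fun a h => ⟨h a le_rfl (by omega), ih (a + 1) fun b h1 h2 => h b (by omega) (by omega)⟩

/-! ### The list of tables as a whole -/

section Program

variable {n : ℕ} (G : Digraph (Fin n)) {q R : ℕ} (S : BilinearAlgorithm (2 ^ q) R)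

/-- The tables of the algorithm. -/
def tables : List (TExpr × TExpr) :=
  (List.range' 1 20).map fun b => (TExpr.size S b, TExpr.entry S b)

theorem isMinCut_minCut (hq : 0 < q) : IsMinCut G (n / 2) (minCut G q) :=
  isMinCut_cutSet G (Nat.one_lt_two_pow hq.ne') (two_pow_pow_depth q n)
    (le_three_mul_blockLen hq n)

theorem card_minCut (hq : 0 < q) : (minCut G q).card = n / 2 := (isMinCut_minCut G hq).1

theorem card_compl_minCut (hq : 0 < q) : (minCut G q)ᶜ.card = (n + 1) / 2 := by
  rw [Finset.card_compl, card_minCut G hq, Fintype.card_fin]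
  omega

/-- The tables are ordered by dependency: powers, index maps, transforms, cuts, then the dynamic
programs of both sides. Each equation thus uses only entries that are already known, including the
lengths of exponentially long tables, which are read from the tables of powers. -/
theorem computes_content (hq : 0 < q) (hR : 2 ^ q * 2 ^ q ≤ R) :
    Computes (graphInput G) (tableLen S n) (content G S) 1 (tables S) := by
  refine computes_map _ _ 20 1 fun b hb hb' τ hτ => ?_
  have h1 : 1 < b → ∀ u < powLen S n, τ 1 u = 2 ^ u := hτ 1 (by norm_num)
  have h2 : 2 < b → ∀ u < depth q n + 1, τ 2 u = R ^ u := hτ 2 (by norm_num)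
  have h3 : 3 < b → ∀ u < (2 ^ q * 2 ^ q) ^ depth q n, τ 3 u = rowIdx (2 ^ q) u :=
    hτ 3 (by norm_num)
  have h4 : 4 < b → ∀ u < (2 ^ q * 2 ^ q) ^ depth q n, τ 4 u = colIdx (2 ^ q) u :=
    hτ 4 (by norm_num)
  have h9 : 9 < b → ∀ u < (2 ^ q * 2 ^ q) ^ depth q n, τ 9 u =
    bestVal G (2 ^ q) (blockLen q n) ((2 ^ q * 2 ^ q) ^ depth q n) u := hτ 9 (by norm_num)
  have h11 : 11 < b → ∀ u < n, τ 11 u = ind (minCut G q) u := hτ 11 (by norm_num)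
  have hL := card_minCut G hq
  have hL' := card_compl_minCut G hq
  have hm : halfB.val (graphInput G 0) = (minCut G q).card := by
    rw [graphInput_zero, hL]; rfl
  have hm' : halfB'.val (graphInput G 0) = (minCut G q)ᶜ.card := by
    rw [graphInput_zero, hL']; rfl
  have hlt : n < powLen S n := by rw [powLen]; omega
  have hp : 1 < b → ∀ u < (minCut G q).card, τ 1 u = 2 ^ u := fun h u hu => h1 h u (by omega)
  have hp' : 1 < b → ∀ u < (minCut G q)ᶜ.card, τ 1 u = 2 ^ u := fun h u hu => h1 h u (by omega)
  have hc : 1 < b → τ 1 (minCut G q).card = 2 ^ (minCut G q).card := fun h => h1 h _ (by omega)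
  have hc' : 1 < b → τ 1 (minCut G q)ᶜ.card = 2 ^ (minCut G q)ᶜ.card :=
    fun h => h1 h _ (by omega)
  have h12 : 12 < b → ∀ u < (minCut G q).card, τ 12 u = elemOf (minCut G q) u :=
    fun h u hu => hτ 12 (by norm_num) h u (by rwa [hL] at hu)
  have h13 : 13 < b → ∀ u < 2 ^ (minCut G q).card, τ 13 u = optOf G (minCut G q) u :=
    fun h u hu => hτ 13 (by norm_num) h u (by rwa [hL] at hu)
  have h16 : 16 < b → ∀ u < (minCut G q)ᶜ.card, τ 16 u = elemOf (minCut G q)ᶜ u :=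
    fun h u hu => hτ 16 (by norm_num) h u (by rwa [hL'] at hu)
  have h17 : 17 < b → ∀ u < 2 ^ (minCut G q)ᶜ.card, τ 17 u = optOf G (minCut G q)ᶜ u :=
    fun h u hu => hτ 17 (by norm_num) h u (by rwa [hL'] at hu)
  have hpairs : 1 < b → (TExpr.numPairs q).eval (graphInput G) τ =
    (2 ^ q * 2 ^ q) ^ depth q n := fun h => (HasValue.numPairs (h1 h)).eval_eq_nil
  have hlevel : 2 < b → (TExpr.mul (.add (.ofBound (depthB q)) (.const 1)) (.levelLen q)).eval
    (graphInput G) τ = (depth q n + 1) * R ^ depth q n := fun h =>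
    (((HasValue.bound (val_depthB q n)).add (.const 1)).mul (.levelLen (h2 h))).eval_eq_nil
  have hhalf : (TExpr.ofBound halfB).eval (graphInput G) τ = n / 2 :=
    (HasValue.bound (b := n / 2) rfl).eval_eq_nil
  have hhalf' : (TExpr.ofBound halfB').eval (graphInput G) τ = (n + 1) / 2 :=
    (HasValue.bound (b := (n + 1) / 2) rfl).eval_eq_nil
  interval_cases b
  · exact ⟨(HasValue.bound (val_powB S n)).eval_eq_nil,
      fun i hi hj h0 => (HasValue.geom (by norm_num) hj).eval_eq h0⟩
  · exact ⟨((HasValue.bound (val_depthB q n)).add (.const 1)).eval_eq_nil,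
      fun i hi hj h0 => (HasValue.geom (by norm_num) hj).eval_eq h0⟩
  · exact ⟨hpairs (by norm_num), fun i hi hj h0 => (HasValue.row hj hq).eval_eq h0⟩
  · exact ⟨hpairs (by norm_num), fun i hi hj h0 => (HasValue.col hj hq).eval_eq h0⟩
  · exact ⟨hlevel (by norm_num), fun i hi hj h0 => (HasValue.levelsA (h1 (by norm_num))
      (h2 (by norm_num)) (h3 (by norm_num)) (h4 (by norm_num)) hq hR hi hj).eval_eq h0⟩
  · exact ⟨hlevel (by norm_num), fun i hi hj h0 => (HasValue.levelsB (h1 (by norm_num))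
      (h2 (by norm_num)) (h3 (by norm_num)) (h4 (by norm_num)) hq hR hi hj).eval_eq h0⟩
  · exact ⟨hlevel (by norm_num), fun i hi hj h0 => (HasValue.levelsC (h1 (by norm_num))
      (h2 (by norm_num)) (hτ 5 (by norm_num) (by norm_num)) (hτ 6 (by norm_num) (by norm_num))
      hR hi hj).eval_eq h0⟩
  · exact ⟨hpairs (by norm_num), fun i hi hj h0 => (HasValue.cutVal (h1 (by norm_num))
      (h2 (by norm_num)) (h3 (by norm_num)) (h4 (by norm_num))
      (hτ 7 (by norm_num) (by norm_num)) hq hR hi).eval_eq h0⟩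
  · exact ⟨hpairs (by norm_num), fun i hi hj h0 => (HasValue.bestVal (h1 (by norm_num))
      (hτ 8 (by norm_num) (by norm_num)) hi hj).eval_eq h0⟩
  · exact ⟨(HasValue.arr one_ne_zero (.bound (val_blockB q n))
      (h1 (by norm_num) _ (by rw [powLen]; omega))).eval_eq_nil, fun i hi hj h0 =>
      (HasValue.lastVal (h1 (by norm_num)) (h3 (by norm_num)) (h4 (by norm_num))
        (h9 (by norm_num)) hq hj).eval_eq h0⟩
  · exact ⟨(HasValue.bound rfl).eval_eq_nil, fun i hi hj h0 =>
      (HasValue.cutInd (h1 (by norm_num)) (h3 (by norm_num)) (h4 (by norm_num))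
        (h9 (by norm_num)) (hτ 10 (by norm_num) (by norm_num)) hi).eval_eq h0⟩
  · exact ⟨hhalf, fun i hi hj h0 => (HasValue.elem (HasValue.inside (h11 (by norm_num)))).eval_eq h0⟩
  · exact ⟨(HasValue.arr one_ne_zero (.bound rfl) (h1 (by norm_num) (n / 2) (by omega))).eval_eq_nil,
      fun i hi hj h0 => (HasValue.opt hm (hp (by norm_num)) (h12 (by norm_num)) (by norm_num)
        (hL ▸ hi) hj).eval_eq h0⟩
  · exact ⟨((HasValue.bound rfl).add (.const 1)).eval_eq_nil, fun i hi hj h0 =>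
      (HasValue.chain hm (hp (by norm_num)) (hc (by norm_num)) (h13 (by norm_num)) hj).eval_eq h0⟩
  · exact ⟨hhalf, fun i hi hj h0 => (HasValue.pos hm (hp (by norm_num)) (hL ▸ hi)
      (hL ▸ hτ 14 (by norm_num) (by norm_num))).eval_eq h0⟩
  · exact ⟨hhalf', fun i hi hj h0 =>
      (HasValue.elem (HasValue.outside (h11 (by norm_num)))).eval_eq h0⟩
  · exact ⟨(HasValue.arr one_ne_zero (.bound rfl)
        (h1 (by norm_num) ((n + 1) / 2) (by omega))).eval_eq_nil,
      fun i hi hj h0 => (HasValue.opt hm' (hp' (by norm_num)) (h16 (by norm_num)) (by norm_num)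
        (hL' ▸ hi) hj).eval_eq h0⟩
  · exact ⟨((HasValue.bound rfl).add (.const 1)).eval_eq_nil, fun i hi hj h0 =>
      (HasValue.chain hm' (hp' (by norm_num)) (hc' (by norm_num)) (h17 (by norm_num)) hj).eval_eq h0⟩
  · exact ⟨hhalf', fun i hi hj h0 => (HasValue.pos hm' (hp' (by norm_num)) (hL' ▸ hi)
      (hL' ▸ hτ 18 (by norm_num) (by norm_num))).eval_eq h0⟩
  · exact ⟨(HasValue.bound rfl).eval_eq_nil, fun i hi hj h0 => (HasValue.outPos
      (h11 (by norm_num)) hL hL' hi (hτ 15 (by norm_num) (by norm_num))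
      (hτ 19 (by norm_num) (by norm_num))).eval_eq h0⟩

/-! ### Bounds on the sizes of the tables and on their contents -/

/-- The number of bits that suffices for all numbers in the tables. -/
def bits (n : ℕ) : ℕ := depth q n + R.size * depth q n + powLen S n + 1

/-- Up to `powLen`, the levels of Yates' algorithm are the largest tables. The matrices have `(2 ^ q
* 2 ^ q) ^ d ≤ R ^ d` entries, and this already exceeds the `2 ^ ((n + 1) / 2)` subsets of a half,
because `n` is at most three block lengths. -/
theorem tableLen_le (hq : 0 < q) (hR : 2 ^ q * 2 ^ q ≤ R) (b : ℕ) :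
    tableLen S n b ≤ (depth q n + 1) * R ^ depth q n + powLen S n := by
  have hR0 : 0 < R ^ depth q n := pow_pos (lt_of_lt_of_le (by positivity) hR) _
  have h1 : R ^ depth q n ≤ (depth q n + 1) * R ^ depth q n :=
    Nat.le_mul_of_pos_left _ (Nat.succ_pos _)
  have h2 : (2 ^ q * 2 ^ q) ^ depth q n ≤ R ^ depth q n := Nat.pow_le_pow_left hR _
  have h3 : depth q n + 1 ≤ (depth q n + 1) * R ^ depth q n := Nat.le_mul_of_pos_right _ hR0
  have h4 : n + 2 ≤ powLen S n := by rw [powLen]; omega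
  have h5 : ∀ m, m ≤ 2 * blockLen q n → 2 ^ m ≤ (2 ^ q * 2 ^ q) ^ depth q n := fun m hm => by
    rw [two_pow_mul_pow, mul_assoc]
    exact Nat.pow_le_pow_right (by norm_num) hm
  have h6 := h5 (blockLen q n) (by omega)
  have h7 := le_three_mul_blockLen hq n
  have h7' : 0 < blockLen q n := Nat.mul_pos hq (Nat.succ_pos _)
  have h8 := h5 (n / 2) (by omega)
  have h9 := h5 ((n + 1) / 2) (by omega)
  unfold tableLen
  split <;> omega

theorem tableLen_lt (hq : 0 < q) (hR : 2 ^ q * 2 ^ q ≤ R) (b : ℕ) :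
    tableLen S n b < 2 ^ bits S n := by
  refine (tableLen_le S hq hR b).trans_lt ?_
  have h1 : R ^ depth q n ≤ 2 ^ (R.size * depth q n) := by
    rw [pow_mul]; exact Nat.pow_le_pow_left (Nat.lt_size_self _).le _
  have h2 : (depth q n + 1) * R ^ depth q n ≤ 2 ^ (depth q n + R.size * depth q n) := by
    rw [pow_add]; exact Nat.mul_le_mul Nat.lt_two_pow_self h1
  have h3 : powLen S n < 2 ^ powLen S n := Nat.lt_two_pow_self
  have h4 : 2 ^ (depth q n + R.size * depth q n) ≤ 2 ^ (depth q n + R.size * depth q n + powLen S n) :=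
    Nat.pow_le_pow_right (by norm_num) (by omega)
  have h5 : 2 ^ powLen S n ≤ 2 ^ (depth q n + R.size * depth q n + powLen S n) :=
    Nat.pow_le_pow_right (by norm_num) (by omega)
  rw [bits, pow_succ]
  omega

theorem posOf_le (L : Finset (Fin n)) (j : ℕ) : posOf G L j ≤ L.card := Nat.sub_le _ _

theorem content_lt (hq : 0 < q) (hR : 2 ^ q * 2 ^ q ≤ R) {b i : ℕ} (hi : i < tableLen S n b) :
    content G S b i < 2 ^ bits S n := by
  have hk : 1 < 2 ^ q := Nat.one_lt_two_pow hq.ne'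
  have hR0 : 0 < R := lt_of_lt_of_le (by positivity) hR
  have hpow : ∀ m ≤ powLen S n, 2 ^ m < 2 ^ bits S n := fun m hm =>
    Nat.pow_lt_pow_right (by norm_num) (by rw [bits]; omega)
  have hsmall : ∀ m ≤ powLen S n, m < 2 ^ bits S n := fun m hm =>
    Nat.lt_two_pow_self.trans (hpow m hm)
  have hmod := hpow (modBits S n) (by rw [powLen]; omega)
  have hblock := hpow (blockLen q n) (by rw [powLen]; omega)
  have hidx : ∀ i < (2 ^ q * 2 ^ q) ^ depth q n, rowIdx (2 ^ q) i < 2 ^ blockLen q n ∧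
      colIdx (2 ^ q) i < 2 ^ blockLen q n := fun i hi => by
    rw [← two_pow_pow_depth]; exact idx_lt hk hi
  have hyates : ∀ (f : ℕ → ℕ → ℤ) (a b : ℕ) (x : ℕ → ℤ), yatesTable f a b (depth q n)
      (R ^ depth q n) (2 ^ modBits S n) x i < 2 ^ bits S n := fun f a b x => by
    rw [yatesTable]
    split_ifs
    · exact (residue_lt (by positivity) _).trans hmod
    · positivity
  have hsq : n * n + 1 ≤ modBits S n := (sq_lt_topExp q n).trans (topExp_lt_modBits S n)
  have hcard : ∀ L : Finset (Fin n), L.card ≤ n := fun L => by simpa using Finset.card_le_univ L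
  have hn : ∀ m, m ≤ 2 * n → m < 2 ^ bits S n := fun m hm => hsmall m (by
    rw [powLen]; have := le_three_mul_blockLen hq n; omega)
  have hopt : ∀ L T, optOf G L T < 2 ^ bits S n := fun L T =>
    hsmall _ ((optOf_le_sq G L T).trans (by rw [powLen]; omega))
  have hchain : ∀ (L : Finset (Fin n)) t, chainOf G L t < 2 ^ bits S n := fun L t =>
    (chainOf_lt G L t).trans (hpow _ ((hcard L).trans (by rw [powLen]; omega)))
  have hind : ∀ (L : Finset (Fin n)) v, ind L v ≤ 1 := fun L v => by rw [ind]; split_ifs <;> simp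
  unfold content
  split
  · exact Nat.pow_lt_pow_right (by norm_num) (by change i < powLen S n at hi; rw [bits]; omega)
  · have h1 : R ^ i ≤ R ^ depth q n := Nat.pow_le_pow_right hR0 (Nat.lt_succ_iff.1 hi)
    refine lt_of_le_of_lt (h1.trans ?_) (tableLen_lt S hq hR 5)
    exact Nat.le_mul_of_pos_left _ (Nat.succ_pos _)
  · exact (hidx i hi).1.trans hblock
  · exact (hidx i hi).2.trans hblock
  · exact hyates _ _ _ _
  · exact hyates _ _ _ _
  · exact hyates _ _ _ _
  · exact hsmall _ ((foldVal_search _ _).1.trans (hsq.trans (by rw [powLen]; omega)))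
  · refine (bestVal_le G _ _ _ i).trans_lt ?_
    rw [two_pow_mul_pow, mul_assoc]
    change _ * 2 ^ (2 * blockLen q n) < _
    calc _ ≤ 2 ^ modBits S n * 2 ^ (2 * blockLen q n) :=
        Nat.mul_le_mul_right _ (hsq.trans Nat.lt_two_pow_self.le)
      _ = 2 ^ (modBits S n + 2 * blockLen q n) := (pow_add _ _ _).symm
      _ < _ := hpow _ (by rw [powLen]; omega)
  · exact ((lastOf_le _ _).trans_lt hi).trans hblock
  · exact (hind _ _).trans_lt (Nat.one_lt_two_pow (Nat.succ_ne_zero _))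
  · exact hn _ ((elemOf_le _ _).trans (by omega))
  · exact hopt _ _
  · exact hchain _ _
  · exact hn _ ((posOf_le G _ _).trans ((hcard _).trans (by omega)))
  · exact hn _ ((elemOf_le _ _).trans (by omega))
  · exact hopt _ _
  · exact hchain _ _
  · exact hn _ ((posOf_le G _ _).trans ((hcard _).trans (by omega)))
  · refine hn _ ?_
    rw [outPos]
    have h1 := (posOf_le G (minCut G q) (rankOf (minCut G q) i)).trans (hcard _)
    have h2 := (posOf_le G (minCut G q)ᶜ (rankOf (minCut G q)ᶜ i)).trans (hcard _)
    split_ifs <;> omega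
  · positivity

end Program

/-! ### Assembling the output ordering and the time bound -/

theorem exists_isConcat {V : Type*} [Fintype V] [DecidableEq V] (L : Finset V) (πL : Ordering L)
    (πR : Ordering (Lᶜ : Finset V)) : ∃ π : Ordering V, IsConcat π L πL πR := by
  have hL : ∀ v, (πL v : ℕ) < L.card := fun v => (πL v).2.trans_eq (Fintype.card_coe L)
  have hR : ∀ v, (πR v : ℕ) < Lᶜ.card := fun v => (πR v).2.trans_eq (Fintype.card_coe Lᶜ)
  have hcard := Finset.card_add_card_compl L
  let f : V → Fin (Fintype.card V) := fun v =>
    if h : v ∈ L then ⟨πL ⟨v, h⟩, by have := hL ⟨v, h⟩; omega⟩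
    else ⟨L.card + πR ⟨v, Finset.mem_compl.2 h⟩, by
      have := hR ⟨v, Finset.mem_compl.2 h⟩; omega⟩
  have hf : ∀ v (h : v ∈ L), (f v : ℕ) = πL ⟨v, h⟩ := fun v h => by simp only [f, dif_pos h]
  have hf' : ∀ v (h : v ∉ L), (f v : ℕ) = L.card + πR ⟨v, Finset.mem_compl.2 h⟩ :=
    fun v h => by simp only [f, dif_neg h]
  have hinj : Function.Injective f := fun u v huv => by
    have huv := congrArg Fin.val huv
    by_cases hu : u ∈ L <;> by_cases hv : v ∈ L
    · rw [hf u hu, hf v hv] at huv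
      exact congrArg Subtype.val (πL.injective (Fin.ext huv))
    · rw [hf u hu, hf' v hv] at huv
      have := hL ⟨u, hu⟩
      omega
    · rw [hf' u hu, hf v hv] at huv
      have := hL ⟨v, hv⟩
      omega
    · rw [hf' u hu, hf' v hv] at huv
      exact congrArg Subtype.val (πR.injective (Fin.ext (Nat.add_left_cancel huv)))
  refine ⟨Equiv.ofBijective f ((Fintype.bijective_iff_injective_and_card f).2 ⟨hinj, by simp⟩),
    fun v => hf v v.2, fun v => hf' v (Finset.mem_compl.1 v.2)⟩

theorem outPos_eq {n : ℕ} (G : Digraph (Fin n)) {L : Finset (Fin n)} (hL : L.card = n / 2)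
    {πL : Ordering L} {πR : Ordering (Lᶜ : Finset (Fin n))} {π : Ordering (Fin n)}
    (hπL : ∀ v : L, (πL v : ℕ) = posOf G L (rankOf L (v : Fin n)))
    (hπR : ∀ v : (Lᶜ : Finset (Fin n)), (πR v : ℕ) = posOf G Lᶜ (rankOf Lᶜ (v : Fin n)))
    (hπ : IsConcat π L πL πR) (v : Fin n) : outPos G L v = π v := by
  by_cases hv : v ∈ L
  · have h : ind L v = 1 := if_pos ⟨v.2, hv⟩
    rw [outPos, if_pos h, hπ.1 ⟨v, hv⟩, hπL]
  · rw [outPos, if_neg, hπ.2 ⟨v, Finset.mem_compl.2 hv⟩, hπR, hL]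
    rw [ind, if_neg fun h => hv h.2]
    exact zero_ne_one

open Polynomial in
theorem exists_eval_le_pow (p : ℕ[X]) : ∃ K c : ℕ, ∀ n, p.eval n ≤ K * (n + 1) ^ c := by
  induction p using Polynomial.induction_on' with
  | add p r hp hr =>
    obtain ⟨K, c, h⟩ := hp
    obtain ⟨K', c', h'⟩ := hr
    refine ⟨K + K', c + c', fun n => ?_⟩
    rw [eval_add, Nat.add_mul]
    exact Nat.add_le_add
      ((h n).trans (Nat.mul_le_mul_left _ (Nat.pow_le_pow_right (Nat.succ_pos _) (by omega))))
      ((h' n).trans (Nat.mul_le_mul_left _ (Nat.pow_le_pow_right (Nat.succ_pos _) (by omega))))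
  | monomial k a =>
    refine ⟨a, k, fun n => ?_⟩
    rw [eval_monomial]
    exact Nat.mul_le_mul_left _ (Nat.pow_le_pow_left (Nat.le_succ n) _)

theorem Bound.exists_val_le (B : Bound) : ∃ p : Polynomial ℕ, ∀ n, B.val n ≤ p.eval n := by
  obtain ⟨p, hp⟩ := B.exists_poly
  exact ⟨p, fun n => (hp n n (fun _ => n) le_rfl rfl).1⟩

/-- The number of bits as a loop bound. -/
def bitsB {q R : ℕ} (S : BilinearAlgorithm (2 ^ q) R) : Bound :=
  .add (.add (.add (depthB q) (.mul (.const R.size) (depthB q))) (powB S)) (.const 1)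

/-- Rounding the depth up gives `q * depth q n ≤ n / 3 + q`, so it costs only the constant factor `2
^ (w * q)`. The exponent `w` is nonnegative because `R ≥ 1`, which makes the power monotone in the
depth. -/
theorem pow_depth_le {q R : ℕ} {w : ℝ} (hq : 0 < q) (hR : 2 ^ q * 2 ^ q ≤ R)
    (hw : (R : ℝ) ≤ ((2 : ℝ) ^ q) ^ w) (n : ℕ) :
    ((R ^ depth q n : ℕ) : ℝ) ≤ (2 : ℝ) ^ (w * q) * (2 : ℝ) ^ (w * n / 3) := by
  have hR1 : (1 : ℝ) ≤ R := by
    exact_mod_cast (Nat.succ_le_of_lt (lt_of_lt_of_le (by positivity) hR))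
  have hw0 : 0 ≤ w := by
    by_contra hneg
    have := Real.rpow_lt_one_of_one_lt_of_neg (one_lt_pow₀ (one_lt_two (α := ℝ)) hq.ne')
      (not_le.1 hneg)
    linarith
  have h1 : (q : ℝ) * depth q n ≤ n / 3 + q := by
    have h2 : 3 * q * (n / (3 * q)) ≤ n := Nat.mul_div_le n (3 * q)
    have h3 : (3 : ℝ) * q * ((n / (3 * q) : ℕ) : ℝ) ≤ n := by exact_mod_cast h2
    rw [depth]
    push_cast at h3 ⊢
    linarith
  calc ((R ^ depth q n : ℕ) : ℝ) ≤ (((2 : ℝ) ^ q) ^ w) ^ depth q n := by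
        rw [Nat.cast_pow]
        exact pow_le_pow_left₀ (by linarith) hw _
    _ = (2 : ℝ) ^ (w * (q * depth q n)) := by
        rw [← Real.rpow_natCast 2 q, ← Real.rpow_mul two_pos.le, ← Real.rpow_natCast _ (depth q n),
          ← Real.rpow_mul two_pos.le]
        congr 1
        ring
    _ ≤ (2 : ℝ) ^ (w * (n / 3 + q)) :=
        Real.rpow_le_rpow_of_exponent_le one_le_two (mul_le_mul_of_nonneg_left h1 hw0)
    _ = _ := by
        rw [← Real.rpow_add two_pos]
        congr 1
        ring

-- The program depends only on the bilinear algorithm. The number of bits is a loop bound and hence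
-- polynomial in `n`, so the only exponential factor in the time is `R ^ depth q n`.
open Polynomial in
theorem exists_prog_outPos {q R : ℕ} (S : BilinearAlgorithm (2 ^ q) R) (hq : 0 < q)
    (hR : 2 ^ q * 2 ^ q ≤ R) : ∃ (P : Prog) (K c : ℕ), ∀ (n : ℕ) (G : Digraph (Fin n)),
      ∃ t ≤ K * (n + 1) ^ c * R ^ depth q n, ∃ m, Exec P (graphInput G) t m ∧
        ∀ v < n, m v = outPos G (minCut G q) v := by
  obtain ⟨P, p, hP⟩ := exists_prog_of_tables (tables S) 20 (by norm_num) (by simp [tables])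
  obtain ⟨b, hb⟩ := (bitsB S).exists_val_le
  obtain ⟨d, hd⟩ := (Bound.add (Bound.add (depthB q) (.const 2)) (powB S)).exists_val_le
  obtain ⟨K, c, hK⟩ := exists_eval_le_pow (p.comp b * d)
  refine ⟨P, K, c, fun n G => ?_⟩
  have hbits : n + 1 ≤ bits S n := by rw [bits, powLen]; omega
  obtain ⟨t, ht, m, hm, hout⟩ := hP (bits S n) n G (tableLen S n) (content G S)
    ((depth q n + 1) * R ^ depth q n + powLen S n) (by omega) (by omega) (tableLen_lt S hq hR)
    (tableLen_le S hq hR) (fun b i hi => content_lt G S hq hR hi) (computes_content G S hq hR) le_rfl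
  refine ⟨t, ht.trans ?_, m, hm, hout⟩
  have hR0 : 0 < R ^ depth q n := pow_pos (lt_of_lt_of_le (by positivity) hR) _
  have h1 : (depth q n + 1) * R ^ depth q n + powLen S n + 1 ≤ d.eval n * R ^ depth q n := by
    calc _ ≤ (depth q n + 1) * R ^ depth q n + (powLen S n + 1) * R ^ depth q n := by
          have := Nat.le_mul_of_pos_right (powLen S n + 1) hR0
          omega
      _ = (depth q n + 2 + powLen S n) * R ^ depth q n := by ring
      _ ≤ _ := Nat.mul_le_mul_right _ (hd n)
  calc _ ≤ p.eval (b.eval n) * (d.eval n * R ^ depth q n) :=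
        Nat.mul_le_mul (polynomial_eval_mono p (hb n)) h1
    _ = (p.comp b * d).eval n * R ^ depth q n := by rw [eval_mul, eval_comp, mul_assoc]
    _ ≤ _ := Nat.mul_le_mul_right _ (hK n)

end DirCutwidth

theorem mainTheorem5 (ε : ℝ) (hε : 0 < ε) :
    ∃ (P : DirCutwidth.Prog) (K : ℝ) (c : ℕ),
      ∀ (n : ℕ) (G : Digraph (Fin n)), (∀ v, ¬ G.Adj v v) →
        ∃ (t : ℕ) (m : DirCutwidth.Mem) (π : DirCutwidth.Ordering (Fin n)),
          DirCutwidth.Exec P (DirCutwidth.graphInput G) t m ∧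
          (t : ℝ) ≤ K * ((n : ℝ) + 1) ^ c * (2 : ℝ) ^ ((DirCutwidth.omega + ε) * n / 3) ∧
          DirCutwidth.IsOutput m π ∧
          DirCutwidth.width G π ≤ 2 * DirCutwidth.dirCutwidth G ∧
          ∃ (L : Finset (Fin n)) (πL : DirCutwidth.Ordering L)
            (πR : DirCutwidth.Ordering (Lᶜ : Finset (Fin n))),
            DirCutwidth.IsMinCut G (n / 2) L ∧
            DirCutwidth.width (DirCutwidth.induced G L) πL =
              DirCutwidth.dirCutwidth (DirCutwidth.induced G L) ∧
            DirCutwidth.width (DirCutwidth.induced G Lᶜ) πR =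
              DirCutwidth.dirCutwidth (DirCutwidth.induced G Lᶜ) ∧
            DirCutwidth.IsConcat π L πL πR := by
  obtain ⟨q, R, hq, hR, hRle, ⟨S⟩⟩ := DirCutwidth.exists_bilinearAlgorithm_rpow hε
  obtain ⟨P, K, c, hP⟩ := DirCutwidth.exists_prog_outPos S hq hR
  -- The second factor of the constant pays for rounding up the recursion depth in `pow_depth_le`.
  refine ⟨P, K * (2 : ℝ) ^ ((DirCutwidth.omega + ε) * q), c, fun n G _ => ?_⟩
  obtain ⟨t, ht, m, hm, hout⟩ := hP n G
  have hL := DirCutwidth.isMinCut_minCut G hq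
  obtain ⟨πL, hπL, hwL⟩ := DirCutwidth.exists_ordering_posOf G (DirCutwidth.minCut G q)
  obtain ⟨πR, hπR, hwR⟩ := DirCutwidth.exists_ordering_posOf G (DirCutwidth.minCut G q)ᶜ
  obtain ⟨π, hπ⟩ := DirCutwidth.exists_isConcat (DirCutwidth.minCut G q) πL πR
  refine ⟨t, m, π, hm, ?_, fun v => ?_, ?_, DirCutwidth.minCut G q, πL, πR, hL, hwL, hwR, hπ⟩
  · calc (t : ℝ) ≤ ((K * (n + 1) ^ c * R ^ DirCutwidth.depth q n : ℕ) : ℝ) := by exact_mod_cast ht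
      _ = K * ((n : ℝ) + 1) ^ c * ((R ^ DirCutwidth.depth q n : ℕ) : ℝ) := by push_cast; ring
      _ ≤ K * ((n : ℝ) + 1) ^ c * ((2 : ℝ) ^ ((DirCutwidth.omega + ε) * q) *
          (2 : ℝ) ^ ((DirCutwidth.omega + ε) * n / 3)) :=
        mul_le_mul_of_nonneg_left (DirCutwidth.pow_depth_le hq hR hRle n) (by positivity)
      _ = _ := by ring
  · rw [hout v v.2]
    exact DirCutwidth.outPos_eq G hL.1 hπL hπR hπ v
  · exact DirCutwidth.width_concat_le_two_mul hπ (by simpa using Nat.div_le_self n 2) hL hwL hwR
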